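/- **Setting.** Let $n,k$ be integers with $1\le k\le n-2$, let $R>0$, and let $f(x)=|x|^{-k}$ on $\mathbb R^n\setminus\{0\}$. For an embedded $k$-dimensional $C^2$ submanifold $M\subset\mathbb R^n$ let $e_1,\dots,e_k$ be an orthonormal basis of the tangent space $T_pM$, $D$ the flat connection of $\mathbb R^n$, $(\cdot)^\perp$ the projection to the normal space of $M$ in $\mathbb R^n$, $\mathbf B(u,v)=(D_uV)^\perp$ (with $V$ a tangent field extending $v$) the second fundamental form, $\mathbf H=\sum_i\mathbf B(e_i,e_i)$ the mean curvature vector, and $\mathcal H_k$ the $k$-dimensional Hausdorff measure. Let $U\subset\mathbb R^n$ be open. A compactly supported deformation of $M$ in $U$ is a $C^2$ family $\varphi_t:M\to\mathbb R^n$, $-\varepsilon<t<\varepsilon$ ($C^2$ in $(t,x)$ jointly), with $\varphi_0=\mathrm{id}$ and $\varphi_t(x)=x$ for all $t$ and all $x\in M\setminus K$, for some compact $K\subset U$. $M$ is *$f$-stationary* in $U$ if $\frac{d}{dt}\big|_{t=0}\int_{\varphi_t(M)}f\,d\mathcal H_k$ exists and equals $0$ for every such deformation. An $f$-stationary $M$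 is *$f$-stable* in $U$ if $$\int_M f\Big[\sum_{i,j=1}^k\langle\mathbf B(e_i,e_j),X\rangle^2+\langle\mathbf H,X\rangle^2\Big]d\mathcal H_k\;\le\;\int_M\Big( f\sum_{i=1}^k\big|(D_{e_i}X)^\perp\big|^2+\mathrm{Hess}f(X,X)\Big)d\mathcal H_k\qquad(1)$$ for every $C^1$ normal field $X$ along $M$ with compact support in $U$; an $f$-stationary $M$ that is not $f$-stable in $U$ is *$f$-unstable* in $U$. **Theorem.** Let $M$ be a nonempty compact embedded $k$-dimensional $C^2$ submanifold (without boundary) of $\mathbb R^n$ that is contained in the sphere $S^{n-1}(R)=\{|x|=R\}$ and is minimal in it, i.e. the mean curvature vector of $M$ in $S^{n-1}(R)$ vanishes. Then $M$ is $f$-unstable in every open $U\subset\mathbb R^n$ containing $M$ (for instance in $\mathbb R^n$ and in $\mathbb R^n\setminus\{0\}$). More precisely: 1. $M$ is $f$-stationary but not $f$-stable in $U$. 2. For every $C^1$ normal field $X$ along $M$ that is tangent to the sphere, inequality (1) is equivalent to the stability inequality for the area of $M$ in the sphere, $$\int_M\Big(\sum_{i,j=1}^k\langle\mathbf B^S(e_i,e_j),X\rangle^2+\frac{k}{R^2}|X|^2\Big)d\mathcal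 H_k\;\le\;\int_M\sum_{i=1}^k\big|\nabla^\perp_{e_i}X\big|^2d\mathcal H_k,\qquad(2)$$ where $\mathbf B^S$ and $\nabla^\perp$ are the second fundamental form and the normal connection of $M$ in $S^{n-1}(R)$. 3. Inequality (2) fails for some $C^1$ normal field $X$ along $M$ that is tangent to the sphere. -/

import Mathlib

open MeasureTheory Set
open scoped RealInnerProductSpace

noncomputable section

namespace WeightedArea

variable {n : ℕ}

/-- Euclidean space `ℝⁿ`. -/
abbrev Euc (n : ℕ) : Type := EuclideanSpace ℝ (Fin n)

/-- `M ⊆ ℝⁿ` is an embedded `k`-dimensional submanifold of class `C²` (without boundary): near each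
of its points a `C²` diffeomorphism between open sets of `ℝⁿ` flattens `M` to an open piece of a
`k`-dimensional linear subspace. -/
def IsC2Submanifold (k : ℕ) (M : Set (Euc n)) : Prop :=
  ∀ p ∈ M, ∃ (Φ : OpenPartialHomeomorph (Euc n) (Euc n)) (W : Submodule ℝ (Euc n)),
    p ∈ Φ.source ∧ Module.finrank ℝ W = k ∧
    ContDiffOn ℝ 2 Φ Φ.source ∧ ContDiffOn ℝ 2 Φ.symm Φ.target ∧
    ∀ x ∈ Φ.source, (x ∈ M ↔ Φ x ∈ W)

/-- The tangent space `T_pM`, as a linear subspace of `ℝⁿ`. On a submanifold the tangent cone at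
`p` already is a linear subspace, so that the span adds nothing. -/
def tangentSpace (M : Set (Euc n)) (p : Euc n) : Submodule ℝ (Euc n) :=
  Submodule.span ℝ (tangentConeAt ℝ M p)

/-- The normal space `N_pM = (T_pM)^⊥` of `M` in `ℝⁿ`. -/
def normalSpace (M : Set (Euc n)) (p : Euc n) : Submodule ℝ (Euc n) :=
  (tangentSpace M p)ᗮ

/-- The derivative `D_v Y` at `p ∈ M` of a vector field `Y` along `M` in the direction of a
tangent vector `v ∈ T_pM`. Two derivatives of `Y` within `M` at `p` agree on `T_pM`, so for
tangent `v` nothing depends on the choice made by `fderivWithin`. -/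
def tangentialDeriv (M : Set (Euc n)) (Y : Euc n → Euc n) (p v : Euc n) : Euc n :=
  fderivWithin ℝ Y M p v

/-- An orthonormal basis `e₁, …, e_k` of `T_pM`. -/
def tangentFrame (M : Set (Euc n)) (p : Euc n) :
    OrthonormalBasis (Fin (Module.finrank ℝ (tangentSpace M p))) ℝ (tangentSpace M p) :=
  stdOrthonormalBasis ℝ (tangentSpace M p)

/-- The tangent field `x ↦ (v)^⊤` along `M` extending the tangent vector `v ∈ T_pM`. -/
def tangentExtension (M : Set (Euc n)) (v : Euc n) : Euc n → Euc n :=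
  fun x => (tangentSpace M x).starProjection v

/-- The second fundamental form `B(u, v) = (D_u V)^⊥` of `M` in `ℝⁿ` at `p`, where `V` is a tangent
field with `V(p) = v`. -/
def secondFundamentalForm (M : Set (Euc n)) (p u v : Euc n) : Euc n :=
  (normalSpace M p).starProjection (tangentialDeriv M (tangentExtension M v) p u)

/-- The mean curvature vector `H = ∑ᵢ B(eᵢ, eᵢ)` of `M` in `ℝⁿ`. -/
def meanCurvature (M : Set (Euc n)) (p : Euc n) : Euc n :=
  ∑ i, secondFundamentalForm M p (tangentFrame M p i) (tangentFrame M p i)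

/-! ### Submanifolds of a sphere centred at the origin -/

/-- For `M` in a sphere `S` centred at the origin, the normal space of `M` in `S` at `p`, i.e. the
orthogonal complement of `T_pM` in `T_pS = p^⊥`. -/
def sphereNormalSpace (M : Set (Euc n)) (p : Euc n) : Submodule ℝ (Euc n) :=
  normalSpace M p ⊓ (Submodule.span ℝ {p})ᗮ

/-- The second fundamental form of `M` as a submanifold of the sphere. (The Levi-Civita connection
of the sphere is the tangential part of `D`, so `(∇_u V)^⊥` is the component of `D_u V` in the
normal space of `M` in the sphere.) -/
def sphereSecondFundamentalForm (M : Set (Euc n)) (p u v : Euc n) : Euc n :=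
  (sphereNormalSpace M p).starProjection (tangentialDeriv M (tangentExtension M v) p u)

/-- `M` is minimal as a submanifold of the sphere of radius `R` centred at the origin: it lies in
the sphere and its mean curvature vector in the sphere vanishes. -/
def IsMinimalInSphere (R : ℝ) (M : Set (Euc n)) : Prop :=
  M ⊆ Metric.sphere 0 R ∧
    ∀ p ∈ M, ∑ i, sphereSecondFundamentalForm M p (tangentFrame M p i) (tangentFrame M p i) = 0

/-- A `C¹` field along `M`, normal to `M` and tangent to the sphere. -/
structure IsSphericalNormalField (M : Set (Euc n)) (X : Euc n → Euc n) : Prop where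
  contDiffOn : ContDiffOn ℝ 1 X M
  normal : ∀ p ∈ M, X p ∈ sphereNormalSpace M p

/-- The stability inequality, tested on `X`, for the `k`-dimensional area of a minimal submanifold
`M` of the sphere of radius `R`:
`∫_M ∑ ⟨B(eᵢ,eⱼ),X⟩² + (k/R²)|X|² ≤ ∫_M |∇^⊥ X|²`, with the second fundamental form `B` and the
normal connection `∇^⊥` of `M` in the sphere. -/
def SphereAreaStabilityInequality (k : ℕ) (R : ℝ) (M : Set (Euc n)) (X : Euc n → Euc n) : Prop :=
  ∫ p in M, ((∑ i, ∑ j,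
        ⟪sphereSecondFundamentalForm M p (tangentFrame M p i) (tangentFrame M p j), X p⟫ ^ 2)
      + k / R ^ 2 * ‖X p‖ ^ 2) ∂μHE[k]
    ≤ ∫ p in M, (∑ i, ‖(sphereNormalSpace M p).starProjection
        (tangentialDeriv M X p (tangentFrame M p i))‖ ^ 2) ∂μHE[k]

/-! ### The weighted area functional -/

/-- The weighted area `E_f(M) = ∫_M f dH_k`, for the `k`-dimensional Hausdorff measure. -/
def weightedArea (f : Euc n → ℝ) (k : ℕ) (M : Set (Euc n)) : ℝ :=
  ∫ x in M, f x ∂μHE[k]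

/-- `φ` is a compactly supported deformation of `M` in `U` with parameter in `(-ε, ε)`: it is `C²`
on `(-ε, ε) × M`, `φ₀` is the identity of `M`, and every `φ_t` fixes all points of `M` outside of
some compact `K ⊆ U`. -/
structure IsDeformation (M U : Set (Euc n)) (ε : ℝ) (φ : ℝ → Euc n → Euc n) : Prop where
  pos : 0 < ε
  contDiffOn : ContDiffOn ℝ 2 (fun q : ℝ × Euc n => φ q.1 q.2) (Ioo (-ε) ε ×ˢ M)
  initial : ∀ x ∈ M, φ 0 x = x
  support : ∃ K : Set (Euc n), IsCompact K ∧ K ⊆ U ∧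
    ∀ t ∈ Ioo (-ε) ε, ∀ x ∈ M \ K, φ t x = x

/-- The submanifold `M` is `f`-stationary in `U`: the first variation
`d/dt|_{t=0} E_f(φ_t(M))` exists and is zero for all compactly supported deformations in `U`. -/
def IsFStationary (f : Euc n → ℝ) (k : ℕ) (U M : Set (Euc n)) : Prop :=
  ∀ (ε : ℝ) (φ : ℝ → Euc n → Euc n), IsDeformation M U ε φ →
    HasDerivAt (fun t : ℝ => weightedArea f k (φ t '' M)) 0 0

/-- A `C¹` normal field along `M`, compactly supported in `U`. -/
structure IsNormalVariationField (M U : Set (Euc n)) (X : Euc n → Euc n) : Prop where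
  contDiffOn : ContDiffOn ℝ 1 X M
  normal : ∀ p ∈ M, X p ∈ normalSpace M p
  support : ∃ K : Set (Euc n), IsCompact K ∧ K ⊆ U ∧ ∀ p ∈ M \ K, X p = 0

/-- The `f`-stability inequality, tested on a normal field `X`:
`∫_M f [∑ ⟨B(eᵢ,eⱼ),X⟩² + ⟨H,X⟩²] ≤ ∫_M f ∑ |(D_{eᵢ}X)^⊥|² + Hess f (X,X)`. -/
def FStabilityInequality (f : Euc n → ℝ) (k : ℕ) (M : Set (Euc n)) (X : Euc n → Euc n) : Prop :=
  ∫ p in M, f p * ((∑ i, ∑ j,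
        ⟪secondFundamentalForm M p (tangentFrame M p i) (tangentFrame M p j), X p⟫ ^ 2)
      + ⟪meanCurvature M p, X p⟫ ^ 2) ∂μHE[k]
    ≤ ∫ p in M, (f p * (∑ i, ‖(normalSpace M p).starProjection
        (tangentialDeriv M X p (tangentFrame M p i))‖ ^ 2)
      + fderiv ℝ (fderiv ℝ f) p (X p) (X p)) ∂μHE[k]

/-- The submanifold `M` is `f`-stable in `U`: it is `f`-stationary in `U` and satisfies the
`f`-stability inequality for all normal variation fields compactly supported in `U`. -/
def IsFStable (f : Euc n → ℝ) (k : ℕ) (U M : Set (Euc n)) : Prop :=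
  IsFStationary f k U M ∧
    ∀ X : Euc n → Euc n, IsNormalVariationField M U X → FStabilityInequality f k M X

/-- The submanifold `M` is `f`-unstable in `U`: it is `f`-stationary in `U`, but not `f`-stable. -/
def IsFUnstable (f : Euc n → ℝ) (k : ℕ) (U M : Set (Euc n)) : Prop :=
  IsFStationary f k U M ∧ ¬ IsFStable f k U M

end WeightedArea

end

open scoped RealInnerProductSpace

noncomputable section

set_option linter.unusedSectionVars false

/-! Write f = |x|^{-k}. Minimality in the sphere says that the mean curvature vector of M in ℝⁿ is
purely radial, H = -(k/R²)x. Hence a field Y along M satisfies div_M Y = div_M(Y^⊤) + (k/R²)⟨x,Y⟩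
(`IsC2Submanifold.surfaceDiv_eq`), while df(Y) = -kR^{-k-2}⟨x,Y⟩. In the first variation ∫ (f div_M
Y + df(Y)) the radial terms cancel, which singles out the exponent -k; what remains is R^{-k}∫
div_M(Y^⊤), zero by the divergence theorem.

If X is normal to M and tangent to the sphere, then ⟨H,X⟩ = 0, the derivatives D_uX have no radial
component, B and B^S agree when paired with X, and Hess f(X,X) = -kR^{-k-2}|X|². So (1) is (2)
multiplied by R^{-k}.

Inequality (2) is refuted by Simons' averaging argument. Take X_a to be the component of b_a normal
to M in the sphere, for an orthonormal basis (b_a) of ℝⁿ. Then ∇^⊥_u X_a = -B^S(u, b_a^⊤), so that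
after summation over a both ∑|∇^⊥X_a|² and ∑⟨B^S,X_a⟩² become |B^S|² (`sum_normalDerivNormSq`).
Adding up (2) would leave (k/R²)∫∑|X_a|² ≤ 0, although ∑|X_a|² = n-1-k ≥ 1 and M has positive finite
measure.

The remaining work is analysis on M. Functions on M are extended by local C² retractions, which
makes the tangent projection C¹; an area formula for Hausdorff measure comes from comparison with
linear maps; the divergence theorem comes from charts and a partition of unity. Sums over
`tangentFrame`, which need not depend continuously on the point, are converted to traces and
Hilbert-Schmidt norms involving the projection. -/

namespace WeightedArea

/-! ### Volume distortion, traces and projections -/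

section LinearAlgebra

variable {E : Type*} [NormedAddCommGroup E] [InnerProductSpace ℝ E] [FiniteDimensional ℝ E]
  [CompleteSpace E]

/-- The volume distortion of `A` on the range of the orthogonal projection `P`. -/
def jacobian (P A : E →L[ℝ] E) : ℝ :=
  √(P * star A * A * P + (1 - P)).det

/-- The operator on the right preserves T, acts there as (A|T)*(A|T) and acts as the identity on
E/T, so its determinant is the Gram determinant of A|T. Being an operator on all of E, it can be
differentiated while T varies. -/
theorem sq_normDet_domRestrict (T : Submodule ℝ E) (A : E →L[ℝ] E) :
    ((A : E →ₗ[ℝ] E).domRestrict T).normDet ^ 2 =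
      (T.starProjection * star A * A * T.starProjection + (1 - T.starProjection)).det := by
  set P := T.starProjection with hP
  set D : E →L[ℝ] E := P * star A * A * P + (1 - P) with hD
  have hP1 : ∀ u ∈ T, P u = u := fun u hu => Submodule.starProjection_eq_self_iff.2 hu
  have hPm : ∀ u, P u ∈ T := fun u => T.starProjection_apply_mem u
  have hDa : ∀ x, D x = P (star A (A (P x))) + (x - P x) := fun x => by simp [hD]
  have he : T ≤ T.comap (D : E →ₗ[ℝ] E) := by
    intro x hx
    simp only [Submodule.mem_comap, ContinuousLinearMap.coe_coe, hDa, hP1 x hx, sub_self, add_zero]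
    exact hPm _
  have h1 : (T.mapQ T (D : E →ₗ[ℝ] E) he) = LinearMap.id := by
    ext x
    simp only [LinearMap.coe_comp, Function.comp_apply, Submodule.mkQ_apply, Submodule.mapQ_apply,
      ContinuousLinearMap.coe_coe, LinearMap.id_comp]
    rw [Submodule.Quotient.eq, hDa]
    have : P (star A (A (P x))) + (x - P x) - x = P (star A (A (P x))) - P x := by abel
    rw [this]
    exact T.sub_mem (hPm _) (hPm _)
  have h2 : ((D : E →ₗ[ℝ] E).restrict he) =
      (((A : E →ₗ[ℝ] E).domRestrict T).adjoint ∘ₗ ((A : E →ₗ[ℝ] E).domRestrict T)) := by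
    refine LinearMap.ext fun x => ext_inner_right ℝ fun y => ?_
    rw [LinearMap.comp_apply, LinearMap.adjoint_inner_left]
    simp only [LinearMap.restrict_apply, Submodule.coe_inner, LinearMap.domRestrict_apply,
      ContinuousLinearMap.coe_coe, hDa, hP1 x x.2, sub_self, add_zero]
    rw [Submodule.inner_starProjection_left_eq_right, hP1 y y.2,
      ContinuousLinearMap.star_eq_adjoint, ContinuousLinearMap.adjoint_inner_left]
  have := LinearMap.normDet_sq ((A : E →ₗ[ℝ] E).domRestrict T)
  simp only [RCLike.ofReal_real_eq_id, id] at this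
  rw [this, ← h2, ContinuousLinearMap.det, LinearMap.det_eq_det_mul_det T _ he, h1]
  simp

theorem jacobian_eq_normDet (T : Submodule ℝ E) (A : E →L[ℝ] E) :
    jacobian T.starProjection A = ((A : E →ₗ[ℝ] E).domRestrict T).normDet := by
  rw [jacobian, ← sq_normDet_domRestrict, Real.sqrt_sq (LinearMap.normDet_nonneg _)]

theorem jacobian_pos_iff (T : Submodule ℝ E) (A : E →L[ℝ] E) :
    0 < jacobian T.starProjection A ↔ ∀ u ∈ T, A u = 0 → u = 0 := by
  rw [jacobian_eq_normDet, (LinearMap.normDet_nonneg _).lt_iff_ne', Ne,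
    LinearMap.normDet_eq_zero_iff_ker_ne_bot, not_not, LinearMap.ker_eq_bot']
  constructor
  · intro h u hu hA
    simpa using h ⟨u, hu⟩ hA
  · intro h u hA
    exact Subtype.ext (h u u.2 hA)

/-- Chain rule for the volume distortion. -/
theorem jacobian_mul (S T : Submodule ℝ E) (A B : E →L[ℝ] E)
    (hS : S.map (B : E →ₗ[ℝ] E) = T) :
    jacobian S.starProjection (A * B) = jacobian T.starProjection A * jacobian S.starProjection B := by
  have h1 : (((A * B : E →L[ℝ] E) : E →ₗ[ℝ] E).domRestrict S) =
      (A : E →ₗ[ℝ] E) ∘ₗ ((B : E →ₗ[ℝ] E).domRestrict S) := rfl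
  have h2 : ((B : E →ₗ[ℝ] E).domRestrict S).range = T := by
    rw [LinearMap.range_domRestrict, hS]
  rw [jacobian_eq_normDet S, jacobian_eq_normDet S, h1, LinearMap.normDet_comp,
    ← jacobian_eq_normDet]
  subst h2
  rfl

theorem contDiff_det : ContDiff ℝ ⊤ (fun A : E →L[ℝ] E => A.det) := by
  classical
  let b := Module.finBasis ℝ E
  have h : (fun A : E →L[ℝ] E => A.det) =
      fun A : E →L[ℝ] E => (LinearMap.toMatrix b b (A : E →ₗ[ℝ] E)).det := by
    ext A
    rw [LinearMap.det_toMatrix, ContinuousLinearMap.det]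
  rw [h]
  simp only [Matrix.det_apply]
  refine ContDiff.sum fun σ _ => ContDiff.const_smul _ (contDiff_prod fun i _ => ?_)
  simp only [LinearMap.toMatrix_apply]
  let l : (E →L[ℝ] E) →ₗ[ℝ] ℝ :=
    { toFun := fun A => b.repr (A (b i)) (σ i)
      map_add' := by intros; simp
      map_smul' := by intros; simp }
  exact (LinearMap.toContinuousLinearMap l).contDiff

theorem hasDerivAt_det_one_add_smul (X : E →L[ℝ] E) :
    HasDerivAt (fun t : ℝ => (1 + t • X).det) (LinearMap.trace ℝ E (X : E →ₗ[ℝ] E)) 0 := by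
  classical
  let b := Module.finBasis ℝ E
  set m := LinearMap.toMatrix b b (X : E →ₗ[ℝ] E) with hm
  have h := (1 + (Polynomial.X : Polynomial ℝ) • m.map Polynomial.C).det.hasDerivAt 0
  rw [Matrix.derivative_det_one_add_X_smul, hm, ← LinearMap.trace_eq_matrix_trace] at h
  refine h.congr_of_eventuallyEq (Filter.Eventually.of_forall fun t => ?_)
  simp only [ContinuousLinearMap.det]
  rw [← LinearMap.det_toMatrix b, ← Polynomial.coe_evalRingHom, RingHom.map_det]
  congr 1
  ext i j
  simp [LinearMap.toMatrix_apply, Matrix.one_apply, apply_ite, Finsupp.single_apply, eq_comm,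
    mul_comm t]

theorem HasDerivAt.det_of_eq_one {B : ℝ → E →L[ℝ] E} {B' : E →L[ℝ] E} {t₀ : ℝ}
    (hB : HasDerivAt B B' t₀) (h1 : B t₀ = 1) :
    HasDerivAt (fun t => (B t).det) (LinearMap.trace ℝ E (B' : E →ₗ[ℝ] E)) t₀ := by
  have hd : HasFDerivAt (fun A : E →L[ℝ] E => A.det) _ (1 : E →L[ℝ] E) :=
    ((contDiff_det (E := E)).differentiable (by simp) 1).hasFDerivAt
  have hl : HasDerivAt (fun t : ℝ => (1 : E →L[ℝ] E) + t • B') B' 0 := by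
    simpa using ((hasDerivAt_id (0 : ℝ)).smul_const B').const_add 1
  have h2 := HasFDerivAt.comp_hasDerivAt_of_eq (f := fun t : ℝ => (1 : E →L[ℝ] E) + t • B')
    0 hd hl (by simp)
  rw [← h2.unique (hasDerivAt_det_one_add_smul B')]
  exact HasFDerivAt.comp_hasDerivAt_of_eq t₀ hd hB h1.symm

theorem contDiff_star_clm : ContDiff ℝ ⊤ (fun A : E →L[ℝ] E => star A) :=
  (starL' ℝ : (E →L[ℝ] E) ≃L[ℝ] (E →L[ℝ] E)).contDiff

theorem star_starProjection (T : Submodule ℝ E) : star T.starProjection = T.starProjection :=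
  (isSelfAdjoint_starProjection T).star_eq

theorem starProjection_mul_self (T : Submodule ℝ E) :
    T.starProjection * T.starProjection = T.starProjection :=
  T.isIdempotentElem_starProjection

/-- Derivative of the volume distortion at the identity. -/
theorem hasDerivAt_jacobian (T : Submodule ℝ E) {A : ℝ → E →L[ℝ] E} {A' : E →L[ℝ] E} {t₀ : ℝ}
    (hA : HasDerivAt A A' t₀) (h0 : A t₀ * T.starProjection = T.starProjection) :
    HasDerivAt (fun t => jacobian T.starProjection (A t))
      (LinearMap.trace ℝ E ((T.starProjection * A' : E →L[ℝ] E) : E →ₗ[ℝ] E)) t₀ := by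
  set P := T.starProjection
  have hPs : star P = P := star_starProjection T
  have hPP : P * P = P := starProjection_mul_self T
  have hs : HasDerivAt (fun t => star (A t)) (star A') t₀ :=
    ((starL' ℝ : (E →L[ℝ] E) ≃L[ℝ] (E →L[ℝ] E)).hasFDerivAt.comp_hasDerivAt t₀ hA)
  have hB : HasDerivAt (fun t => P * star (A t) * A t * P + (1 - P))
      ((P * star A' * A t₀ + P * star (A t₀) * A') * P) t₀ :=
    (((hs.const_mul P).mul hA).mul_const P).add_const _
  have hs0 : P * star (A t₀) = P := by
    have := congrArg star h0
    rwa [star_mul, hPs] at this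
  have e1 : P * star (A t₀) * A t₀ * P + (1 - P) = 1 := by
    rw [hs0, mul_assoc, h0, hPP]; abel
  have e2 : (P * star A' * A t₀ + P * star (A t₀) * A') * P = P * star A' * P + P * A' * P := by
    rw [hs0, add_mul, mul_assoc _ (A t₀), h0]
  rw [e2] at hB
  have hd := HasDerivAt.det_of_eq_one hB e1
  have hq := hd.sqrt (by simp [e1, ContinuousLinearMap.det])
  simp only [jacobian]
  convert hq using 1
  rw [e1]
  -- The two halves PA'P and PA'*P both have trace tr(PA'); the factor 2 cancels the 1/2 from the
  -- square root.
  have c1 : LinearMap.trace ℝ E ((P * A' * P : E →L[ℝ] E) : E →ₗ[ℝ] E) =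
      LinearMap.trace ℝ E ((P * A' : E →L[ℝ] E) : E →ₗ[ℝ] E) := by
    have := LinearMap.trace_mul_comm ℝ ((P * A' : E →L[ℝ] E) : E →ₗ[ℝ] E) (P : E →ₗ[ℝ] E)
    have h3 : (P : E →ₗ[ℝ] E) * ((P * A' : E →L[ℝ] E) : E →ₗ[ℝ] E) =
        ((P * A' : E →L[ℝ] E) : E →ₗ[ℝ] E) := by
      have : P * (P * A') = P * A' := by rw [← mul_assoc, hPP]
      exact congrArg ContinuousLinearMap.toLinearMap this
    rw [h3] at this
    exact this
  have c2 : LinearMap.trace ℝ E ((P * star A' * P : E →L[ℝ] E) : E →ₗ[ℝ] E) =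
      LinearMap.trace ℝ E ((P * A' * P : E →L[ℝ] E) : E →ₗ[ℝ] E) := by
    let b := stdOrthonormalBasis ℝ E
    rw [LinearMap.trace_eq_sum_inner _ b, LinearMap.trace_eq_sum_inner _ b]
    refine Finset.sum_congr rfl fun i _ => ?_
    have : P * star A' * P = star (P * A' * P) := by
      simp [star_mul, hPs, mul_assoc]
    rw [this, ContinuousLinearMap.star_eq_adjoint]
    simp only [ContinuousLinearMap.coe_coe]
    rw [ContinuousLinearMap.adjoint_inner_right, real_inner_comm]
  rw [ContinuousLinearMap.toLinearMap_add, map_add, c2, c1]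
  simp [ContinuousLinearMap.det]

theorem contDiffAt_jacobian {P A : E →L[ℝ] E} (h : jacobian P A ≠ 0) :
    ContDiffAt ℝ ⊤ (fun q : (E →L[ℝ] E) × (E →L[ℝ] E) => jacobian q.1 q.2) (P, A) := by
  have hs : ContDiff ℝ ⊤ (fun q : (E →L[ℝ] E) × (E →L[ℝ] E) => star q.2) :=
    contDiff_star_clm.comp contDiff_snd
  have hd : ContDiff ℝ ⊤ (fun q : (E →L[ℝ] E) × (E →L[ℝ] E) =>
      (q.1 * star q.2 * q.2 * q.1 + (1 - q.1)).det) :=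
    contDiff_det.comp ((((contDiff_fst.mul hs).mul contDiff_snd).mul contDiff_fst).add
      (contDiff_const.sub contDiff_fst))
  refine hd.contDiffAt.sqrt ?_
  intro h0
  exact h (by simp only [jacobian]; simp only at h0; rw [h0, Real.sqrt_zero])

theorem continuous_jacobian :
    Continuous (fun q : (E →L[ℝ] E) × (E →L[ℝ] E) => jacobian q.1 q.2) := by
  have hs : Continuous (fun q : (E →L[ℝ] E) × (E →L[ℝ] E) => star q.2) :=
    continuous_star.comp continuous_snd
  exact ((contDiff_det (E := E)).continuous.comp ((((continuous_fst.mul hs).mul continuous_snd).mul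
    continuous_fst).add (continuous_const.sub continuous_fst))).sqrt

theorem continuousOn_jacobian_comp {X : Type*} [TopologicalSpace X] {s : Set X}
    {f g : X → E →L[ℝ] E} (hf : ContinuousOn f s) (hg : ContinuousOn g s) :
    ContinuousOn (fun x => jacobian (f x) (g x)) s :=
  (continuous_jacobian (E := E)).comp_continuousOn (f := fun x => (f x, g x)) (hf.prodMk hg)

/-- The trace of `A` on a subspace, computed in an orthonormal basis of the subspace. -/
theorem trace_mul_starProjection {ι : Type*} [Fintype ι] (T : Submodule ℝ E) (A : E →L[ℝ] E)
    (e : OrthonormalBasis ι ℝ T) :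
    LinearMap.trace ℝ E ((A * T.starProjection : E →L[ℝ] E) : E →ₗ[ℝ] E) =
      ∑ j, ⟪(e j : E), A (e j)⟫ := by
  let b := stdOrthonormalBasis ℝ E
  have hP : ∀ x : E, T.starProjection x = ∑ j, ⟪(e j : E), x⟫ • (e j : E) := by
    intro x
    rw [Submodule.starProjection_apply, e.orthogonalProjectionOnto_apply_eq_sum]
    simp
  rw [LinearMap.trace_eq_sum_inner _ b]
  simp only [ContinuousLinearMap.coe_coe, mul_apply_eq_comp, hP, map_sum, map_smul,
    inner_sum, inner_smul_right]
  rw [Finset.sum_comm]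
  refine Finset.sum_congr rfl fun j _ => ?_
  exact b.sum_inner_mul_inner (e j : E) (A (e j))

/-- The square of the Hilbert-Schmidt norm. -/
def hsNormSq (C : E →L[ℝ] E) : ℝ := ∑ a, ‖C (stdOrthonormalBasis ℝ E a)‖ ^ 2

theorem continuous_hsNormSq : Continuous (hsNormSq : (E →L[ℝ] E) → ℝ) := by
  unfold hsNormSq
  fun_prop

theorem hsNormSq_eq_trace (C : E →L[ℝ] E) :
    hsNormSq C = LinearMap.trace ℝ E ((star C * C : E →L[ℝ] E) : E →ₗ[ℝ] E) := by
  rw [LinearMap.trace_eq_sum_inner _ (stdOrthonormalBasis ℝ E), hsNormSq]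
  refine Finset.sum_congr rfl fun a _ => ?_
  rw [ContinuousLinearMap.coe_coe, mul_apply_eq_comp,
    ContinuousLinearMap.star_eq_adjoint, ContinuousLinearMap.adjoint_inner_right,
    real_inner_self_eq_norm_sq]

theorem hsNormSq_eq_sum {ι : Type*} [Fintype ι] (C : E →L[ℝ] E) (b : OrthonormalBasis ι ℝ E) :
    hsNormSq C = ∑ a, ‖C (b a)‖ ^ 2 := by
  rw [hsNormSq_eq_trace, LinearMap.trace_eq_sum_inner _ b]
  refine Finset.sum_congr rfl fun a _ => ?_
  rw [ContinuousLinearMap.coe_coe, mul_apply_eq_comp,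
    ContinuousLinearMap.star_eq_adjoint, ContinuousLinearMap.adjoint_inner_right,
    real_inner_self_eq_norm_sq]

/-- Cyclicity of the trace and P² = P. This turns sums over a frame of T into an expression
continuous in the projection, whatever the frame does. -/
theorem hsNormSq_mul_starProjection {ι : Type*} [Fintype ι] (T : Submodule ℝ E) (C : E →L[ℝ] E)
    (e : OrthonormalBasis ι ℝ T) :
    hsNormSq (C * T.starProjection) = ∑ j, ‖C (e j)‖ ^ 2 := by
  have h1 : LinearMap.trace ℝ E
      ((star (C * T.starProjection) * (C * T.starProjection) : E →L[ℝ] E) : E →ₗ[ℝ] E) =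
      LinearMap.trace ℝ E ((star C * C * T.starProjection : E →L[ℝ] E) : E →ₗ[ℝ] E) := by
    rw [star_mul, star_starProjection]
    have h := LinearMap.trace_mul_comm ℝ (T.starProjection : E →ₗ[ℝ] E)
      ((star C * (C * T.starProjection) : E →L[ℝ] E) : E →ₗ[ℝ] E)
    have e1 : (star C * (C * T.starProjection)) * T.starProjection =
        star C * C * T.starProjection := by
      rw [mul_assoc, mul_assoc C, starProjection_mul_self, mul_assoc]
    rw [← e1, mul_assoc T.starProjection]
    exact h
  rw [hsNormSq_eq_trace, h1, trace_mul_starProjection T _ e]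
  refine Finset.sum_congr rfl fun j _ => ?_
  rw [mul_apply_eq_comp, ContinuousLinearMap.star_eq_adjoint,
    ContinuousLinearMap.adjoint_inner_right, real_inner_self_eq_norm_sq]

/-- The orthogonal projection onto the range of an idempotent is a smooth function of it. -/
theorem starProjection_eq_mul_inverse (T : Submodule ℝ E) (e : E →L[ℝ] E)
    (hmem : ∀ v, e v ∈ T) (hself : ∀ v ∈ T, e v = v) :
    IsUnit (e + star e - 1) ∧ T.starProjection = e * Ring.inverse (e + star e - 1) := by
  set P := T.starProjection
  have hPe : P * e = e := by
    ext v
    exact Submodule.starProjection_eq_self_iff.2 (hmem v)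
  have heP : e * P = P := by
    ext v
    exact hself _ (T.starProjection_apply_mem v)
  have hPes : P * star e = P := by
    have := congrArg star heP
    rwa [star_mul, star_starProjection] at this
  -- Pe = e, and the adjoint of eP = P is Pe* = P.
  have hPS : P * (e + star e - 1) = e := by
    rw [mul_sub, mul_add, hPe, hPes, mul_one]; abel
  -- If (e + e* - 1)v = 0, applying P gives ev = 0, hence e*v = v and |v|² = ⟨e*v,v⟩ = ⟨v,ev⟩ = 0.
  have hu : IsUnit (e + star e - 1) := by
    have hinj : Function.Injective ((e + star e - 1 : E →L[ℝ] E) : E →ₗ[ℝ] E) := by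
      rw [← LinearMap.ker_eq_bot, LinearMap.ker_eq_bot']
      intro v hv
      have h1 : e v = 0 := by
        rw [← hPS, mul_apply_eq_comp]
        rw [ContinuousLinearMap.coe_coe] at hv
        rw [hv, map_zero]
      have h2 : star e v = v := by
        have : e v + star e v - v = 0 := by simpa using hv
        rw [h1, zero_add, sub_eq_zero] at this
        exact this
      rw [← inner_self_eq_zero (𝕜 := ℝ)]
      nth_rewrite 1 [← h2]
      rw [ContinuousLinearMap.star_eq_adjoint, ContinuousLinearMap.adjoint_inner_left, h1,
        inner_zero_right]
    let L : E ≃L[ℝ] E := (LinearEquiv.ofInjectiveEndo _ hinj).toContinuousLinearEquiv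
    have hL : (L : E →L[ℝ] E) = e + star e - 1 := by
      ext v
      rfl
    rw [← hL]
    exact ⟨⟨L, L.symm, by ext; simp, by ext; simp⟩, rfl⟩
  refine ⟨hu, ?_⟩
  nth_rewrite 1 [← hPS]
  rw [mul_assoc, Ring.mul_inverse_cancel _ hu, mul_one]

end LinearAlgebra

end WeightedArea

/-! ### Tangent spaces, local retractions and regularity -/

namespace WeightedArea

open scoped Topology

variable {n : ℕ}

/-- The orthogonal projection onto the tangent space. -/
def tangentProj (M : Set (Euc n)) (x : Euc n) : Euc n →L[ℝ] Euc n :=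
  (tangentSpace M x).starProjection

section Basic

variable {M : Set (Euc n)} {x : Euc n}

theorem tangentProj_mem (v : Euc n) : tangentProj M x v ∈ tangentSpace M x :=
  Submodule.starProjection_apply_mem _ v

theorem tangentProj_of_mem {v : Euc n} (hv : v ∈ tangentSpace M x) : tangentProj M x v = v :=
  Submodule.starProjection_eq_self_iff.2 hv

theorem tangentProj_mul_self : tangentProj M x * tangentProj M x = tangentProj M x :=
  starProjection_mul_self _

/-- Derivatives within M agree on the tangent cone, hence by linearity on its span. Any derivative
found by hand may thus stand in for `fderivWithin` on tangent vectors. -/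
theorem fderivWithin_of_mem_tangentSpace {F : Type*} [NormedAddCommGroup F] [NormedSpace ℝ F]
    {g : Euc n → F} {g' : Euc n →L[ℝ] F} (h : HasFDerivWithinAt g g' M x) {v : Euc n}
    (hv : v ∈ tangentSpace M x) : fderivWithin ℝ g M x v = g' v := by
  have h1 : EqOn (fderivWithin ℝ g M x) g' (tangentConeAt ℝ M x) :=
    h.differentiableWithinAt.hasFDerivWithinAt.unique_on h
  exact LinearMap.eqOn_span (f := (fderivWithin ℝ g M x : Euc n →ₗ[ℝ] F))
    (g := (g' : Euc n →ₗ[ℝ] F)) h1 hv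

theorem fderivWithin_comp_tangentProj {F : Type*} [NormedAddCommGroup F] [NormedSpace ℝ F]
    {g : Euc n → F} {g' : Euc n →L[ℝ] F} (h : HasFDerivWithinAt g g' M x) :
    fderivWithin ℝ g M x ∘L tangentProj M x = g' ∘L tangentProj M x := by
  ext v
  exact fderivWithin_of_mem_tangentSpace h (tangentProj_mem v)

end Basic

/-- A `C²` retraction of the open set `V` to `M`. -/
structure IsRetraction (M V : Set (Euc n)) (r : Euc n → Euc n) : Prop where
  isOpen : IsOpen V
  contDiffOn : ContDiffOn ℝ 2 r V
  mapsTo : ∀ x ∈ V, r x ∈ M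
  eq_self : ∀ x ∈ V, x ∈ M → r x = x

/-- A diffeomorphism flattening `M` to the subspace `W`. -/
structure IsFlattening (k : ℕ) (M : Set (Euc n)) (Φ : OpenPartialHomeomorph (Euc n) (Euc n))
    (W : Submodule ℝ (Euc n)) : Prop where
  finrank_eq : Module.finrank ℝ W = k
  contDiffOn : ContDiffOn ℝ 2 Φ Φ.source
  contDiffOn_symm : ContDiffOn ℝ 2 Φ.symm Φ.target
  mem_iff : ∀ x ∈ Φ.source, (x ∈ M ↔ Φ x ∈ W)

theorem IsC2Submanifold.exists_flattening {k : ℕ} {M : Set (Euc n)} (hM : IsC2Submanifold k M)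
    {p : Euc n} (hp : p ∈ M) : ∃ Φ W, p ∈ Φ.source ∧ IsFlattening k M Φ W := by
  obtain ⟨Φ, W, h1, h2, h3, h4, h5⟩ := hM p hp
  exact ⟨Φ, W, h1, h2, h3, h4, h5⟩

section Flattening

variable {k : ℕ} {M : Set (Euc n)} {Φ : OpenPartialHomeomorph (Euc n) (Euc n)}
  {W : Submodule ℝ (Euc n)} (h : IsFlattening k M Φ W)
include h

theorem IsFlattening.symm_mem {w : Euc n} (hw : w ∈ Φ.target) (hW : w ∈ W) : Φ.symm w ∈ M := by
  rw [h.mem_iff _ (Φ.map_target hw), Φ.right_inv hw]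
  exact hW

/-- Project onto W in the flattened picture. Composing with the retraction extends a function on M
to an open set, where ordinary calculus applies. -/
theorem IsFlattening.exists_retraction {p : Euc n} (hp : p ∈ Φ.source) (hpM : p ∈ M) :
    ∃ V r, p ∈ V ∧ IsRetraction M V r := by
  refine ⟨Φ.source ∩ Φ ⁻¹' (W.starProjection ⁻¹' Φ.target),
    fun x => Φ.symm (W.starProjection (Φ x)), ⟨hp, ?_⟩, ?_, ?_, ?_, ?_⟩
  · rw [mem_preimage, mem_preimage,
      Submodule.starProjection_eq_self_iff.2 ((h.mem_iff p hp).1 hpM)]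
    exact Φ.map_source hp
  · exact Φ.continuousOn.isOpen_inter_preimage Φ.open_source
      (Φ.open_target.preimage W.starProjection.continuous)
  · refine h.contDiffOn_symm.comp (W.starProjection.contDiff.comp_contDiffOn
      (h.contDiffOn.mono inter_subset_left)) ?_
    intro x hx
    exact hx.2
  · intro x hx
    exact h.symm_mem hx.2 (Submodule.starProjection_apply_mem _ _)
  · intro x hx hxM
    rw [Submodule.starProjection_eq_self_iff.2 ((h.mem_iff x hx.1).1 hxM), Φ.left_inv hx.1]

theorem IsFlattening.differentiableAt {x : Euc n} (hx : x ∈ Φ.source) : DifferentiableAt ℝ Φ x :=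
  (h.contDiffOn.contDiffAt (Φ.open_source.mem_nhds hx)).differentiableAt (by simp)

theorem IsFlattening.differentiableAt_symm {w : Euc n} (hw : w ∈ Φ.target) :
    DifferentiableAt ℝ Φ.symm w :=
  (h.contDiffOn_symm.contDiffAt (Φ.open_target.mem_nhds hw)).differentiableAt (by simp)

theorem IsFlattening.fderiv_symm_mul_fderiv {x : Euc n} (hx : x ∈ Φ.source) :
    fderiv ℝ Φ.symm (Φ x) * fderiv ℝ Φ x = 1 := by
  have h1 := (h.differentiableAt_symm (Φ.map_source hx)).hasFDerivAt.comp x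
    (h.differentiableAt hx).hasFDerivAt
  refine h1.unique ((hasFDerivAt_id x).congr_of_eventuallyEq ?_)
  filter_upwards [Φ.open_source.mem_nhds hx] with y hy using Φ.left_inv hy

theorem IsFlattening.fderiv_mul_fderiv_symm {w : Euc n} (hw : w ∈ Φ.target) :
    fderiv ℝ Φ (Φ.symm w) * fderiv ℝ Φ.symm w = 1 := by
  have h1 := (h.differentiableAt (Φ.map_target hw)).hasFDerivAt.comp w
    (h.differentiableAt_symm hw).hasFDerivAt
  refine h1.unique ((hasFDerivAt_id w).congr_of_eventuallyEq ?_)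
  filter_upwards [Φ.open_target.mem_nhds hw] with y hy using Φ.right_inv hy

/-- The derivative carries the tangent cone of M into that of W, and the latter lies in W because W
is closed. -/
theorem IsFlattening.fderiv_mem {x v : Euc n} (hx : x ∈ Φ.source) (hxM : x ∈ M)
    (hv : v ∈ tangentSpace M x) : fderiv ℝ Φ x v ∈ W := by
  have hsub : tangentConeAt ℝ M x ⊆ W.comap (fderiv ℝ Φ x : Euc n →ₗ[ℝ] Euc n) := by
    intro u hu
    rw [← tangentConeAt_inter_nhds (Φ.open_source.mem_nhds hx)] at hu
    have h1 := (h.differentiableAt hx).hasFDerivAt.hasFDerivWithinAt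
      (s := M ∩ Φ.source) |>.mapsTo_tangent_cone hu
    have h2 : fderiv ℝ Φ x u ∈ tangentConeAt ℝ (W : Set (Euc n)) (Φ x) := by
      refine tangentConeAt_mono ?_ h1
      rintro _ ⟨y, hy, rfl⟩
      exact (h.mem_iff y hy.2).1 hy.1
    obtain ⟨α, l, hl, c, d, -, hd, hcd⟩ := exists_fun_of_mem_tangentConeAt h2
    refine W.closed_of_finiteDimensional.mem_of_tendsto hcd ?_
    filter_upwards [hd] with a ha
    refine W.smul_mem _ ?_
    have := W.sub_mem ha ((h.mem_iff x hx).1 hxM)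
    simpa using this
  exact (Submodule.span_le.2 hsub) hv

/-- Segments in W show that every vector of W is in the tangent cone of W at w; the derivative of
the inverse chart sends that cone into the one of M. -/
theorem IsFlattening.fderiv_symm_mem {w v : Euc n} (hw : w ∈ Φ.target) (hwW : w ∈ W)
    (hv : v ∈ W) : fderiv ℝ Φ.symm w v ∈ tangentSpace M (Φ.symm w) := by
  apply Submodule.subset_span
  have h0 : v ∈ tangentConeAt ℝ ((W : Set (Euc n)) ∩ Φ.target) w := by
    rw [tangentConeAt_inter_nhds (Φ.open_target.mem_nhds hw)]
    have := mem_tangentConeAt_of_segment_subset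
      (W.convex.segment_subset hwW (W.add_mem hwW hv))
    rwa [add_sub_cancel_left] at this
  have h1 := (h.differentiableAt_symm hw).hasFDerivAt.hasFDerivWithinAt
      (s := (W : Set (Euc n)) ∩ Φ.target) |>.mapsTo_tangent_cone h0
  refine tangentConeAt_mono ?_ h1
  rintro _ ⟨y, hy, rfl⟩
  exact h.symm_mem hy.2 hy.1

theorem IsFlattening.map_fderiv_symm {w : Euc n} (hw : w ∈ Φ.target) (hwW : w ∈ W) :
    W.map (fderiv ℝ Φ.symm w : Euc n →ₗ[ℝ] Euc n) = tangentSpace M (Φ.symm w) := by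
  apply le_antisymm
  · rintro _ ⟨v, hv, rfl⟩
    exact h.fderiv_symm_mem hw hwW hv
  · intro u hu
    refine ⟨fderiv ℝ Φ (Φ.symm w) u,
      h.fderiv_mem (Φ.map_target hw) (h.symm_mem hw hwW) hu, ?_⟩
    have := h.fderiv_symm_mul_fderiv (Φ.map_target hw)
    rw [Φ.right_inv hw] at this
    exact congrArg (fun A : Euc n →L[ℝ] Euc n => A u) this

theorem IsFlattening.finrank_tangentSpace {x : Euc n} (hx : x ∈ Φ.source) (hxM : x ∈ M) :
    Module.finrank ℝ (tangentSpace M x) = k := by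
  have h1 := h.map_fderiv_symm (Φ.map_source hx) ((h.mem_iff x hx).1 hxM)
  rw [Φ.left_inv hx] at h1
  rw [← h1, ← h.finrank_eq]
  have h2 := h.fderiv_mul_fderiv_symm (Φ.map_source hx)
  have h3 : Function.Injective (fderiv ℝ Φ.symm (Φ x) : Euc n →ₗ[ℝ] Euc n) :=
    Function.LeftInverse.injective (g := fderiv ℝ Φ (Φ.symm (Φ x)))
      fun v => congrArg (fun A : Euc n →L[ℝ] Euc n => A v) h2
  exact (LinearEquiv.finrank_eq (Submodule.equivMapOfInjective _ h3 W)).symm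

end Flattening

theorem IsC2Submanifold.exists_retraction {k : ℕ} {M : Set (Euc n)} (hM : IsC2Submanifold k M)
    {p : Euc n} (hp : p ∈ M) : ∃ V r, p ∈ V ∧ IsRetraction M V r := by
  obtain ⟨Φ, W, h1, h2⟩ := hM.exists_flattening hp
  exact h2.exists_retraction h1 hp

theorem IsC2Submanifold.finrank_tangentSpace {k : ℕ} {M : Set (Euc n)} (hM : IsC2Submanifold k M)
    {p : Euc n} (hp : p ∈ M) : Module.finrank ℝ (tangentSpace M p) = k := by
  obtain ⟨Φ, W, h1, h2⟩ := hM.exists_flattening hp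
  exact h2.finrank_tangentSpace h1 hp

section Retraction

variable {M V : Set (Euc n)} {r : Euc n → Euc n} (hr : IsRetraction M V r)
include hr

theorem IsRetraction.contDiffAt {x : Euc n} (hx : x ∈ V) : ContDiffAt ℝ 2 r x :=
  hr.contDiffOn.contDiffAt (hr.isOpen.mem_nhds hx)

theorem IsRetraction.hasFDerivAt {x : Euc n} (hx : x ∈ V) : HasFDerivAt r (fderiv ℝ r x) x :=
  ((hr.contDiffAt hx).differentiableAt (by simp)).hasFDerivAt

theorem IsRetraction.eventuallyEq {F : Type*} (g : Euc n → F) {x : Euc n} (hx : x ∈ V) :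
    g =ᶠ[𝓝[M] x] fun y => g (r y) := by
  filter_upwards [self_mem_nhdsWithin, mem_nhdsWithin_of_mem_nhds (hr.isOpen.mem_nhds hx)]
    with y hyM hyV
  rw [hr.eq_self y hyV hyM]

theorem IsRetraction.fderiv_mem {x : Euc n} (hx : x ∈ V) (hxM : x ∈ M) (v : Euc n) :
    fderiv ℝ r x v ∈ tangentSpace M x := by
  apply Submodule.subset_span
  have h0 : v ∈ tangentConeAt ℝ V x := by
    rw [tangentConeAt_of_mem_nhds (hr.isOpen.mem_nhds hx)]; trivial
  have h1 := (hr.hasFDerivAt hx).hasFDerivWithinAt (s := V) |>.mapsTo_tangent_cone h0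
  rw [hr.eq_self x hx hxM] at h1
  refine tangentConeAt_mono ?_ h1
  rintro _ ⟨y, hy, rfl⟩
  exact hr.mapsTo y hy

theorem IsRetraction.fderiv_eq_self {x v : Euc n} (hx : x ∈ V) (hxM : x ∈ M)
    (hv : v ∈ tangentSpace M x) : fderiv ℝ r x v = v := by
  have h2 : HasFDerivWithinAt r (ContinuousLinearMap.id ℝ (Euc n)) M x := by
    refine (hasFDerivWithinAt_id x M).congr_of_eventuallyEq ?_ (hr.eq_self x hx hxM)
    exact (hr.eventuallyEq id hx).symm
  rw [← fderivWithin_of_mem_tangentSpace (hr.hasFDerivAt hx).hasFDerivWithinAt hv,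
    fderivWithin_of_mem_tangentSpace h2 hv]
  rfl

/-- The derivative of the retraction is a projection onto the tangent space, though perhaps an
oblique one; this formula makes it orthogonal without losing regularity. -/
theorem IsRetraction.tangentProj_eq {x : Euc n} (hx : x ∈ V) (hxM : x ∈ M) :
    IsUnit (fderiv ℝ r x + star (fderiv ℝ r x) - 1) ∧ tangentProj M x =
      fderiv ℝ r x * Ring.inverse (fderiv ℝ r x + star (fderiv ℝ r x) - 1) :=
  starProjection_eq_mul_inverse _ _ (hr.fderiv_mem hx hxM) fun _ => hr.fderiv_eq_self hx hxM

theorem IsRetraction.contDiffOn_comp {F : Type*} [NormedAddCommGroup F] [NormedSpace ℝ F]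
    {g : Euc n → F} {m : WithTop ℕ∞} (hg : ContDiffOn ℝ m g M) (hm : m ≤ 2) :
    ContDiffOn ℝ m (fun x => g (r x)) V :=
  hg.comp (hr.contDiffOn.of_le hm) hr.mapsTo

theorem IsRetraction.contDiffOn_family {F : Type*} [NormedAddCommGroup F] [NormedSpace ℝ F]
    {I : Set ℝ} {φ : ℝ → Euc n → F}
    (hφ : ContDiffOn ℝ 2 (fun q : ℝ × Euc n => φ q.1 q.2) (I ×ˢ M)) :
    ContDiffOn ℝ 2 (fun q : ℝ × Euc n => φ q.1 (r q.2)) (I ×ˢ V) := by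
  refine hφ.comp (g := fun q : ℝ × Euc n => φ q.1 q.2)
    (f := fun q : ℝ × Euc n => (q.1, r q.2)) ?_ ?_
  · exact contDiff_fst.contDiffOn.prodMk
      (hr.contDiffOn.comp contDiff_snd.contDiffOn fun q hq => hq.2)
  · intro q hq
    exact ⟨hq.1, hr.mapsTo _ hq.2⟩

end Retraction

section Regularity

variable {k : ℕ} {M : Set (Euc n)} (hM : IsC2Submanifold k M)
include hM

/-- The retraction is C², so its derivative is C¹, and inversion of operators is smooth. -/
theorem IsC2Submanifold.contDiffOn_tangentProj : ContDiffOn ℝ 1 (tangentProj M) M := by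
  intro p hp
  obtain ⟨V, r, hpV, hr⟩ := hM.exists_retraction hp
  have hd : ContDiffAt ℝ 1 (fderiv ℝ r) p :=
    (hr.contDiffAt hpV).fderiv_right (m := 1) (by norm_num)
  have hs : ContDiffAt ℝ 1 (fun x => fderiv ℝ r x + star (fderiv ℝ r x) - 1) p :=
    (hd.add (((contDiff_star_clm (E := Euc n)).of_le le_top).contDiffAt.comp p hd)).sub
      contDiffAt_const
  obtain ⟨u, hu⟩ := (hr.tangentProj_eq hpV hp).1
  have hi : ContDiffAt ℝ 1 (fun x => Ring.inverse (fderiv ℝ r x + star (fderiv ℝ r x) - 1)) p := by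
    refine ContDiffAt.comp p (g := Ring.inverse) ?_ hs
    rw [← hu]
    exact contDiffAt_ringInverse ℝ u
  refine (hd.mul hi).contDiffWithinAt.congr_of_eventuallyEq ?_ (hr.tangentProj_eq hpV hp).2
  filter_upwards [self_mem_nhdsWithin, mem_nhdsWithin_of_mem_nhds (hr.isOpen.mem_nhds hpV)]
    with x hxM hxV
  exact (hr.tangentProj_eq hxV hxM).2

theorem IsC2Submanifold.continuousOn_tangentialDeriv {F : Type*} [NormedAddCommGroup F]
    [NormedSpace ℝ F] {g : Euc n → F} (hg : ContDiffOn ℝ 1 g M) :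
    ContinuousOn (fun x => fderivWithin ℝ g M x ∘L tangentProj M x) M := by
  intro p hp
  obtain ⟨V, r, hpV, hr⟩ := hM.exists_retraction hp
  have hgr := hr.contDiffOn_comp hg (by norm_num)
  have hc : ContinuousWithinAt (fun x => fderiv ℝ (fun y => g (r y)) x ∘L tangentProj M x) M p := by
    refine ContinuousWithinAt.clm_comp ?_ (hM.contDiffOn_tangentProj.continuousOn p hp)
    exact ((hgr.continuousOn_fderiv_of_isOpen hr.isOpen (by norm_num)).continuousAt
      (hr.isOpen.mem_nhds hpV)).continuousWithinAt
  have key : ∀ x ∈ V, x ∈ M → fderivWithin ℝ g M x ∘L tangentProj M x =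
      fderiv ℝ (fun y => g (r y)) x ∘L tangentProj M x := by
    intro x hxV hxM
    apply fderivWithin_comp_tangentProj
    refine HasFDerivWithinAt.congr_of_eventuallyEq ?_ (hr.eventuallyEq g hxV)
      (by rw [hr.eq_self x hxV hxM])
    exact ((hgr.contDiffAt (hr.isOpen.mem_nhds hxV)).differentiableAt
      (by norm_num)).hasFDerivAt.hasFDerivWithinAt
  refine hc.congr_of_eventuallyEq ?_ (key p hpV hp)
  filter_upwards [self_mem_nhdsWithin, mem_nhdsWithin_of_mem_nhds (hr.isOpen.mem_nhds hpV)]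
    with x hxM hxV using key x hxV hxM

end Regularity

/-! ### Derivatives of families of maps on M -/

section Family

variable {k : ℕ} {M : Set (Euc n)} {I : Set ℝ} {φ : ℝ → Euc n → Euc n}

/-- The spatial and time derivatives of a family of maps on `M`, read off a local extension. -/
theorem IsRetraction.hasFDerivAt_family {V : Set (Euc n)} {r : Euc n → Euc n}
    (hr : IsRetraction M V r) (hI : IsOpen I)
    (hφ : ContDiffOn ℝ 2 (fun q : ℝ × Euc n => φ q.1 q.2) (I ×ˢ M)) {t : ℝ} (ht : t ∈ I)
    {x : Euc n} (hx : x ∈ V) :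
    HasFDerivAt (fun q : ℝ × Euc n => φ q.1 (r q.2))
      (fderiv ℝ (fun q : ℝ × Euc n => φ q.1 (r q.2)) (t, x)) (t, x) :=
  (((hr.contDiffOn_family hφ).contDiffAt ((hI.prod hr.isOpen).mem_nhds ⟨ht, hx⟩)).differentiableAt
    (by simp)).hasFDerivAt

theorem IsRetraction.hasFDerivWithinAt_family {V : Set (Euc n)} {r : Euc n → Euc n}
    (hr : IsRetraction M V r) (hI : IsOpen I)
    (hφ : ContDiffOn ℝ 2 (fun q : ℝ × Euc n => φ q.1 q.2) (I ×ˢ M)) {t : ℝ} (ht : t ∈ I)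
    {x : Euc n} (hx : x ∈ V) (hxM : x ∈ M) :
    HasFDerivWithinAt (φ t) (fderiv ℝ (fun q : ℝ × Euc n => φ q.1 (r q.2)) (t, x) ∘L
      ContinuousLinearMap.inr ℝ ℝ (Euc n)) M x := by
  have h1 := (hr.hasFDerivAt_family hI hφ ht hx).comp x (hasFDerivAt_prodMk_right t x)
  exact h1.hasFDerivWithinAt.congr_of_eventuallyEq (hr.eventuallyEq (φ t) hx)
    (by simp [hr.eq_self x hx hxM])

theorem IsRetraction.hasDerivAt_family {V : Set (Euc n)} {r : Euc n → Euc n}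
    (hr : IsRetraction M V r) (hI : IsOpen I)
    (hφ : ContDiffOn ℝ 2 (fun q : ℝ × Euc n => φ q.1 q.2) (I ×ˢ M)) {t : ℝ} (ht : t ∈ I)
    {x : Euc n} (hx : x ∈ V) (hxM : x ∈ M) :
    HasDerivAt (fun s => φ s x)
      (fderiv ℝ (fun q : ℝ × Euc n => φ q.1 (r q.2)) (t, x) (1, 0)) t := by
  have h1 := (hr.hasFDerivAt_family hI hφ ht hx).comp_hasDerivAt t
    ((hasDerivAt_id t).prodMk (hasDerivAt_const t x))
  refine h1.congr_of_eventuallyEq (Filter.Eventually.of_forall fun s => ?_)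
  simp [hr.eq_self x hx hxM]

variable (hM : IsC2Submanifold k M) (hI : IsOpen I)
  (hφ : ContDiffOn ℝ 2 (fun q : ℝ × Euc n => φ q.1 q.2) (I ×ˢ M))
include hM hI hφ

theorem IsC2Submanifold.contDiffOn_family_tangentialDeriv :
    ContDiffOn ℝ 1 (fun q : ℝ × Euc n => fderivWithin ℝ (φ q.1) M q.2 ∘L tangentProj M q.2)
      (I ×ˢ M) := by
  rintro ⟨t, p⟩ ⟨ht, hp⟩
  obtain ⟨V, r, hpV, hr⟩ := hM.exists_retraction hp
  have hG := ((hr.contDiffOn_family hφ).contDiffAt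
    ((hI.prod hr.isOpen).mem_nhds (x := (t, p)) ⟨ht, hpV⟩)).fderiv_right (m := 1) (by norm_num)
  have hP : ContDiffWithinAt ℝ 1 (fun q : ℝ × Euc n => tangentProj M q.2) (I ×ˢ M) (t, p) :=
    (hM.contDiffOn_tangentProj p hp).comp (t, p) contDiff_snd.contDiffWithinAt fun q hq => hq.2
  have hc := (hG.contDiffWithinAt (s := I ×ˢ M)).clm_comp (contDiffWithinAt_const
    (c := ContinuousLinearMap.inr ℝ ℝ (Euc n))) |>.clm_comp hP
  refine hc.congr_of_eventuallyEq ?_ ?_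
  · have hV : (univ : Set ℝ) ×ˢ V ∈ 𝓝[I ×ˢ M] (t, p) :=
      mem_nhdsWithin_of_mem_nhds ((isOpen_univ.prod hr.isOpen).mem_nhds ⟨trivial, hpV⟩)
    filter_upwards [self_mem_nhdsWithin, hV] with q hq hqV
    exact fderivWithin_comp_tangentProj (hr.hasFDerivWithinAt_family hI hφ hq.1 hqV.2 hq.2)
  · exact fderivWithin_comp_tangentProj (hr.hasFDerivWithinAt_family hI hφ ht hpV hp)

theorem IsC2Submanifold.contDiffOn_family_velocity {t : ℝ} (ht : t ∈ I) :
    ContDiffOn ℝ 1 (fun x => deriv (fun s => φ s x) t) M := by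
  intro p hp
  obtain ⟨V, r, hpV, hr⟩ := hM.exists_retraction hp
  have hG := ((hr.contDiffOn_family hφ).contDiffAt
    ((hI.prod hr.isOpen).mem_nhds (x := (t, p)) ⟨ht, hpV⟩)).fderiv_right (m := 1) (by norm_num)
  have hc : ContDiffAt ℝ 1
      (fun x => fderiv ℝ (fun q : ℝ × Euc n => φ q.1 (r q.2)) (t, x) (1, 0)) p :=
    (hG.comp p (contDiffAt_const.prodMk contDiffAt_id)).clm_apply contDiffAt_const
  refine hc.contDiffWithinAt.congr_of_eventuallyEq ?_
    (hr.hasDerivAt_family hI hφ ht hpV hp).deriv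
  filter_upwards [self_mem_nhdsWithin, mem_nhdsWithin_of_mem_nhds (hr.isOpen.mem_nhds hpV)]
    with x hxM hxV using (hr.hasDerivAt_family hI hφ ht hxV hxM).deriv

/-- Tangential and time derivatives commute. -/
theorem IsC2Submanifold.hasDerivAt_family_tangentialDeriv {t : ℝ} (ht : t ∈ I) {x : Euc n}
    (hx : x ∈ M) :
    HasDerivAt (fun s => fderivWithin ℝ (φ s) M x ∘L tangentProj M x)
      (fderivWithin ℝ (fun y => deriv (fun s => φ s y) t) M x ∘L tangentProj M x) t := by
  obtain ⟨V, r, hxV, hr⟩ := hM.exists_retraction hx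
  set G := fun q : ℝ × Euc n => φ q.1 (r q.2) with hGdef
  have hG2 : ContDiffAt ℝ 2 G (t, x) := (hr.contDiffOn_family hφ).contDiffAt
    ((hI.prod hr.isOpen).mem_nhds (x := (t, x)) ⟨ht, hxV⟩)
  have hG1 : HasFDerivAt (fderiv ℝ G) (fderiv ℝ (fderiv ℝ G) (t, x)) (t, x) :=
    ((hG2.fderiv_right (m := 1) (by norm_num)).differentiableAt (by simp)).hasFDerivAt
  -- The interchange of derivatives is the symmetry of the second derivative of the extension, which
  -- is C² jointly in (t, x).
  have hsymm := hG2.isSymmSndFDerivAt (by simp)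
  have hY : HasFDerivWithinAt (fun y => deriv (fun s => φ s y) t)
      (((fderiv ℝ (fderiv ℝ G) (t, x)) ∘L ContinuousLinearMap.inr ℝ ℝ (Euc n)).flip (1, 0)) M x := by
    have h1 := (hG1.comp x (hasFDerivAt_prodMk_right t x)).clm_apply
      (hasFDerivAt_const ((1, 0) : ℝ × Euc n) x)
    have h2 : HasFDerivAt (fun y => fderiv ℝ G (t, y) (1, 0))
      (((fderiv ℝ (fderiv ℝ G) (t, x)) ∘L ContinuousLinearMap.inr ℝ ℝ (Euc n)).flip (1, 0)) x := by
      simpa using h1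
    refine h2.hasFDerivWithinAt.congr_of_eventuallyEq ?_
      (hr.hasDerivAt_family hI hφ ht hxV hx).deriv
    filter_upwards [self_mem_nhdsWithin, mem_nhdsWithin_of_mem_nhds (hr.isOpen.mem_nhds hxV)]
      with y hyM hyV using (hr.hasDerivAt_family hI hφ ht hyV hyM).deriv
  rw [fderivWithin_comp_tangentProj hY]
  have h3 : HasDerivAt (fun s => fderiv ℝ G (s, x)) (fderiv ℝ (fderiv ℝ G) (t, x) (1, 0)) t :=
    hG1.comp_hasDerivAt t ((hasDerivAt_id t).prodMk (hasDerivAt_const t x))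
  have h4 := (h3.clm_comp (hasDerivAt_const t (ContinuousLinearMap.inr ℝ ℝ (Euc n)))).clm_comp
    (hasDerivAt_const t (tangentProj M x))
  have h5 : HasDerivAt (fun s => fderiv ℝ G (s, x) ∘L ContinuousLinearMap.inr ℝ ℝ (Euc n) ∘L
      tangentProj M x) _ t := h4
  refine (h4.congr_of_eventuallyEq ?_).congr_deriv ?_
  · filter_upwards [hI.mem_nhds ht] with s hs
    exact fderivWithin_comp_tangentProj (hr.hasFDerivWithinAt_family hI hφ hs hxV hx)
  · ext1 v
    simp [hsymm.eq (1, 0)]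

end Family

end WeightedArea

/-! ### The area formula for Hausdorff measure -/

namespace WeightedArea

open scoped Topology ENNReal
open Filter Asymptotics

section Comparison

variable {X Y Z : Type*} [MetricSpace Y] [MeasurableSpace Y] [BorelSpace Y]
  [MetricSpace Z] [MeasurableSpace Z] [BorelSpace Z]

/-- On v(s) the map u∘v⁻¹ is well defined and C-Lipschitz: points with equal v have equal u. So v
need not be injective. -/
theorem euclideanHausdorffMeasure_image_le {u : X → Y} {v : X → Z} {s : Set X} {C : ℝ} (hC : 0 ≤ C)
    (h : ∀ y ∈ s, ∀ z ∈ s, dist (u y) (u z) ≤ C * dist (v y) (v z)) (d : ℕ) :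
    μHE[d] (u '' s) ≤ ENNReal.ofReal C ^ d * μHE[d] (v '' s) := by
  rcases s.eq_empty_or_nonempty with rfl | ⟨x₀, hx₀⟩
  · simp
  have : Nonempty X := ⟨x₀⟩
  have hv : ∀ a ∈ v '' s, Function.invFunOn v s a ∈ s ∧ v (Function.invFunOn v s a) = a :=
    fun a ha => ⟨Function.invFunOn_mem ha, Function.invFunOn_eq ha⟩
  have himg : (u ∘ Function.invFunOn v s) '' (v '' s) = u '' s := by
    rw [image_image]
    refine image_congr fun y hy => ?_
    have h1 := hv (v y) (mem_image_of_mem v hy)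
    have h2 := h _ h1.1 y hy
    rw [h1.2, dist_self, mul_zero] at h2
    exact dist_le_zero.1 h2
  have hL : LipschitzOnWith C.toNNReal (u ∘ Function.invFunOn v s) (v '' s) := by
    refine LipschitzOnWith.of_dist_le_mul fun a ha b hb => ?_
    have h2 := h _ (hv a ha).1 _ (hv b hb).1
    rw [(hv a ha).2, (hv b hb).2] at h2
    rwa [Real.coe_toNNReal C hC]
  have h3 := hL.hausdorffMeasure_image_le (d := d) (by positivity)
  rw [himg] at h3
  simp only [Measure.euclideanHausdorffMeasure_def, Measure.smul_apply, ENNReal.smul_def,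
    smul_eq_mul]
  rw [mul_left_comm]
  gcongr
  rw [ENNReal.rpow_natCast] at h3
  exact h3

end Comparison

section Area

variable {E : Type*} [NormedAddCommGroup E] [InnerProductSpace ℝ E] [FiniteDimensional ℝ E]
  [CompleteSpace E] [MeasurableSpace E] [BorelSpace E]

/-- `φ` has strict derivative `A` at `x` within `S`. -/
def HasStrictDerivWithin (S : Set E) (φ : E → E) (A : E →L[ℝ] E) (x : E) : Prop :=
  (fun q : E × E => φ q.1 - φ q.2 - A (q.1 - q.2)) =o[𝓝[S ×ˢ S] (x, x)] fun q => q.1 - q.2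

theorem euclideanHausdorffMeasure_linear_image (T : Submodule ℝ E) (A : E →L[ℝ] E) (s : Set E) :
    μHE[Module.finrank ℝ T] ((fun y => A (T.starProjection y)) '' s) =
      ENNReal.ofReal (jacobian T.starProjection A) *
        μHE[Module.finrank ℝ T] (T.starProjection '' s) := by
  have h1 : (fun y => A (T.starProjection y)) '' s =
      ((A : E →ₗ[ℝ] E).domRestrict T) '' (T.orthogonalProjectionOnto '' s) := by
    rw [image_image]; rfl
  have h2 : T.starProjection '' s = ((↑) : T → E) '' (T.orthogonalProjectionOnto '' s) := by
    rw [image_image]; rfl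
  rw [h1, h2, jacobian_eq_normDet, LinearMap.euclideanHausdorffMeasure_image,
    Isometry.euclideanHausdorffMeasure_image (f := ((↑) : T → E)) isometry_subtype_coe]

variable {S : Set E} {T : Submodule ℝ E} {φ : E → E} {A : E →L[ℝ] E} {x : E}

/-- Near x chords of S are almost in T: an error |d - Pd| ≤ (1 - 1/C)|d| leaves |Pd| ≥ |d|/C. -/
theorem HasStrictDerivWithin.eventually_le_projection
    (hT : HasStrictDerivWithin S id T.starProjection x) {C : ℝ} (hC : 1 < C) :
    ∀ᶠ q : E × E in 𝓝[S ×ˢ S] (x, x),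
      ‖q.1 - q.2‖ ≤ C * ‖T.starProjection q.1 - T.starProjection q.2‖ := by
  have hC0 : (0 : ℝ) < C := by linarith
  have hη : 0 < 1 - C⁻¹ := sub_pos.2 (inv_lt_one_of_one_lt₀ hC)
  filter_upwards [hT.bound hη] with q hq
  rw [← map_sub]
  set d := q.1 - q.2
  have h1 : ‖d‖ ≤ ‖T.starProjection d‖ + (1 - C⁻¹) * ‖d‖ := by
    have h2 : ‖d‖ ≤ ‖T.starProjection d‖ + ‖d - T.starProjection d‖ := by
      simpa using norm_add_le (T.starProjection d) (d - T.starProjection d)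
    have : id q.1 - id q.2 = d := rfl
    rw [this] at hq
    linarith
  have h3 : C⁻¹ * ‖d‖ ≤ ‖T.starProjection d‖ := by linarith
  calc ‖d‖ = C * (C⁻¹ * ‖d‖) := by field_simp
    _ ≤ _ := by gcongr

/-- A is bounded below on T, so the error of the linear model A∘P is small relative to the model
itself. The two-sided bound makes φ and A∘P interchangeable in measure up to a power of C. -/
theorem HasStrictDerivWithin.eventually_comparison
    (hT : HasStrictDerivWithin S id T.starProjection x) (hφ : HasStrictDerivWithin S φ A x)
    (hA : 0 < jacobian T.starProjection A) {C : ℝ} (hC : 1 < C) :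
    ∀ᶠ q : E × E in 𝓝[S ×ˢ S] (x, x),
      ‖φ q.1 - φ q.2‖ ≤ C * ‖A (T.starProjection q.1) - A (T.starProjection q.2)‖ ∧
      ‖A (T.starProjection q.1) - A (T.starProjection q.2)‖ ≤ C * ‖φ q.1 - φ q.2‖ := by
  have hC0 : (0 : ℝ) < C := by linarith
  have hη : 0 < 1 - C⁻¹ := sub_pos.2 (inv_lt_one_of_one_lt₀ hC)
  obtain ⟨K, hK, hKA⟩ := LinearMap.exists_antilipschitzWith
    ((A : E →ₗ[ℝ] E).domRestrict T) (by
      rw [LinearMap.ker_eq_bot']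
      intro u hu
      exact Subtype.ext ((jacobian_pos_iff T A).1 hA u u.2 hu))
  have hK' : ∀ u ∈ T, ‖u‖ ≤ K * ‖A u‖ := by
    intro u hu
    have := hKA.le_mul_norm_sub (⟨u, hu⟩ : T) 0
    simpa using this
  have hK0 : (0 : ℝ) < K := hK
  -- The deviations of φ from A and of S from T contribute δ(1 + ‖A‖)|d|, and |d| ≤ 2K|APd|; this δ
  -- makes the total exactly (1 - 1/C)|APd|.
  have hδ : 0 < (1 - C⁻¹) / ((1 + ‖A‖) * (2 * K)) := by positivity
  filter_upwards [hT.eventually_le_projection one_lt_two, hT.bound hδ, hφ.bound hδ] with q h1 h2 h3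
  rw [← map_sub] at h1
  rw [← map_sub, ← map_sub]
  have hid : id q.1 - id q.2 = q.1 - q.2 := rfl
  rw [hid] at h2
  set d := q.1 - q.2
  set e := φ q.1 - φ q.2
  set δ := (1 - C⁻¹) / ((1 + ‖A‖) * (2 * K)) with hδdef
  have h4 : ‖d‖ ≤ 2 * K * ‖A (T.starProjection d)‖ := by
    have := hK' _ (T.starProjection_apply_mem d)
    linarith
  have h5 : ‖e - A (T.starProjection d)‖ ≤ (1 - C⁻¹) * ‖A (T.starProjection d)‖ := by
    calc ‖e - A (T.starProjection d)‖ = ‖(e - A d) + A (d - T.starProjection d)‖ := by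
          rw [A.map_sub d]; abel_nf
      _ ≤ δ * ‖d‖ + ‖A‖ * (δ * ‖d‖) :=
          (norm_add_le _ _).trans (add_le_add h3 ((A.le_opNorm _).trans (by gcongr)))
      _ = (δ * (1 + ‖A‖)) * ‖d‖ := by ring
      _ ≤ (δ * (1 + ‖A‖)) * (2 * K * ‖A (T.starProjection d)‖) := by gcongr
      _ = (1 - C⁻¹) * ‖A (T.starProjection d)‖ := by rw [hδdef]; field_simp
  have h6 : ‖e‖ ≤ ‖A (T.starProjection d)‖ + ‖e - A (T.starProjection d)‖ := by
    simpa using norm_add_le (A (T.starProjection d)) (e - A (T.starProjection d))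
  have h7 : ‖A (T.starProjection d)‖ ≤ ‖e‖ + ‖e - A (T.starProjection d)‖ := by
    have := norm_sub_le e (e - A (T.starProjection d))
    simpa using this
  have h8 : 2 - C⁻¹ ≤ C := by
    have : 0 ≤ (C - 1) ^ 2 * C⁻¹ := by positivity
    have e1 : (C - 1) ^ 2 * C⁻¹ = C - 2 + C⁻¹ := by field_simp; ring
    linarith
  constructor
  · calc ‖e‖ ≤ (2 - C⁻¹) * ‖A (T.starProjection d)‖ := by linarith
      _ ≤ _ := by gcongr
  · have h9 : C⁻¹ * ‖A (T.starProjection d)‖ ≤ ‖e‖ := by linarith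
    calc ‖A (T.starProjection d)‖ = C * (C⁻¹ * ‖A (T.starProjection d)‖) := by field_simp
      _ ≤ _ := by gcongr

theorem exists_isOpen_forall_of_eventually_prod {X : Type*} [TopologicalSpace X] {S : Set X} {x : X}
    {p : X × X → Prop} (h : ∀ᶠ q in 𝓝[S ×ˢ S] (x, x), p q) :
    ∃ U, IsOpen U ∧ x ∈ U ∧ ∀ y ∈ U ∩ S, ∀ z ∈ U ∩ S, p (y, z) := by
  rw [nhdsWithin_prod_eq, eventually_prod_iff] at h
  obtain ⟨pa, ha, pb, hb, h⟩ := h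
  obtain ⟨U, hU, hxU, hUS⟩ := mem_nhdsWithin.1 (ha.and hb)
  exact ⟨U, hU, hxU, fun y hy z hz => h (hUS hy).1 (hUS hz).2⟩

/-- The linear model scales measure exactly by the Jacobian; replacing φ by A∘P, and s by its
projection, each costs a factor C to the power dim T. -/
theorem HasStrictDerivWithin.exists_measure_image_le
    (hT : HasStrictDerivWithin S id T.starProjection x) (hφ : HasStrictDerivWithin S φ A x)
    (hA : 0 < jacobian T.starProjection A) {C : ℝ} (hC : 1 < C) :
    ∃ U, IsOpen U ∧ x ∈ U ∧ ∀ s ⊆ U ∩ S,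
      μHE[Module.finrank ℝ T] (φ '' s) ≤ ENNReal.ofReal C ^ Module.finrank ℝ T *
        (ENNReal.ofReal (jacobian T.starProjection A) * μHE[Module.finrank ℝ T] s) ∧
      ENNReal.ofReal (jacobian T.starProjection A) * μHE[Module.finrank ℝ T] s ≤
        ENNReal.ofReal C ^ (2 * Module.finrank ℝ T) * μHE[Module.finrank ℝ T] (φ '' s) := by
  obtain ⟨U, hU, hxU, h⟩ := exists_isOpen_forall_of_eventually_prod
    ((hT.eventually_le_projection hC).and (hT.eventually_comparison hφ hA hC))
  refine ⟨U, hU, hxU, fun s hs => ?_⟩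
  have hC0 : 0 ≤ C := by linarith
  set d := Module.finrank ℝ T
  have h1 : μHE[d] s ≤ ENNReal.ofReal C ^ d * μHE[d] (T.starProjection '' s) := by
    have := euclideanHausdorffMeasure_image_le (u := id) (v := T.starProjection) (s := s) hC0
      (fun y hy z hz => by
        simpa [dist_eq_norm] using (h y (hs hy) z (hs hz)).1) d
    simpa using this
  have h2 : μHE[d] (T.starProjection '' s) ≤ μHE[d] s := by
    have := euclideanHausdorffMeasure_image_le (u := T.starProjection) (v := id) (s := s)
      zero_le_one (fun y hy z hz => by
        rw [dist_eq_norm, dist_eq_norm, ← map_sub, one_mul]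
        exact T.norm_starProjection_apply_le _) d
    simpa using this
  have h3 : μHE[d] (φ '' s) ≤ ENNReal.ofReal C ^ d *
      μHE[d] ((fun y => A (T.starProjection y)) '' s) :=
    euclideanHausdorffMeasure_image_le hC0 (fun y hy z hz => by
        simpa only [dist_eq_norm] using (h y (hs hy) z (hs hz)).2.1) d
  have h4 : μHE[d] ((fun y => A (T.starProjection y)) '' s) ≤ ENNReal.ofReal C ^ d *
      μHE[d] (φ '' s) :=
    euclideanHausdorffMeasure_image_le hC0 (fun y hy z hz => by
        simpa only [dist_eq_norm] using (h y (hs hy) z (hs hz)).2.2) d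
  rw [euclideanHausdorffMeasure_linear_image] at h3 h4
  constructor
  · exact h3.trans (by gcongr)
  · calc _ ≤ ENNReal.ofReal (jacobian T.starProjection A) *
        (ENNReal.ofReal C ^ d * μHE[d] (T.starProjection '' s)) := by gcongr
      _ = ENNReal.ofReal C ^ d * (ENNReal.ofReal (jacobian T.starProjection A) *
          μHE[d] (T.starProjection '' s)) := by ring
      _ ≤ ENNReal.ofReal C ^ d * (ENNReal.ofReal C ^ d * μHE[d] (φ '' s)) := by gcongr
      _ = _ := by rw [two_mul, pow_add, mul_assoc]

/-- The data of the area formula on `S`: tangent spaces `T x` of dimension `k`, and an injective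
immersion `φ` with derivative `A x`. -/
structure IsImmersionOn (k : ℕ) (S : Set E) (T : E → Submodule ℝ E) (φ : E → E)
    (A : E → E →L[ℝ] E) : Prop where
  measurableSet : MeasurableSet S
  finrank_eq : ∀ x ∈ S, Module.finrank ℝ (T x) = k
  tangent : ∀ x ∈ S, HasStrictDerivWithin S id (T x).starProjection x
  deriv : ∀ x ∈ S, HasStrictDerivWithin S φ (A x) x
  injOn : InjOn φ S
  continuousOn : ContinuousOn φ S
  pos : ∀ x ∈ S, 0 < jacobian (T x).starProjection (A x)
  continuousOn_jacobian : ContinuousOn (fun x => jacobian (T x).starProjection (A x)) S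

variable {k : ℕ} {T : E → Submodule ℝ E} {A : E → E →L[ℝ] E}

/-- Continuity of the Jacobian replaces its frozen value at x by the integral, at the cost of one
more factor C; hence the exponent 2k + 1. -/
theorem IsImmersionOn.exists_isOpen_le (h : IsImmersionOn k S T φ A) {C : ℝ} (hC : 1 < C)
    (hx : x ∈ S) :
    ∃ U, IsOpen U ∧ x ∈ U ∧ ∀ s ⊆ U ∩ S, MeasurableSet s →
      μHE[k] (φ '' s) ≤ ENNReal.ofReal C ^ (2 * k + 1) *
        ∫⁻ y in s, ENNReal.ofReal (jacobian (T y).starProjection (A y)) ∂μHE[k] ∧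
      ∫⁻ y in s, ENNReal.ofReal (jacobian (T y).starProjection (A y)) ∂μHE[k] ≤
        ENNReal.ofReal C ^ (2 * k + 1) * μHE[k] (φ '' s) := by
  obtain ⟨U, hU, hxU, h1⟩ :=
    (h.tangent x hx).exists_measure_image_le (h.deriv x hx) (h.pos x hx) hC
  rw [h.finrank_eq x hx] at h1
  set j : E → ℝ := fun x => jacobian (T x).starProjection (A x) with hj
  have hjx : 0 < j x := h.pos x hx
  have hC0 : 0 < C := by linarith
  have h2 : ∀ᶠ y in 𝓝[S] x, j x ≤ C * j y ∧ j y ≤ C * j x := by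
    have hc := h.continuousOn_jacobian x hx
    have e1 : C⁻¹ * j x < j x := by
      have := inv_lt_one_of_one_lt₀ hC
      nlinarith
    have e2 : j x < C * j x := by nlinarith
    filter_upwards [hc.eventually (lt_mem_nhds e1), hc.eventually (gt_mem_nhds e2)] with y h3 h4
    refine ⟨?_, h4.le⟩
    calc j x = C * (C⁻¹ * j x) := by field_simp
      _ ≤ _ := by gcongr
  obtain ⟨U', hU', hxU', h3⟩ := mem_nhdsWithin.1 h2
  refine ⟨U ∩ U', hU.inter hU', ⟨hxU, hxU'⟩, fun s hs hsm => ?_⟩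
  obtain ⟨h4, h5⟩ := h1 s fun y hy => ⟨(hs hy).1.1, (hs hy).2⟩
  have hjs : ∀ y ∈ s, j x ≤ C * j y ∧ j y ≤ C * j x := fun y hy => h3 ⟨(hs hy).1.2, (hs hy).2⟩
  have hC1 : 1 ≤ ENNReal.ofReal C := by
    rw [← ENNReal.ofReal_one]; exact ENNReal.ofReal_le_ofReal hC.le
  have h6 : ENNReal.ofReal (j x) * μHE[k] s ≤
      ENNReal.ofReal C * ∫⁻ y in s, ENNReal.ofReal (j y) ∂μHE[k] := by
    rw [← setLIntegral_const, ← lintegral_const_mul' _ _ ENNReal.ofReal_ne_top]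
    refine setLIntegral_mono' hsm fun y hy => ?_
    rw [← ENNReal.ofReal_mul hC0.le]
    exact ENNReal.ofReal_le_ofReal (hjs y hy).1
  have h7 : ∫⁻ y in s, ENNReal.ofReal (j y) ∂μHE[k] ≤
      ENNReal.ofReal C * (ENNReal.ofReal (j x) * μHE[k] s) := by
    rw [← mul_assoc, ← ENNReal.ofReal_mul hC0.le, ← setLIntegral_const]
    exact setLIntegral_mono' hsm fun y hy => ENNReal.ofReal_le_ofReal (hjs y hy).2
  constructor
  · calc μHE[k] (φ '' s) ≤ ENNReal.ofReal C ^ k * (ENNReal.ofReal (j x) * μHE[k] s) := h4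
      _ ≤ ENNReal.ofReal C ^ (2 * k) *
          (ENNReal.ofReal C * ∫⁻ y in s, ENNReal.ofReal (j y) ∂μHE[k]) := by
          gcongr
          · omega
      _ = _ := by rw [pow_succ, mul_assoc]
  · calc _ ≤ ENNReal.ofReal C * (ENNReal.ofReal (j x) * μHE[k] s) := h7
      _ ≤ ENNReal.ofReal C * (ENNReal.ofReal C ^ (2 * k) * μHE[k] (φ '' s)) := by gcongr
      _ = _ := by rw [pow_succ]; ring

theorem le_of_forall_one_lt_le_ofReal_pow_mul {a b : ℝ≥0∞} (m : ℕ)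
    (h : ∀ C : ℝ, 1 < C → a ≤ ENNReal.ofReal C ^ m * b) : a ≤ b := by
  have h1 : Tendsto (fun C : ℝ => ENNReal.ofReal C ^ m * b) (𝓝[>] 1) (𝓝 (1 * b)) := by
    refine ENNReal.Tendsto.mul_const ?_ (Or.inl one_ne_zero)
    have : Tendsto (fun C : ℝ => ENNReal.ofReal C ^ m) (𝓝 1) (𝓝 (ENNReal.ofReal 1 ^ m)) :=
      ((ENNReal.continuous_pow m).comp ENNReal.continuous_ofReal).tendsto 1
    simp only [ENNReal.ofReal_one, one_pow] at this
    exact this.mono_left nhdsWithin_le_nhds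
  rw [one_mul] at h1
  refine ge_of_tendsto h1 ?_
  filter_upwards [self_mem_nhdsWithin] with C hC using h C hC

/-- **Area formula** for injective immersions. -/
theorem IsImmersionOn.measure_image (h : IsImmersionOn k S T φ A) {s : Set E} (hs : s ⊆ S)
    (hsm : MeasurableSet s) :
    μHE[k] (φ '' s) =
      ∫⁻ y in s, ENNReal.ofReal (jacobian (T y).starProjection (A y)) ∂μHE[k] := by
  rcases s.eq_empty_or_nonempty with rfl | hne
  · simp
  set j : E → ℝ≥0∞ := fun y => ENNReal.ofReal (jacobian (T y).starProjection (A y)) with hj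
  suffices H : ∀ C : ℝ, 1 < C → μHE[k] (φ '' s) ≤ ENNReal.ofReal C ^ (2 * k + 1) *
      ∫⁻ y in s, j y ∂μHE[k] ∧
      ∫⁻ y in s, j y ∂μHE[k] ≤ ENNReal.ofReal C ^ (2 * k + 1) * μHE[k] (φ '' s) from
    le_antisymm (le_of_forall_one_lt_le_ofReal_pow_mul _ fun C hC => (H C hC).1)
      (le_of_forall_one_lt_le_ofReal_pow_mul _ fun C hC => (H C hC).2)
  intro C hC
  choose! U hU hxU hUs using fun x (hx : x ∈ S) => h.exists_isOpen_le hC hx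
  -- By Lindelöf countably many of these neighbourhoods suffice. Made disjoint, they let the local
  -- estimates be summed with the same constant, which tends to 1 with C.
  obtain ⟨t, htS, htc, hcov⟩ := TopologicalSpace.countable_cover_nhdsWithin (f := U) (s := s)
    fun x hx => mem_nhdsWithin_of_mem_nhds ((hU x (hs hx)).mem_nhds (hxU x (hs hx)))
  have htne : t.Nonempty := by
    obtain ⟨x, hx⟩ := hne
    obtain ⟨y, hy, -⟩ := mem_iUnion₂.1 (hcov hx)
    exact ⟨y, hy⟩
  obtain ⟨f, rfl⟩ := htc.exists_eq_range htne
  have hf : ∀ i, f i ∈ S := fun i => hs (htS (mem_range_self i))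
  set D : ℕ → Set E := fun i => s ∩ disjointed (fun i => U (f i)) i with hD
  have hDm : ∀ i, MeasurableSet (D i) := fun i =>
    hsm.inter (MeasurableSet.disjointed (fun i => (hU _ (hf i)).measurableSet) i)
  have hDd : Pairwise (Function.onFun Disjoint D) := fun i l hil =>
    ((disjoint_disjointed _) hil).mono inter_subset_right inter_subset_right
  have hDU : ⋃ i, D i = s := by
    rw [← inter_iUnion, iUnion_disjointed, inter_eq_left]
    simpa using hcov
  have hDs : ∀ i, D i ⊆ U (f i) ∩ S := fun i y hy => ⟨disjointed_subset (fun i => U (f i)) i hy.2, hs hy.1⟩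
  have e1 : μHE[k] (φ '' s) = ∑' i, μHE[k] (φ '' D i) := by
    rw [← hDU, image_iUnion, measure_iUnion]
    · intro i l hil
      refine disjoint_left.2 ?_
      rintro _ ⟨y, hy, rfl⟩ ⟨z, hz, hzy⟩
      rw [h.injOn (hDs l hz).2 (hDs i hy).2 hzy] at hz
      exact disjoint_left.1 (hDd hil) hy hz
    · intro i
      -- Lusin-Souslin: injective continuous images of Borel sets are Borel.
      exact (hDm i).image_of_continuousOn_injOn
        (h.continuousOn.mono fun y hy => (hDs i hy).2) (h.injOn.mono fun y hy => (hDs i hy).2)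
  have e2 : ∫⁻ y in s, j y ∂μHE[k] = ∑' i, ∫⁻ y in D i, j y ∂μHE[k] := by
    conv_lhs => rw [← hDU]
    exact lintegral_iUnion hDm hDd _
  rw [e1, e2, ← ENNReal.tsum_mul_left, ← ENNReal.tsum_mul_left]
  exact ⟨ENNReal.tsum_le_tsum fun i => (hUs _ (hf i) _ (hDs i) (hDm i)).1,
    ENNReal.tsum_le_tsum fun i => (hUs _ (hf i) _ (hDs i) (hDm i)).2⟩

/-- **Change of variables** for injective immersions. -/
theorem IsImmersionOn.setIntegral_image (h : IsImmersionOn k S T φ A) {g : E → ℝ}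
    (hg : ContinuousOn g (φ '' S)) :
    ∫ y in φ '' S, g y ∂μHE[k] =
      ∫ x in S, jacobian (T x).starProjection (A x) * g (φ x) ∂μHE[k] := by
  classical
  set j : E → ℝ := fun y => jacobian (T y).starProjection (A y) with hj
  have hS := h.measurableSet
  -- φ is controlled only on S; extended by 0 it is measurable everywhere, as pushing measures
  -- forward requires.
  set φ' : E → E := S.piecewise φ fun _ => 0 with hφ'
  have hφm : Measurable φ' := h.continuousOn.measurable_piecewise continuousOn_const hS
  have hφS : ∀ x ∈ S, φ' x = φ x := fun x hx => piecewise_eq_of_mem _ _ _ hx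
  have him : MeasurableSet (φ '' S) := hS.image_of_continuousOn_injOn h.continuousOn h.injOn
  have hjm : AEMeasurable (fun x => ENNReal.ofReal (j x)) (μHE[k].restrict S) :=
    (h.continuousOn_jacobian.aemeasurable hS).ennreal_ofReal
  have hmap : ((μHE[k].restrict S).withDensity fun x => ENNReal.ofReal (j x)).map φ' =
      μHE[k].restrict (φ '' S) := by
    ext t ht
    rw [Measure.map_apply hφm ht, withDensity_apply _ (hφm ht),
      Measure.restrict_restrict (hφm ht), Measure.restrict_apply ht,
      ← h.measure_image inter_subset_right ((hφm ht).inter hS)]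
    congr 1
    ext y
    constructor
    · rintro ⟨x, ⟨hxt, hxS⟩, rfl⟩
      rw [mem_preimage, hφS x hxS] at hxt
      exact ⟨hxt, mem_image_of_mem _ hxS⟩
    · rintro ⟨hyt, x, hxS, rfl⟩
      refine ⟨x, ⟨?_, hxS⟩, rfl⟩
      rw [mem_preimage, hφS x hxS]
      exact hyt
  rw [← hmap, integral_map hφm.aemeasurable, integral_withDensity_eq_integral_toReal_smul₀ hjm
    (Eventually.of_forall fun _ => ENNReal.ofReal_lt_top)]
  · refine setIntegral_congr_fun hS fun x hx => ?_
    simp only [smul_eq_mul]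
    rw [ENNReal.toReal_ofReal (h.pos x hx).le, hφS x hx]
  · rw [hmap]
    exact hg.aestronglyMeasurable him

end Area

end WeightedArea

/-! ### Hausdorff measure on a submanifold; surface divergence -/

namespace WeightedArea

open scoped Topology ENNReal
open Filter Asymptotics

variable {n k : ℕ} {M : Set (Euc n)}

theorem IsC2Submanifold.hasStrictDerivWithin_id (hM : IsC2Submanifold k M) {x : Euc n}
    (hx : x ∈ M) : HasStrictDerivWithin M id (tangentSpace M x).starProjection x := by
  obtain ⟨V, r, hxV, hr⟩ := hM.exists_retraction hx
  have h1 : HasStrictFDerivAt r (fderiv ℝ r x) x :=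
    (hr.contDiffAt hxV).hasStrictFDerivAt (by simp)
  have h2 : (fun q : Euc n × Euc n => q.1 - q.2 - fderiv ℝ r x (q.1 - q.2))
      =o[𝓝[M ×ˢ M] (x, x)] fun q => q.1 - q.2 := by
    refine (h1.isLittleO.mono nhdsWithin_le_nhds).congr' ?_ EventuallyEq.rfl
    have hV : V ×ˢ V ∈ 𝓝[M ×ˢ M] (x, x) :=
      mem_nhdsWithin_of_mem_nhds ((hr.isOpen.prod hr.isOpen).mem_nhds ⟨hxV, hxV⟩)
    filter_upwards [self_mem_nhdsWithin, hV] with q hq hqV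
    rw [hr.eq_self _ hqV.1 hq.1, hr.eq_self _ hqV.2 hq.2]
  -- On M the retraction is the identity, so d - Dr(d) = o(d). Since Dr(d) is tangent, 1 - P maps d
  -- - Dr(d) to d - Pd.
  have h3 := ((1 - tangentProj M x : Euc n →L[ℝ] Euc n).isBigO_comp _ _).trans_isLittleO h2
  refine h3.congr_left fun q => ?_
  have h4 : tangentProj M x (fderiv ℝ r x (q.1 - q.2)) = fderiv ℝ r x (q.1 - q.2) :=
    tangentProj_of_mem (hr.fderiv_mem hxV hx _)
  have h5 : id q.1 - id q.2 - (tangentSpace M x).starProjection (q.1 - q.2) =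
    q.1 - q.2 - tangentProj M x (q.1 - q.2) := rfl
  rw [h5]
  generalize q.1 - q.2 = d at *
  simp only [sub_apply, one_apply_eq_self, map_sub, h4]
  abel

theorem IsC2Submanifold.hasStrictDerivWithin (hM : IsC2Submanifold k M) {g : Euc n → Euc n}
    (hg : ContDiffOn ℝ 1 g M) {x : Euc n} (hx : x ∈ M) :
    HasStrictDerivWithin M g (fderivWithin ℝ g M x ∘L tangentProj M x) x := by
  obtain ⟨V, r, hxV, hr⟩ := hM.exists_retraction hx
  have hgr : ContDiffAt ℝ 1 (fun y => g (r y)) x :=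
    (hr.contDiffOn_comp hg (by norm_num)).contDiffAt (hr.isOpen.mem_nhds hxV)
  have h1 := hgr.hasStrictFDerivAt (by simp)
  set G := fderiv ℝ (fun y => g (r y)) x
  have h0 : fderivWithin ℝ g M x ∘L tangentProj M x = G ∘L tangentProj M x := by
    apply fderivWithin_comp_tangentProj
    exact h1.hasFDerivAt.hasFDerivWithinAt.congr_of_eventuallyEq (hr.eventuallyEq g hxV)
      (by rw [hr.eq_self x hxV hx])
  have h2 : (fun q : Euc n × Euc n => g q.1 - g q.2 - G (q.1 - q.2))
      =o[𝓝[M ×ˢ M] (x, x)] fun q => q.1 - q.2 := by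
    refine (h1.isLittleO.mono nhdsWithin_le_nhds).congr' ?_ EventuallyEq.rfl
    have hV : V ×ˢ V ∈ 𝓝[M ×ˢ M] (x, x) :=
      mem_nhdsWithin_of_mem_nhds ((hr.isOpen.prod hr.isOpen).mem_nhds ⟨hxV, hxV⟩)
    filter_upwards [self_mem_nhdsWithin, hV] with q hq hqV
    rw [hr.eq_self _ hqV.1 hq.1, hr.eq_self _ hqV.2 hq.2]
  have h3 := (G.isBigO_comp _ _).trans_isLittleO (hM.hasStrictDerivWithin_id hx)
  refine (h2.add h3).congr_left fun q => ?_
  rw [h0]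
  have h5 : id q.1 - id q.2 - (tangentSpace M x).starProjection (q.1 - q.2) =
    q.1 - q.2 - tangentProj M x (q.1 - q.2) := rfl
  rw [h5, G.map_sub (q.1 - q.2)]
  simp

theorem IsC2Submanifold.isImmersionOn (hM : IsC2Submanifold k M) (hc : IsCompact M)
    {g : Euc n → Euc n} (hg : ContDiffOn ℝ 1 g M) (hinj : InjOn g M)
    (hpos : ∀ x ∈ M, 0 < jacobian (tangentProj M x) (fderivWithin ℝ g M x ∘L tangentProj M x)) :
    IsImmersionOn k M (tangentSpace M) g
      (fun x => fderivWithin ℝ g M x ∘L tangentProj M x) where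
  measurableSet := hc.measurableSet
  finrank_eq _ hx := hM.finrank_tangentSpace hx
  tangent _ hx := hM.hasStrictDerivWithin_id hx
  deriv _ hx := hM.hasStrictDerivWithin hg hx
  injOn := hinj
  continuousOn := hg.continuousOn
  pos := hpos
  continuousOn_jacobian := continuousOn_jacobian_comp
    hM.contDiffOn_tangentProj.continuousOn (hM.continuousOn_tangentialDeriv hg)

/-- Locally M is a 2-Lipschitz image of its projection to a tangent space, which lies in a compact
set of a k-dimensional space. -/
theorem IsC2Submanifold.measure_lt_top (hM : IsC2Submanifold k M) (hc : IsCompact M) :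
    μHE[k] M < ∞ := by
  refine hc.measure_lt_top_of_nhdsWithin fun x hx => ?_
  obtain ⟨U, hU, hxU, h⟩ := exists_isOpen_forall_of_eventually_prod
    ((hM.hasStrictDerivWithin_id hx).eventually_le_projection one_lt_two)
  refine ⟨(U ∩ M), mem_nhdsWithin.2 ⟨U, hU, hxU, Subset.rfl⟩, ?_⟩
  set T := tangentSpace M x
  have h1 : μHE[k] (U ∩ M) ≤ ENNReal.ofReal 2 ^ k * μHE[k] (T.starProjection '' (U ∩ M)) := by
    have := euclideanHausdorffMeasure_image_le (u := id) (v := T.starProjection) (s := U ∩ M)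
      zero_le_two (fun y hy z hz => by simpa [dist_eq_norm] using h y hy z hz) k
    simpa using this
  refine h1.trans_lt (ENNReal.mul_lt_top (by finiteness) ?_)
  have h2 : T.starProjection '' (U ∩ M) = ((↑) : T → Euc n) ''
      (T.orthogonalProjectionOnto '' (U ∩ M)) := by
    rw [image_image]; rfl
  rw [h2, Isometry.euclideanHausdorffMeasure_image (f := ((↑) : T → Euc n)) isometry_subtype_coe]
  have hk : Module.finrank ℝ T = k := hM.finrank_tangentSpace hx
  rw [← hk]
  refine (measure_mono (image_mono inter_subset_right)).trans_lt ?_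
  exact (hc.image T.orthogonalProjectionOnto.continuous).measure_lt_top

/-- A flattening is locally Lipschitz and sends a piece of M onto a nonempty open subset of W, which
has positive volume. -/
theorem IsC2Submanifold.measure_pos (hM : IsC2Submanifold k M) (hne : M.Nonempty) :
    0 < μHE[k] M := by
  obtain ⟨p, hp⟩ := hne
  obtain ⟨Φ, W, hpΦ, h⟩ := hM.exists_flattening hp
  have h1 : ContDiffAt ℝ 1 Φ p :=
    (h.contDiffOn.contDiffAt (Φ.open_source.mem_nhds hpΦ)).of_le (by norm_num)
  obtain ⟨K, t, ht, hK⟩ := h1.exists_lipschitzOnWith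
  obtain ⟨U, hUt, hU, hpU⟩ := mem_nhds_iff.1 (inter_mem ht (Φ.open_source.mem_nhds hpΦ))
  have h2 : μHE[k] (Φ '' (U ∩ M)) ≤ ENNReal.ofReal K ^ k * μHE[k] (U ∩ M) := by
    have := euclideanHausdorffMeasure_image_le (u := Φ) (v := id) (s := U ∩ M) K.2
      (fun y hy z hz => hK.dist_le_mul y (hUt hy.1).1 z (hUt hz.1).1) k
    simpa using this
  have h3 : Φ '' (U ∩ M) = ((↑) : W → Euc n) '' ((↑) ⁻¹' (Φ '' U)) := by
    ext y
    constructor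
    · rintro ⟨x, ⟨hxU, hxM⟩, rfl⟩
      exact ⟨⟨Φ x, (h.mem_iff x (hUt hxU).2).1 hxM⟩, ⟨x, hxU, rfl⟩, rfl⟩
    · rintro ⟨w, ⟨x, hxU, hxw⟩, rfl⟩
      exact ⟨x, ⟨hxU, (h.mem_iff x (hUt hxU).2).2 (by rw [hxw]; exact w.2)⟩, hxw⟩
  have h4 : 0 < μHE[k] (Φ '' (U ∩ M)) := by
    rw [h3, Isometry.euclideanHausdorffMeasure_image (f := ((↑) : W → Euc n)) isometry_subtype_coe,
      ← h.finrank_eq]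
    refine IsOpen.measure_pos _ ?_ ?_
    · exact (Φ.isOpen_image_of_subset_source hU fun x hx => (hUt hx).2).preimage
        continuous_subtype_val
    · exact ⟨⟨Φ p, (h.mem_iff p hpΦ).1 hp⟩, p, hpU, rfl⟩
  refine lt_of_lt_of_le (pos_iff_ne_zero.2 fun h0 => ?_) (measure_mono (inter_subset_right (s := U)))
  rw [h0, mul_zero] at h2
  exact absurd h4 (not_lt.2 h2)

theorem IsFlattening.isImmersionOn {Φ : OpenPartialHomeomorph (Euc n) (Euc n)}
    {W : Submodule ℝ (Euc n)} (h : IsFlattening k M Φ W) :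
    IsImmersionOn k ((W : Set (Euc n)) ∩ Φ.target) (fun _ => W) Φ.symm (fderiv ℝ Φ.symm) where
  measurableSet := W.closed_of_finiteDimensional.measurableSet.inter Φ.open_target.measurableSet
  finrank_eq _ _ := h.finrank_eq
  tangent x hx := by
    refine (isLittleO_zero _ _).congr' ?_ EventuallyEq.rfl
    filter_upwards [self_mem_nhdsWithin] with q hq
    rw [Submodule.starProjection_eq_self_iff.2 (W.sub_mem hq.1.1 hq.2.1)]
    simp
  deriv x hx := by
    have : HasStrictFDerivAt Φ.symm (fderiv ℝ Φ.symm x) x :=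
      (h.contDiffOn_symm.contDiffAt (Φ.open_target.mem_nhds hx.2)).hasStrictFDerivAt (by simp)
    exact this.isLittleO.mono nhdsWithin_le_nhds
  injOn := Φ.symm.injOn.mono inter_subset_right
  continuousOn := Φ.continuousOn_symm.mono inter_subset_right
  pos x hx := by
    rw [jacobian_pos_iff]
    intro u hu hu0
    have := congrArg (fun A : Euc n →L[ℝ] Euc n => A u) (h.fderiv_mul_fderiv_symm hx.2)
    simpa [hu0] using this.symm
  continuousOn_jacobian := continuousOn_jacobian_comp continuousOn_const
    ((h.contDiffOn_symm.continuousOn_fderiv_of_isOpen Φ.open_target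
      (by norm_num)).mono inter_subset_right)

/-- The divergence along `M`. -/
def surfaceDiv (M : Set (Euc n)) (Y : Euc n → Euc n) (x : Euc n) : ℝ :=
  LinearMap.trace ℝ (Euc n)
    ((tangentProj M x * (fderivWithin ℝ Y M x ∘L tangentProj M x) : Euc n →L[ℝ] Euc n) :
      Euc n →ₗ[ℝ] Euc n)

theorem continuous_trace : Continuous (fun A : Euc n →L[ℝ] Euc n =>
    LinearMap.trace ℝ (Euc n) (A : Euc n →ₗ[ℝ] Euc n)) :=
  ((LinearMap.trace ℝ (Euc n)) ∘ₗ ContinuousLinearMap.coeLM ℝ).continuous_of_finiteDimensional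

theorem IsC2Submanifold.continuousOn_surfaceDiv (hM : IsC2Submanifold k M) {Y : Euc n → Euc n}
    (hY : ContDiffOn ℝ 1 Y M) : ContinuousOn (surfaceDiv M Y) M :=
  continuous_trace.comp_continuousOn
    (hM.contDiffOn_tangentProj.continuousOn.mul (hM.continuousOn_tangentialDeriv hY))

theorem surfaceDiv_eq_of_hasFDerivWithinAt {Y : Euc n → Euc n} {Y' : Euc n →L[ℝ] Euc n} {x : Euc n}
    (hY : HasFDerivWithinAt Y Y' M x) :
    surfaceDiv M Y x = LinearMap.trace ℝ (Euc n)
      ((tangentProj M x * (Y' * tangentProj M x) : Euc n →L[ℝ] Euc n) : Euc n →ₗ[ℝ] Euc n) := by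
  rw [surfaceDiv, fderivWithin_comp_tangentProj hY]
  rfl

theorem trace_mul_comm_clm (A B : Euc n →L[ℝ] Euc n) :
    LinearMap.trace ℝ (Euc n) ((A * B : Euc n →L[ℝ] Euc n) : Euc n →ₗ[ℝ] Euc n) =
      LinearMap.trace ℝ (Euc n) ((B * A : Euc n →L[ℝ] Euc n) : Euc n →ₗ[ℝ] Euc n) :=
  LinearMap.trace_mul_comm ℝ (A : Euc n →ₗ[ℝ] Euc n) (B : Euc n →ₗ[ℝ] Euc n)

theorem integral_fderiv_eq_zero {W : Type*} [NormedAddCommGroup W] [NormedSpace ℝ W]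
    [FiniteDimensional ℝ W] [MeasurableSpace W] [BorelSpace W] (μ : Measure W)
    [μ.IsAddHaarMeasure] {u : W → ℝ} (hu : ContDiff ℝ 1 u) (hc : HasCompactSupport u) (v : W) :
    ∫ w, fderiv ℝ u w v ∂μ = 0 := by
  have hd : Integrable (fun w => fderiv ℝ u w v) μ :=
    ((hu.continuous_fderiv (by norm_num)).clm_apply continuous_const).integrable_of_hasCompactSupport
      (hc.fderiv_apply ℝ v)
  have := integral_mul_fderiv_eq_neg_fderiv_mul_of_integrable (μ := μ) (f := fun _ : W => (1 : ℝ))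
    (g := u) (v := v) (by simp) (by simpa using hd)
    (by simpa using hu.continuous.integrable_of_hasCompactSupport hc)
    (fun x _ => differentiableAt_const _) (fun x _ => (hu.differentiable (by norm_num)) x)
  simpa using this

end WeightedArea

/-! ### The divergence theorem in a chart -/

namespace WeightedArea

open scoped Topology ENNReal
open Filter Asymptotics

variable {n k : ℕ} {M : Set (Euc n)}

section Chart

variable {Φ : OpenPartialHomeomorph (Euc n) (Euc n)} {W : Submodule ℝ (Euc n)}
  (h : IsFlattening k M Φ W)
include h

theorem IsFlattening.hasFDerivAt_fderiv_symm {w : Euc n} (hw : w ∈ Φ.target) :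
    HasFDerivAt (fderiv ℝ Φ.symm) (fderiv ℝ (fderiv ℝ Φ.symm) w) w :=
  (((h.contDiffOn_symm.contDiffAt (Φ.open_target.mem_nhds hw)).fderiv_right
    (m := 1) (by norm_num)).differentiableAt (by simp)).hasFDerivAt

/-- Derivative of the volume distortion of a parametrization. -/
theorem IsFlattening.hasDerivAt_jacobian_line {w : Euc n} (hw : w ∈ Φ.target) (hwW : w ∈ W)
    (v : Euc n) :
    HasDerivAt (fun s : ℝ => jacobian W.starProjection (fderiv ℝ Φ.symm (w + s • v)))
      (LinearMap.trace ℝ (Euc n) ((tangentProj M (Φ.symm w) *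
        (fderiv ℝ (fderiv ℝ Φ.symm) w v * fderiv ℝ Φ (Φ.symm w)) : Euc n →L[ℝ] Euc n) :
          Euc n →ₗ[ℝ] Euc n) * jacobian W.starProjection (fderiv ℝ Φ.symm w)) 0 := by
  have hl : HasDerivAt (fun s : ℝ => w + s • v) v 0 := by
    simpa using ((hasDerivAt_id (0 : ℝ)).smul_const v).const_add w
  have h1 : HasDerivAt (fun s : ℝ => fderiv ℝ Φ.symm (w + s • v))
      (fderiv ℝ (fderiv ℝ Φ.symm) w v) 0 :=
    (h.hasFDerivAt_fderiv_symm hw).comp_hasDerivAt_of_eq 0 hl (by simp)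
  have hLK : fderiv ℝ Φ.symm w * fderiv ℝ Φ (Φ.symm w) = 1 := by
    have := h.fderiv_symm_mul_fderiv (Φ.map_target hw)
    rwa [Φ.right_inv hw] at this
  -- Right multiplication by DΦ makes the operator the identity at s = 0, where the derivative of
  -- the distortion is known; the chain rule then restores the missing factor.
  have h2 := hasDerivAt_jacobian (tangentSpace M (Φ.symm w))
    (h1.mul_const (fderiv ℝ Φ (Φ.symm w))) (by simp [hLK])
  refine (h2.mul_const (jacobian W.starProjection (fderiv ℝ Φ.symm w))).congr_of_eventuallyEq
    (Eventually.of_forall fun s => ?_)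
  simp only
  rw [← jacobian_mul W _ _ _ (h.map_fderiv_symm hw hwW), mul_assoc, h.fderiv_mul_fderiv_symm hw,
    mul_one]

theorem IsFlattening.contDiffAt_jacobian {w : W} (hw : (w : Euc n) ∈ Φ.target) :
    ContDiffAt ℝ 1 (fun w : W => jacobian W.starProjection (fderiv ℝ Φ.symm w)) w := by
  have h1 : ContDiffAt ℝ 1 (fun w : W => fderiv ℝ Φ.symm w) w :=
    ((h.contDiffOn_symm.contDiffAt (Φ.open_target.mem_nhds hw)).fderiv_right
      (m := 1) (by norm_num)).comp w W.subtypeL.contDiff.contDiffAt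
  have h2 := (WeightedArea.contDiffAt_jacobian (h.isImmersionOn.pos w ⟨w.2, hw⟩).ne').of_le
    (m := 1) le_top
  exact h2.comp w (f := fun w : W => (W.starProjection, fderiv ℝ Φ.symm w))
    (contDiffAt_const.prodMk h1)

theorem IsFlattening.isOpen_domain : IsOpen {w : W | (w : Euc n) ∈ Φ.target} :=
  Φ.open_target.preimage continuous_subtype_val

theorem IsFlattening.contDiffAt_pullback {Z : Euc n → Euc n} (hZ : ContDiffOn ℝ 1 Z M) {w : W}
    (hw : (w : Euc n) ∈ Φ.target) :
    ContDiffAt ℝ 1 (fun w : W => fderiv ℝ Φ (Φ.symm w) (Z (Φ.symm w))) w := by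
  have hF : ContDiffOn ℝ 1 (fun w : W => Φ.symm w) {w : W | (w : Euc n) ∈ Φ.target} :=
    (h.contDiffOn_symm.of_le (by norm_num)).comp W.subtypeL.contDiff.contDiffOn fun w hw => hw
  have h1 : ContDiffOn ℝ 1 (fderiv ℝ Φ) Φ.source :=
    h.contDiffOn.fderiv_of_isOpen Φ.open_source (by norm_num)
  exact ((h1.comp hF fun w hw => Φ.map_target hw).clm_apply
    (hZ.comp hF fun w hw => h.symm_mem hw w.2)).contDiffAt (h.isOpen_domain.mem_nhds hw)

/-- In a chart, the weighted Euclidean divergence of a tangential field is the surface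
divergence. -/
theorem IsFlattening.sum_fderiv_eq {Z : Euc n → Euc n} (hZ : ContDiffOn ℝ 1 Z M)
    (hZt : ∀ x ∈ M, Z x ∈ tangentSpace M x) {w : W} (hw : (w : Euc n) ∈ Φ.target)
    {ι : Type*} [Fintype ι] (b : OrthonormalBasis ι ℝ W) :
    ∑ i, fderiv ℝ (fun w : W => jacobian W.starProjection (fderiv ℝ Φ.symm w) *
        ⟪(b i : Euc n), fderiv ℝ Φ (Φ.symm w) (Z (Φ.symm w))⟫) w (b i) =
      jacobian W.starProjection (fderiv ℝ Φ.symm w) * surfaceDiv M Z (Φ.symm w) := by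
  set J : W → ℝ := fun w : W => jacobian W.starProjection (fderiv ℝ Φ.symm w) with hJ
  set ζ : W → Euc n := fun w : W => fderiv ℝ Φ (Φ.symm w) (Z (Φ.symm w)) with hζ
  set x := Φ.symm w with hx
  set L₀ := fderiv ℝ Φ.symm w with hL₀
  set K := fderiv ℝ Φ x with hK
  set L' := fderiv ℝ (fderiv ℝ Φ.symm) w with hL'
  set P := tangentProj M x with hP
  set Q := W.starProjection with hQ
  set D := fderivWithin ℝ Z M x with hD
  have hxs : x ∈ Φ.source := Φ.map_target hw
  have hxM : x ∈ M := h.symm_mem hw w.2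
  have hKL : K * L₀ = 1 := h.fderiv_mul_fderiv_symm hw
  have hLK : L₀ * K = 1 := by
    have := h.fderiv_symm_mul_fderiv hxs
    rwa [Φ.right_inv hw] at this
  have hPL : ∀ v ∈ W, P (L₀ v) = L₀ v := fun v hv =>
    tangentProj_of_mem (h.fderiv_symm_mem hw w.2 hv)
  have hQK : ∀ v, Q (K (P v)) = K (P v) := fun v =>
    Submodule.starProjection_eq_self_iff.2 (h.fderiv_mem hxs hxM (tangentProj_mem v))
  have hQm : ∀ v, Q v ∈ W := fun v => W.starProjection_apply_mem v
  have hζW : ∀ w : W, (w : Euc n) ∈ Φ.target → ζ w ∈ W := fun w hw =>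
    h.fderiv_mem (Φ.map_target hw) (h.symm_mem hw w.2) (hZt _ (h.symm_mem hw w.2))
  have hnhds : {w : W | (w : Euc n) ∈ Φ.target} ∈ 𝓝 w := h.isOpen_domain.mem_nhds hw
  have dJ : HasFDerivAt J (fderiv ℝ J w) w :=
    ((h.contDiffAt_jacobian hw).differentiableAt (by simp)).hasFDerivAt
  have dζ : HasFDerivAt ζ (fderiv ℝ ζ w) w :=
    ((h.contDiffAt_pullback hZ hw).differentiableAt (by simp)).hasFDerivAt
  have hsymm : IsSymmSndFDerivAt ℝ Φ.symm (w : Euc n) :=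
    (h.contDiffOn_symm.contDiffAt (Φ.open_target.mem_nhds hw)).isSymmSndFDerivAt (by simp)
  have eJ : ∀ v : W, fderiv ℝ J w v =
      LinearMap.trace ℝ (Euc n) ((P * (L' v * K) : Euc n →L[ℝ] Euc n) : Euc n →ₗ[ℝ] Euc n) *
        J w := by
    intro v
    have hl : HasDerivAt (fun s : ℝ => w + s • v) v 0 := by
      simpa using ((hasDerivAt_id (0 : ℝ)).smul_const v).const_add w
    exact (dJ.comp_hasDerivAt_of_eq 0 hl (by simp)).unique
      (h.hasDerivAt_jacobian_line hw w.2 (v : Euc n))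
  have eQ : ∀ v, Q (fderiv ℝ ζ w v) = fderiv ℝ ζ w v := by
    intro v
    have h1 : HasFDerivAt ζ (Q ∘L fderiv ℝ ζ w) w := by
      refine (Q.hasFDerivAt.comp w dζ).congr_of_eventuallyEq ?_
      filter_upwards [hnhds] with y hy
      exact (Submodule.starProjection_eq_self_iff.2 (hζW y hy)).symm
    exact congrArg (fun A : W →L[ℝ] Euc n => A v) (h1.unique dζ)
  -- Here ζ is the field Z in coordinates; this is the derivative of the identity (DΦ⁻¹)ζ = Z∘Φ⁻¹.
  have eL : ∀ v : W, L' v (ζ w) + L₀ (fderiv ℝ ζ w v) = D (L₀ v) := by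
    intro v
    have dF : HasFDerivAt (fun w : W => Φ.symm w) (L₀ ∘L W.subtypeL) w :=
      (h.differentiableAt_symm hw).hasFDerivAt.comp w W.subtypeL.hasFDerivAt
    have dβ : HasFDerivAt (fun w : W => Z (Φ.symm w)) (D ∘L (L₀ ∘L W.subtypeL)) w := by
      have hm : MapsTo (fun w : W => Φ.symm w) {w : W | (w : Euc n) ∈ Φ.target} M :=
        fun w hw => h.symm_mem hw w.2
      exact (((hZ.differentiableOn (by simp)) x hxM).hasFDerivWithinAt.comp w
        dF.hasFDerivWithinAt hm).hasFDerivAt hnhds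
    have dL : HasFDerivAt (fun w : W => fderiv ℝ Φ.symm (w : Euc n)) (L' ∘L W.subtypeL) w :=
      (h.hasFDerivAt_fderiv_symm hw).comp w W.subtypeL.hasFDerivAt
    have h2 : HasFDerivAt (fun w : W => fderiv ℝ Φ.symm (w : Euc n) (ζ w))
        (D ∘L (L₀ ∘L W.subtypeL)) w := by
      refine dβ.congr_of_eventuallyEq ?_
      filter_upwards [hnhds] with y hy
      have h3 := h.fderiv_symm_mul_fderiv (Φ.map_target hy)
      rw [Φ.right_inv hy] at h3
      exact congrArg (fun A : Euc n →L[ℝ] Euc n => A (Z (Φ.symm y))) h3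
    have h4 := congrArg (fun A : W →L[ℝ] Euc n => A v) ((dL.clm_apply dζ).unique h2)
    simpa [add_comm] using h4
  -- Solve the previous relation for the derivative of ζ; symmetry of the second derivative turns
  -- L'(v)ζ into L'(ζ)v. The factor P may be inserted because ζ, and so its derivative, has values
  -- in W.
  have eζ : ∀ v : W, fderiv ℝ ζ w v = (K * P * D * L₀ - K * P * L' (ζ w)) v := by
    intro v
    have h1 : L₀ (fderiv ℝ ζ w v) = D (L₀ v) - L' (ζ w) v := by
      rw [← eL v, hsymm.eq (ζ w) v, add_sub_cancel_left]
    have h2 : fderiv ℝ ζ w v = K (P (L₀ (fderiv ℝ ζ w v))) := by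
      have hm : fderiv ℝ ζ w v ∈ W := by rw [← eQ v]; exact hQm _
      rw [hPL _ hm]
      exact (congrArg (fun A : Euc n →L[ℝ] Euc n => A (fderiv ℝ ζ w v)) hKL).symm
    rw [h2, h1]
    simp
  have eu : ∀ i, fderiv ℝ (fun w : W => J w * ⟪(b i : Euc n), ζ w⟫) w (b i) =
      J w * ⟪(b i : Euc n), (K * P * D * L₀ - K * P * L' (ζ w)) (b i)⟫ +
        ⟪(b i : Euc n), ζ w⟫ * fderiv ℝ J w (b i) := by
    intro i
    have h1 : HasFDerivAt (fun w : W => J w * ⟪(b i : Euc n), ζ w⟫) _ w :=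
      dJ.mul ((hasFDerivAt_const (b i : Euc n) w).inner ℝ dζ)
    rw [h1.fderiv, ← eζ]
    simp
  rw [Finset.sum_congr rfl fun i _ => eu i, Finset.sum_add_distrib, ← Finset.mul_sum,
    ← trace_mul_starProjection W _ b]
  -- The derivative of the density J along ζ yields the trace of P L'(ζ) K, the term that `e2`
  -- produces with opposite sign.
  have e1 : ∑ i, ⟪(b i : Euc n), ζ w⟫ * fderiv ℝ J w (b i) =
      LinearMap.trace ℝ (Euc n) ((P * (L' (ζ w) * K) : Euc n →L[ℝ] Euc n) : Euc n →ₗ[ℝ] Euc n) *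
        J w := by
    have h1 : (⟨ζ w, hζW w hw⟩ : W) = ∑ i, ⟪(b i : Euc n), ζ w⟫ • b i := by
      have := b.sum_repr' ⟨ζ w, hζW w hw⟩
      exact this.symm
    have h2 := eJ ⟨ζ w, hζW w hw⟩
    rw [← h2, h1]
    simp
  have e2 : LinearMap.trace ℝ (Euc n) (((K * P * D * L₀ - K * P * L' (ζ w)) * Q :
      Euc n →L[ℝ] Euc n) : Euc n →ₗ[ℝ] Euc n) = surfaceDiv M Z x - LinearMap.trace ℝ (Euc n)
      ((P * (L' (ζ w) * K) : Euc n →L[ℝ] Euc n) : Euc n →ₗ[ℝ] Euc n) := by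
    have a1 : LinearMap.trace ℝ (Euc n) ((K * P * L' (ζ w) * Q : Euc n →L[ℝ] Euc n) :
        Euc n →ₗ[ℝ] Euc n) = LinearMap.trace ℝ (Euc n)
        ((P * (L' (ζ w) * K) : Euc n →L[ℝ] Euc n) : Euc n →ₗ[ℝ] Euc n) := by
      have hq : Q * (K * P * L' (ζ w)) = K * (P * L' (ζ w)) := by
        ext1 v; exact hQK _
      rw [trace_mul_comm_clm, hq, trace_mul_comm_clm, mul_assoc]
    have a2 : LinearMap.trace ℝ (Euc n) ((K * P * D * L₀ * Q : Euc n →L[ℝ] Euc n) :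
        Euc n →ₗ[ℝ] Euc n) = surfaceDiv M Z x := by
      have hLQ : L₀ * Q = P * (L₀ * Q) := by
        ext1 v; exact (hPL _ (hQm v)).symm
      have hPP : P * P = P := tangentProj_mul_self
      have hLQKP : L₀ * Q * K * P = P := by
        ext1 v
        have h1 : L₀ (K (P v)) = P v :=
          congrArg (fun A : Euc n →L[ℝ] Euc n => A (P v)) hLK
        simp only [mul_apply_eq_comp]
        rw [hQK, h1]
      have b1 : K * P * D * L₀ * Q = K * (P * (P * D * P * (L₀ * Q))) := by
        calc K * P * D * L₀ * Q = K * P * D * (L₀ * Q) := by simp only [mul_assoc]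
          _ = K * (P * P) * D * (P * (L₀ * Q)) := by rw [← hLQ, hPP]
          _ = _ := by simp only [mul_assoc]
      rw [b1, trace_mul_comm_clm, mul_assoc, trace_mul_comm_clm]
      have b2 : P * D * P * (L₀ * Q) * K * P = P * (D * P) := by
        calc P * D * P * (L₀ * Q) * K * P = P * D * P * (L₀ * Q * K * P) := by
              simp only [mul_assoc]
          _ = P * (D * P) := by rw [hLQKP, mul_assoc, hPP, mul_assoc]
      rw [b2]
      rfl
    rw [← a1, ← a2, ← map_sub, sub_mul]
    rfl
  rw [e1, e2]
  ring

/-- The divergence theorem for tangential fields supported in a chart. -/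
theorem IsFlattening.integral_surfaceDiv (hM : IsC2Submanifold k M) (hc : IsCompact M)
    {Z : Euc n → Euc n} (hZ : ContDiffOn ℝ 1 Z M) (hZt : ∀ x ∈ M, Z x ∈ tangentSpace M x)
    {C : Set (Euc n)} (hC : IsClosed C) (hCs : C ⊆ Φ.source) (hZC : ∀ x ∈ M, x ∉ C → Z x = 0) :
    ∫ x in M, surfaceDiv M Z x ∂μHE[k] = 0 := by
  classical
  have hdiv0 : ∀ x ∈ M, x ∉ C → surfaceDiv M Z x = 0 := by
    intro x hxM hxC
    have : HasFDerivWithinAt Z (0 : Euc n →L[ℝ] Euc n) M x := by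
      refine (hasFDerivWithinAt_const (0 : Euc n) x M).congr_of_eventuallyEq ?_ (hZC x hxM hxC)
      filter_upwards [self_mem_nhdsWithin, mem_nhdsWithin_of_mem_nhds (hC.isOpen_compl.mem_nhds hxC)]
        with y hyM hyC using hZC y hyM hyC
    rw [surfaceDiv_eq_of_hasFDerivWithinAt this]
    simp
  have himg : Φ.symm '' ((W : Set (Euc n)) ∩ Φ.target) = M ∩ Φ.source := by
    ext x
    constructor
    · rintro ⟨w, ⟨hwW, hw⟩, rfl⟩
      exact ⟨h.symm_mem hw hwW, Φ.map_target hw⟩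
    · rintro ⟨hxM, hx⟩
      exact ⟨Φ x, ⟨(h.mem_iff x hx).1 hxM, Φ.map_source hx⟩, Φ.left_inv hx⟩
  have hcont : ContinuousOn (surfaceDiv M Z) (Φ.symm '' ((W : Set (Euc n)) ∩ Φ.target)) := by
    rw [himg]
    exact (hM.continuousOn_surfaceDiv hZ).mono inter_subset_left
  have e1 : ∫ x in M, surfaceDiv M Z x ∂μHE[k] =
      ∫ x in M ∩ Φ.source, surfaceDiv M Z x ∂μHE[k] :=
    setIntegral_eq_of_subset_of_forall_sdiff_eq_zero hc.measurableSet inter_subset_left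
      fun x hx => hdiv0 x hx.1 fun hxC => hx.2 ⟨hx.1, hCs hxC⟩
  rw [e1, ← himg, h.isImmersionOn.setIntegral_image hcont]
  set g : Euc n → ℝ := fun w => jacobian W.starProjection (fderiv ℝ Φ.symm w) *
    surfaceDiv M Z (Φ.symm w) with hg
  -- On the k-dimensional space W the normalized Hausdorff measure is Lebesgue measure, so
  -- integration by parts is available.
  have e2 : ∫ w in (W : Set (Euc n)) ∩ Φ.target, g w ∂μHE[k] =
      ∫ w : W, (Φ.target.indicator g) w := by
    have hmap : (volume : Measure W).map ((↑) : W → Euc n) =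
        (μHE[k] : Measure (Euc n)).restrict (W : Set (Euc n)) := by
      rw [← InnerProductSpace.euclideanHausdorffMeasure_eq_volume,
        Isometry.map_euclideanHausdorffMeasure (f := ((↑) : W → Euc n)) isometry_subtype_coe,
        Subtype.range_coe, h.finrank_eq]
    have hme : MeasurableEmbedding ((↑) : W → Euc n) :=
      MeasurableEmbedding.subtype_coe W.closed_of_finiteDimensional.measurableSet
    rw [← hme.integral_map, hmap, integral_indicator Φ.open_target.measurableSet,
      Measure.restrict_restrict Φ.open_target.measurableSet, inter_comm]
  rw [e2]
  let b := stdOrthonormalBasis ℝ W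
  set v : Fin (Module.finrank ℝ W) → W → ℝ := fun i w =>
    jacobian W.starProjection (fderiv ℝ Φ.symm w) *
      ⟪(b i : Euc n), fderiv ℝ Φ (Φ.symm w) (Z (Φ.symm w))⟫ with hv
  set O : Set W := {w : W | (w : Euc n) ∈ Φ.target} with hO
  have hOo : IsOpen O := h.isOpen_domain
  set N : Set W := ((↑) : W → Euc n) ⁻¹' (Φ '' (M ∩ C)) with hN
  have hMC : IsCompact (Φ '' (M ∩ C)) :=
    (hc.inter_right hC).image_of_continuousOn (Φ.continuousOn.mono fun x hx => hCs hx.2)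
  have hNc : IsCompact N :=
    (W.closed_of_finiteDimensional.isClosedEmbedding_subtypeVal).isCompact_preimage hMC
  have hN0 : ∀ w ∈ O, w ∉ N → Φ.symm w ∉ C := by
    intro w hw hwN hwC
    exact hwN ⟨Φ.symm w, ⟨h.symm_mem hw w.2, hwC⟩, Φ.right_inv hw⟩
  -- The compact set N, the chart image of M ∩ C, lies in the open set O, and the components vanish
  -- on O outside N; their extensions by zero are therefore C¹ with compact support.
  set u : Fin (Module.finrank ℝ W) → W → ℝ := fun i => O.indicator (v i) with hu
  have hu0 : ∀ i, ∀ w ∉ N, u i w = 0 := by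
    intro i w hw
    by_cases hwO : w ∈ O
    · rw [hu]
      simp only [indicator_of_mem hwO, hv]
      rw [hZC _ (h.symm_mem hwO w.2) (hN0 w hwO hw)]
      simp
    · exact indicator_of_notMem hwO _
  have huO : ∀ i, ∀ w ∈ O, u i =ᶠ[𝓝 w] v i := by
    intro i w hw
    filter_upwards [hOo.mem_nhds hw] with y hy
    exact indicator_of_mem hy _
  have huN : ∀ i, ∀ w ∉ N, u i =ᶠ[𝓝 w] fun _ => 0 := by
    intro i w hw
    filter_upwards [hNc.isClosed.isOpen_compl.mem_nhds hw] with y hy using hu0 i y hy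
  have hNO : N ⊆ O := by
    rintro w ⟨x, ⟨-, hxC⟩, hxw⟩
    rw [hO, mem_ofPred_eq, ← hxw]
    exact Φ.map_source (hCs hxC)
  have huc : ∀ i, ContDiff ℝ 1 (u i) := by
    intro i
    rw [contDiff_iff_contDiffAt]
    intro w
    by_cases hw : w ∈ N
    · exact ((h.contDiffAt_jacobian (hNO hw)).mul (contDiffAt_const.inner ℝ
        (h.contDiffAt_pullback hZ (hNO hw)))).congr_of_eventuallyEq (huO i w (hNO hw))
    · exact contDiffAt_const.congr_of_eventuallyEq (huN i w hw)
  have husupp : ∀ i, HasCompactSupport (u i) := fun i => HasCompactSupport.intro hNc (hu0 i)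
  have hsum : ∀ w : W, Φ.target.indicator g w = ∑ i, fderiv ℝ (u i) w (b i) := by
    intro w
    by_cases hw : w ∈ O
    · rw [indicator_of_mem (show (w : Euc n) ∈ Φ.target from hw), hg]
      simp only
      rw [← h.sum_fderiv_eq hZ hZt hw b]
      refine Finset.sum_congr rfl fun i _ => ?_
      rw [(huO i w hw).fderiv_eq]
    · rw [indicator_of_notMem (show (w : Euc n) ∉ Φ.target from hw)]
      symm
      refine Finset.sum_eq_zero fun i _ => ?_
      rw [(huN i w fun hwN => hw (hNO hwN)).fderiv_eq]
      simp
  simp_rw [hsum]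
  rw [integral_finsetSum]
  · exact Finset.sum_eq_zero fun i _ => integral_fderiv_eq_zero _ (huc i) (husupp i) _
  · intro i _
    exact (((huc i).continuous_fderiv (by norm_num)).clm_apply
      continuous_const).integrable_of_hasCompactSupport ((husupp i).fderiv_apply ℝ _)

end Chart

end WeightedArea

/-! ### The global divergence theorem and the geometry of M in the sphere -/

namespace WeightedArea

open scoped Topology ENNReal Manifold
open Filter Asymptotics

variable {n k : ℕ} {M : Set (Euc n)}

theorem IsC2Submanifold.integrableOn (hM : IsC2Submanifold k M) (hc : IsCompact M)
    {g : Euc n → ℝ} (hg : ContinuousOn g M) : IntegrableOn g M μHE[k] := by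
  have : IsFiniteMeasure (μHE[k].restrict M) := ⟨by simpa using hM.measure_lt_top hc⟩
  obtain ⟨C, hC⟩ := hc.exists_bound_of_continuousOn hg
  exact Integrable.of_bound (hg.aestronglyMeasurable hc.measurableSet) C
    ((ae_restrict_iff' hc.measurableSet).2 (Eventually.of_forall hC))

/-- **Divergence theorem** for tangential fields on a compact submanifold. -/
theorem IsC2Submanifold.integral_surfaceDiv_tangential (hM : IsC2Submanifold k M)
    (hc : IsCompact M) {Z : Euc n → Euc n} (hZ : ContDiffOn ℝ 1 Z M)
    (hZt : ∀ x ∈ M, Z x ∈ tangentSpace M x) :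
    ∫ x in M, surfaceDiv M Z x ∂μHE[k] = 0 := by
  classical
  choose Φ W hΦp hΦ using fun p : M => hM.exists_flattening p.2
  -- Each f_i Z is supported in a single chart, and by compactness only finitely many f_i are
  -- nonzero on M.
  obtain ⟨f, hf⟩ := SmoothPartitionOfUnity.exists_isSubordinate 𝓘(ℝ, Euc n) hc.isClosed
    (fun p : M => (Φ p).source) (fun p => (Φ p).open_source)
    (fun p hp => mem_iUnion.2 ⟨⟨p, hp⟩, hΦp ⟨p, hp⟩⟩)
  have hfin := f.locallyFinite.finite_nonempty_inter_compact hc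
  set s := hfin.toFinset with hs
  have hsum : ∀ x ∈ M, ∑ i ∈ s, f i x = 1 := by
    intro x hx
    rw [← f.sum_eq_one hx]
    refine (finsum_eq_sum_of_support_subset _ fun i hi => ?_).symm
    rw [hs, Finset.mem_coe, Set.Finite.mem_toFinset]
    exact ⟨x, hi, hx⟩
  have hfd : ∀ i, ContDiff ℝ 1 (f i) := fun i => ((f i).contMDiff.contDiff).of_le (by simp)
  have hfZ : ∀ i, ContDiffOn ℝ 1 (fun x => f i x • Z x) M := fun i =>
    (hfd i).contDiffOn.smul hZ
  have hdiv : ∀ x ∈ M, surfaceDiv M Z x = ∑ i ∈ s, surfaceDiv M (fun x => f i x • Z x) x := by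
    intro x hx
    have h1 : ∀ i, HasFDerivWithinAt (fun x => f i x • Z x)
        (fderivWithin ℝ (fun x => f i x • Z x) M x) M x := fun i =>
      ((hfZ i).differentiableOn (by simp) x hx).hasFDerivWithinAt
    have h2 : HasFDerivWithinAt Z (∑ i ∈ s, fderivWithin ℝ (fun x => f i x • Z x) M x) M x := by
      have key : ∀ y ∈ M, Z y = ∑ i ∈ s, f i y • Z y := fun y hy => by
        rw [← Finset.sum_smul, hsum y hy, one_smul]
      exact (HasFDerivWithinAt.fun_sum fun i _ => h1 i).congr key (key x hx)
    rw [surfaceDiv_eq_of_hasFDerivWithinAt h2, Finset.sum_mul, Finset.mul_sum]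
    simp only [surfaceDiv]
    rw [← map_sum]
    congr 1
    ext v
    simp
  have hint : ∀ i, IntegrableOn (surfaceDiv M fun x => f i x • Z x) M μHE[k] := fun i =>
    hM.integrableOn hc (hM.continuousOn_surfaceDiv (hfZ i))
  rw [setIntegral_congr_fun hc.measurableSet hdiv, integral_finsetSum _ fun i _ => hint i]
  refine Finset.sum_eq_zero fun i _ => ?_
  refine (hΦ i).integral_surfaceDiv hM hc (hfZ i)
    (fun x hx => (tangentSpace M x).smul_mem _ (hZt x hx)) (isClosed_tsupport (f i)) (hf i) ?_
  intro x _ hx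
  rw [image_eq_zero_of_notMem_tsupport hx, zero_smul]

/-- The derivative of the tangent projection along `M`. -/
def projDeriv (M : Set (Euc n)) (x u : Euc n) : Euc n →L[ℝ] Euc n :=
  fderivWithin ℝ (tangentProj M) M x u

section ProjDeriv

variable (hM : IsC2Submanifold k M) {x : Euc n} (hx : x ∈ M)
include hM hx

theorem IsC2Submanifold.hasFDerivWithinAt_tangentProj :
    HasFDerivWithinAt (tangentProj M) (fderivWithin ℝ (tangentProj M) M x) M x :=
  (hM.contDiffOn_tangentProj.differentiableOn (by simp) x hx).hasFDerivWithinAt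

/-- The extension of v is Pv, so both second fundamental forms are read off from the derivative of
P. -/
theorem IsC2Submanifold.tangentialDeriv_tangentExtension {u : Euc n} (hu : u ∈ tangentSpace M x)
    (v : Euc n) :
    tangentialDeriv M (tangentExtension M v) x u = projDeriv M x u v := by
  have h1 := (hM.hasFDerivWithinAt_tangentProj hx).clm_apply (hasFDerivWithinAt_const v x M)
  have h2 := fderivWithin_of_mem_tangentSpace (g := tangentExtension M v) h1 hu
  rw [tangentialDeriv, h2]
  simp [projDeriv]

theorem IsC2Submanifold.inner_projDeriv {u : Euc n} (hu : u ∈ tangentSpace M x) (a b : Euc n) :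
    ⟪projDeriv M x u a, b⟫ = ⟪a, projDeriv M x u b⟫ := by
  have h0 := hM.hasFDerivWithinAt_tangentProj hx
  have h1 := ((starL' ℝ : (Euc n →L[ℝ] Euc n) ≃L[ℝ] (Euc n →L[ℝ] Euc n)) :
    (Euc n →L[ℝ] Euc n) →L[ℝ] (Euc n →L[ℝ] Euc n)).hasFDerivAt.comp_hasFDerivWithinAt x h0
  have h2 : HasFDerivWithinAt (tangentProj M) _ M x :=
    h1.congr (fun y _ => (star_starProjection _).symm) (star_starProjection _).symm
  have h3 : projDeriv M x u = star (projDeriv M x u) := by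
    have := fderivWithin_of_mem_tangentSpace h2 hu
    exact this
  conv_lhs => rw [h3]
  rw [ContinuousLinearMap.star_eq_adjoint, ContinuousLinearMap.adjoint_inner_left]

/-- Differentiating `P X = 0` for a normal field `X`. -/
theorem IsC2Submanifold.projDeriv_normal {X : Euc n → Euc n} {X' : Euc n →L[ℝ] Euc n}
    (hX : HasFDerivWithinAt X X' M x) (hn : ∀ y ∈ M, tangentProj M y (X y) = 0) {u : Euc n}
    (hu : u ∈ tangentSpace M x) :
    projDeriv M x u (X x) = -tangentProj M x (X' u) := by
  have h1 := (hM.hasFDerivWithinAt_tangentProj hx).clm_apply hX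
  have h2 : HasFDerivWithinAt (fun y => tangentProj M y (X y)) (0 : Euc n →L[ℝ] Euc n) M x :=
    (hasFDerivWithinAt_const (0 : Euc n) x M).congr hn (hn x hx)
  have h3 := fderivWithin_of_mem_tangentSpace h1 hu
  rw [fderivWithin_of_mem_tangentSpace h2 hu] at h3
  rw [eq_neg_iff_add_eq_zero, add_comm]
  exact h3.symm

/-- Differentiate P² = P. -/
theorem IsC2Submanifold.projDeriv_eq {u : Euc n} (hu : u ∈ tangentSpace M x) :
    projDeriv M x u = tangentProj M x * projDeriv M x u + projDeriv M x u * tangentProj M x := by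
  have h0 := hM.hasFDerivWithinAt_tangentProj hx
  have h1 : HasFDerivWithinAt (fun y => tangentProj M y * tangentProj M y) _ M x := h0.mul' h0
  have h2 : HasFDerivWithinAt (tangentProj M) _ M x :=
    h1.congr (fun y _ => tangentProj_mul_self.symm) tangentProj_mul_self.symm
  have h3 := fderivWithin_of_mem_tangentSpace h2 hu
  exact h3

end ProjDeriv

section Sphere

variable {R : ℝ} {x : Euc n}

theorem inner_eq_zero_of_mem_tangentSpace (hS : M ⊆ Metric.sphere 0 R) (hx : x ∈ M) {u : Euc n}
    (hu : u ∈ tangentSpace M x) : ⟪x, u⟫ = 0 := by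
  have h1 : HasFDerivWithinAt (fun y : Euc n => ⟪y, y⟫) _ M x :=
    (hasFDerivWithinAt_id x M).inner ℝ (hasFDerivWithinAt_id x M)
  have h2 : HasFDerivWithinAt (fun y : Euc n => ⟪y, y⟫) (0 : Euc n →L[ℝ] ℝ) M x := by
    have : ∀ y ∈ M, ⟪y, y⟫ = R ^ 2 := fun y hy => by
      rw [real_inner_self_eq_norm_sq, mem_sphere_zero_iff_norm.1 (hS hy)]
    exact (hasFDerivWithinAt_const (R ^ 2) x M).congr this (this x hx)
  have h3 := fderivWithin_of_mem_tangentSpace h1 hu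
  rw [fderivWithin_of_mem_tangentSpace h2 hu] at h3
  simp only [zero_apply, ContinuousLinearMap.comp_apply, ContinuousLinearMap.prod_apply,
    ContinuousLinearMap.id_apply, fderivInnerCLM_apply, id] at h3
  rw [real_inner_comm x u] at h3
  linarith

theorem tangentProj_apply_self (hS : M ⊆ Metric.sphere 0 R) (hx : x ∈ M) :
    tangentProj M x x = 0 := by
  rw [tangentProj, Submodule.starProjection_apply_eq_zero_iff, Submodule.mem_orthogonal']
  exact fun u hu => inner_eq_zero_of_mem_tangentSpace hS hx hu

/-- The position field is normal to M and its derivative is the identity. This is the source of the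
radial part of the curvature. -/
theorem IsC2Submanifold.projDeriv_apply_self (hM : IsC2Submanifold k M)
    (hS : M ⊆ Metric.sphere 0 R) (hx : x ∈ M) {u : Euc n} (hu : u ∈ tangentSpace M x) :
    projDeriv M x u x = -u := by
  have := hM.projDeriv_normal hx (hasFDerivWithinAt_id x M)
    (fun y hy => tangentProj_apply_self hS hy) hu
  rw [id] at this
  rw [this, ContinuousLinearMap.id_apply, tangentProj_of_mem hu]

theorem starProjection_normalSpace (v : Euc n) :
    (normalSpace M x).starProjection v = v - tangentProj M x v := by
  simp [normalSpace, tangentProj, Submodule.starProjection_orthogonal]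

/-- The projection onto the normal space of `M` in the sphere, explicitly. -/
theorem starProjection_sphereNormalSpace (hR : 0 < R) (hS : M ⊆ Metric.sphere 0 R) (hx : x ∈ M)
    (v : Euc n) :
    (sphereNormalSpace M x).starProjection v =
      v - tangentProj M x v - (R ^ 2)⁻¹ • ⟪x, v⟫ • x := by
  have hxx : ⟪x, x⟫ = R ^ 2 := by
    rw [real_inner_self_eq_norm_sq, mem_sphere_zero_iff_norm.1 (hS hx)]
  have hR2 : R ^ 2 ≠ 0 := by positivity
  refine Submodule.eq_starProjection_of_mem_of_inner_eq_zero ?_ ?_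
  · refine ⟨?_, ?_⟩
    · refine (normalSpace M x).sub_mem ?_ ?_
      · rw [← starProjection_normalSpace]
        exact Submodule.starProjection_apply_mem _ _
      · refine Submodule.smul_mem _ _ (Submodule.smul_mem _ _ ?_)
        rw [normalSpace, Submodule.mem_orthogonal']
        exact fun u hu => inner_eq_zero_of_mem_tangentSpace hS hx hu
    · rw [SetLike.mem_coe, Submodule.mem_orthogonal_singleton_iff_inner_right, inner_sub_right,
        inner_sub_right, inner_eq_zero_of_mem_tangentSpace hS hx (tangentProj_mem v), inner_smul_right,
        inner_smul_right, hxx]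
      field_simp
      ring
  · rintro w ⟨hw1, hw2⟩
    rw [SetLike.mem_coe, Submodule.mem_orthogonal_singleton_iff_inner_right] at hw2
    have h1 : ⟪tangentProj M x v, w⟫ = 0 :=
      (Submodule.mem_orthogonal _ _).1 hw1 _ (tangentProj_mem v)
    have h2 : v - (v - tangentProj M x v - (R ^ 2)⁻¹ • ⟪x, v⟫ • x) =
      tangentProj M x v + (R ^ 2)⁻¹ • ⟪x, v⟫ • x := by abel
    rw [h2, inner_add_left, h1, inner_smul_left, inner_smul_left, hw2]
    simp

theorem mem_sphereNormalSpace_iff {v : Euc n} :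
    v ∈ sphereNormalSpace M x ↔ tangentProj M x v = 0 ∧ ⟪x, v⟫ = 0 := by
  rw [sphereNormalSpace, Submodule.mem_inf, Submodule.mem_orthogonal_singleton_iff_inner_right,
    normalSpace, tangentProj, Submodule.starProjection_apply_eq_zero_iff]

/-- First variation identity: the divergence of a field along a minimal submanifold of the
sphere. -/
theorem IsC2Submanifold.surfaceDiv_eq (hM : IsC2Submanifold k M) (hR : 0 < R)
    (hmin : IsMinimalInSphere R M) {Y : Euc n → Euc n} (hY : ContDiffOn ℝ 1 Y M) (hx : x ∈ M) :
    surfaceDiv M Y x = surfaceDiv M (fun y => tangentProj M y (Y y)) x +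
      k / R ^ 2 * ⟪x, Y x⟫ := by
  obtain ⟨hS, hH⟩ := hmin
  have hPY : ContDiffOn ℝ 1 (fun y => tangentProj M y (Y y)) M :=
    hM.contDiffOn_tangentProj.clm_apply hY
  have h1 := (hY.differentiableOn (by simp) x hx).hasFDerivWithinAt
  have h2 := (hPY.differentiableOn (by simp) x hx).hasFDerivWithinAt
  set Y' := fderivWithin ℝ Y M x
  set V' := fderivWithin ℝ (fun y => tangentProj M y (Y y)) M x
  have h3 : HasFDerivWithinAt (fun y => Y y - tangentProj M y (Y y)) (Y' - V') M x := h1.fun_sub h2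
  set Z := Y x - tangentProj M x (Y x) with hZ
  set P := tangentProj M x with hP
  let e := tangentFrame M x
  have he : ∀ i, (e i : Euc n) ∈ tangentSpace M x := fun i => (e i).2
  have hcard : (Finset.univ : Finset (Fin (Module.finrank ℝ (tangentSpace M x)))).card = k := by
    rw [Finset.card_univ, Fintype.card_fin, hM.finrank_tangentSpace hx]
  have hn : ∀ y ∈ M, tangentProj M y (Y y - tangentProj M y (Y y)) = 0 := by
    intro y _
    rw [map_sub, tangentProj_of_mem (tangentProj_mem (Y y)), sub_self]
  have hPZ : P Z = 0 := hn x hx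
  have h4 : surfaceDiv M Y x - surfaceDiv M (fun y => tangentProj M y (Y y)) x =
      ∑ i, ⟪(e i : Euc n), (P * (Y' - V')) (e i)⟫ := by
    rw [← trace_mul_starProjection _ _ e, surfaceDiv_eq_of_hasFDerivWithinAt h1,
      surfaceDiv_eq_of_hasFDerivWithinAt h2, ← map_sub, mul_assoc, sub_mul, mul_sub]
    rfl
  -- Weingarten's relation: the divergence of the normal part Z of Y is -⟨H,Z⟩.
  have h5 : ∀ i, ⟪(e i : Euc n), (P * (Y' - V')) (e i)⟫ =
      -⟪projDeriv M x (e i) (e i), Z⟫ := by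
    intro i
    have := hM.projDeriv_normal hx h3 hn (he i)
    rw [hM.inner_projDeriv hx (he i), ← inner_neg_right, this, neg_neg]
    rfl
  have hxZ : ⟪x, Z⟫ = ⟪x, Y x⟫ := by
    rw [hZ, inner_sub_right, inner_eq_zero_of_mem_tangentSpace hS hx (tangentProj_mem _), sub_zero]
  have hZdec : Z = (sphereNormalSpace M x).starProjection Z + (R ^ 2)⁻¹ • ⟪x, Y x⟫ • x := by
    rw [starProjection_sphereNormalSpace hR hS hx, hPZ, hxZ]
    abel
  -- Minimality removes the part of Z tangent to the sphere; only the radial part remains, and each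
  -- frame vector contributes -1 to it.
  have h6 : ∑ i, ⟪projDeriv M x (e i) (e i), (sphereNormalSpace M x).starProjection Z⟫ = 0 := by
    have := hH x hx
    simp only [sphereSecondFundamentalForm] at this
    have h7 : ∑ i, (sphereNormalSpace M x).starProjection (projDeriv M x (e i) (e i)) = 0 := by
      rw [← this]
      refine Finset.sum_congr rfl fun i _ => ?_
      rw [hM.tangentialDeriv_tangentExtension hx (he i)]
    have h8 := congrArg (fun v => ⟪v, Z⟫) h7
    simp only [sum_inner, inner_zero_left] at h8
    rw [← h8]
    refine Finset.sum_congr rfl fun i _ => ?_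
    rw [Submodule.inner_starProjection_left_eq_right]
  have h9 : ∀ i, ⟪projDeriv M x (e i) (e i), x⟫ = -1 := by
    intro i
    rw [hM.inner_projDeriv hx (he i), hM.projDeriv_apply_self hS hx (he i), inner_neg_right]
    have := e.orthonormal.1 i
    rw [real_inner_self_eq_norm_sq]
    rw [Submodule.norm_coe, this]
    norm_num
  have h10 : ∑ i, ⟪projDeriv M x (e i) (e i), Z⟫ = -(k / R ^ 2 * ⟪x, Y x⟫) := by
    rw [hZdec]
    simp only [inner_add_right, inner_smul_right, h9, Finset.sum_add_distrib]
    rw [h6, Finset.sum_const, hcard]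
    simp
    ring
  have h11 : ∑ i, ⟪(e i : Euc n), (P * (Y' - V')) (e i)⟫ = k / R ^ 2 * ⟪x, Y x⟫ := by
    rw [Finset.sum_congr rfl fun i _ => h5 i, Finset.sum_neg_distrib, h10, neg_neg]
  linarith [h4, h11]

theorem IsC2Submanifold.integral_surfaceDiv (hM : IsC2Submanifold k M) (hc : IsCompact M)
    (hR : 0 < R) (hmin : IsMinimalInSphere R M) {Y : Euc n → Euc n} (hY : ContDiffOn ℝ 1 Y M) :
    ∫ x in M, (surfaceDiv M Y x - k / R ^ 2 * ⟪x, Y x⟫) ∂μHE[k] = 0 := by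
  rw [← hM.integral_surfaceDiv_tangential hc (hM.contDiffOn_tangentProj.clm_apply hY)
    fun x _ => tangentProj_mem (Y x)]
  refine setIntegral_congr_fun hc.measurableSet fun x hx => ?_
  rw [hM.surfaceDiv_eq hR hmin hY hx, add_sub_cancel_right]

end Sphere

end WeightedArea

/-! ### The weight, the first variation and stationarity -/

namespace WeightedArea

open scoped Topology ENNReal
open Filter Asymptotics

variable {n k : ℕ} {M : Set (Euc n)}

section NormPow

theorem hasFDerivAt_norm_zpow (m : ℤ) {x : Euc n} (hx : x ≠ 0) :
    HasFDerivAt (fun y : Euc n => ‖y‖ ^ m) (((m : ℝ) * ‖x‖ ^ (m - 2)) • innerSL ℝ x) x := by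
  have hx0 : ‖x‖ ≠ 0 := norm_ne_zero_iff.2 hx
  have h1 : HasFDerivAt (fun y : Euc n => √(‖y‖ ^ 2)) _ x :=
    (hasStrictFDerivAt_norm_sq x).hasFDerivAt.sqrt (by positivity)
  have h2 := (hasDerivAt_zpow m (√(‖x‖ ^ 2)) (Or.inl (by simpa using hx0))).comp_hasFDerivAt x h1
  have h3 : (fun y : Euc n => ‖y‖ ^ m) = (fun s : ℝ => s ^ m) ∘ fun y : Euc n => √(‖y‖ ^ 2) := by
    ext y; simp
  rw [h3]
  refine h2.congr_fderiv ?_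
  ext v
  simp only [norm_nonneg, Real.sqrt_sq, smul_apply, smul_eq_mul, coe_innerSL_apply]
  have h4 : ‖x‖ ^ (m - 1) = ‖x‖ ^ (m - 2) * ‖x‖ := by
    rw [← zpow_add_one₀ hx0]; congr 1; ring
  rw [h4]
  simp
  field_simp

theorem contDiffAt_norm_zpow (m : ℤ) {x : Euc n} (hx : x ≠ 0) :
    ContDiffAt ℝ 1 (fun y : Euc n => ‖y‖ ^ m) x := by
  have h1 : ContDiffAt ℝ 1 (fun y : Euc n => ‖y‖) x := contDiffAt_norm ℝ hx
  have h2 : ContDiffAt ℝ 1 (fun s : ℝ => s ^ m) ‖x‖ := by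
    have h0 := norm_ne_zero_iff.2 hx
    rcases Int.eq_nat_or_neg m with ⟨l, rfl | rfl⟩
    · simpa using (contDiff_id.pow l).contDiffAt
    · have h : ContDiffAt ℝ 1 (fun s : ℝ => s ^ l) ‖x‖ := (contDiff_id.pow l).contDiffAt
      simp only [zpow_neg, zpow_natCast]
      exact h.inv (pow_ne_zero l h0)
  exact h2.comp x h1

/-- The gradient is m|x|^{m-2}x; in a direction orthogonal to x its scalar factor is stationary, so
only the derivative of x contributes. -/
theorem hessian_norm_zpow (m : ℤ) {x v : Euc n} (hx : x ≠ 0) (hv : ⟪x, v⟫ = 0) :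
    fderiv ℝ (fderiv ℝ fun y : Euc n => ‖y‖ ^ m) x v v = m * ‖x‖ ^ (m - 2) * ‖v‖ ^ 2 := by
  have h1 : fderiv ℝ (fun y : Euc n => ‖y‖ ^ m) =ᶠ[𝓝 x]
      fun y => ((m : ℝ) * ‖y‖ ^ (m - 2)) • innerSL ℝ y := by
    filter_upwards [isOpen_ne.mem_nhds hx] with y hy
    exact (hasFDerivAt_norm_zpow m hy).fderiv
  have h2 : HasFDerivAt (fun y : Euc n => ((m : ℝ) * ‖y‖ ^ (m - 2)) • innerSL ℝ y) _ x :=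
    ((hasFDerivAt_norm_zpow (m - 2) hx).const_mul (m : ℝ)).smul
      ((innerSL ℝ : Euc n →L[ℝ] Euc n →L[ℝ] ℝ).hasFDerivAt (x := x))
  rw [h1.fderiv_eq, h2.fderiv]
  simp [hv, coe_innerSL_apply]
  left
  exact real_inner_self_eq_norm_sq v

end NormPow

section Uniformity

variable {I : Set ℝ}

theorem eventually_forall_pos (hI : IsOpen I) (h0 : (0 : ℝ) ∈ I) (hc : IsCompact M)
    {c : ℝ × Euc n → ℝ} (hcont : ContinuousOn c (I ×ˢ M)) (hpos : ∀ x ∈ M, 0 < c (0, x)) :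
    ∀ᶠ t in 𝓝 (0 : ℝ), ∀ x ∈ M, 0 < c (t, x) := by
  have h : ∀ᶠ t in 𝓝 (0 : ℝ), ∀ x ∈ M, x ∈ M → 0 < c (t, x) := by
    refine hc.eventually_forall_of_forall_eventually fun x hx => ?_
    have h1 := (hcont (0, x) ⟨h0, hx⟩).eventually (lt_mem_nhds (hpos x hx))
    rw [eventually_nhdsWithin_iff] at h1
    filter_upwards [h1, (hI.preimage continuous_fst).mem_nhds (show ((0 : ℝ), x) ∈ _ from h0)]
      with q hq hqI hqM using hq ⟨hqI, hqM⟩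
  filter_upwards [h] with t ht x hx using ht x hx hx

/-- Compactness of M × M reduces this to neighbourhoods of pairs: off the diagonal continuity
suffices, on it φ_t - id is a contraction for small t. -/
theorem IsC2Submanifold.eventually_injOn (hM : IsC2Submanifold k M) (hc : IsCompact M)
    (hI : IsOpen I) (h0 : (0 : ℝ) ∈ I) {φ : ℝ → Euc n → Euc n}
    (hφ : ContDiffOn ℝ 2 (fun q : ℝ × Euc n => φ q.1 q.2) (I ×ˢ M))
    (hid : ∀ x ∈ M, φ 0 x = x) : ∀ᶠ t in 𝓝 (0 : ℝ), InjOn (φ t) M := by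
  have h : ∀ᶠ t in 𝓝 (0 : ℝ), ∀ q ∈ M ×ˢ M, q ∈ M ×ˢ M → φ t q.1 = φ t q.2 → q.1 = q.2 := by
    refine (hc.prod hc).eventually_forall_of_forall_eventually ?_
    rintro ⟨x, y⟩ ⟨hx, hy⟩
    have hIn : ∀ᶠ z : ℝ × (Euc n × Euc n) in 𝓝 (0, (x, y)), z.1 ∈ I :=
      (hI.preimage continuous_fst).mem_nhds (show ((0 : ℝ), (x, y)) ∈ _ from h0)
    by_cases hxy : x = y
    · subst hxy
      obtain ⟨V, r, hxV, hr⟩ := hM.exists_retraction hx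
      have hG := (hr.contDiffOn_family hφ).contDiffAt
        ((hI.prod hr.isOpen).mem_nhds (x := (0, x)) ⟨h0, hxV⟩)
      have hH : ContDiffAt ℝ 2 (fun q : ℝ × Euc n => φ q.1 (r q.2) - r q.2) (0, x) :=
        hG.sub ((hr.contDiffAt hxV).comp (0, x) contDiffAt_snd)
      have hs := hH.hasStrictFDerivAt (by simp)
      set H' := fderiv ℝ (fun q : ℝ × Euc n => φ q.1 (r q.2) - r q.2) (0, x)
      -- At t = 0 the map φ_t - id vanishes on M, so its spatial derivative is zero and strict
      -- differentiability gives the Lipschitz constant 1/2. Equal images then force |x - y| ≤ |x -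
      -- y|/2.
      have hz : ∀ v, H' (0, v) = 0 := by
        have h1 := hs.hasFDerivAt.comp x (hasFDerivAt_prodMk_right (0 : ℝ) x)
        have h2 : HasFDerivAt ((fun q : ℝ × Euc n => φ q.1 (r q.2) - r q.2) ∘ fun y => ((0 : ℝ), y))
            (0 : Euc n →L[ℝ] Euc n) x := by
          refine (hasFDerivAt_const (0 : Euc n) x).congr_of_eventuallyEq ?_
          filter_upwards [hr.isOpen.mem_nhds hxV] with y hy
          simp [hid _ (hr.mapsTo y hy)]
        intro v
        exact congrArg (fun A : Euc n →L[ℝ] Euc n => A v) (h1.unique h2)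
      have hb := hs.isLittleO.bound (c := 1 / 2) (by norm_num)
      have htend : Tendsto (fun z : ℝ × (Euc n × Euc n) => ((z.1, z.2.1), (z.1, z.2.2)))
          (𝓝 (0, (x, x))) (𝓝 ((0, x), (0, x))) := by
        apply Continuous.tendsto' (by fun_prop)
        rfl
      have hVn : ∀ᶠ z : ℝ × (Euc n × Euc n) in 𝓝 (0, (x, x)), z.2 ∈ V ×ˢ V :=
        ((hr.isOpen.prod hr.isOpen).preimage continuous_snd).mem_nhds
          (show ((0 : ℝ), (x, x)) ∈ _ from ⟨hxV, hxV⟩)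
      filter_upwards [htend.eventually hb, hVn] with z hz1 hzV hzM he
      simp only [hr.eq_self _ hzV.1 hzM.1, hr.eq_self _ hzV.2 hzM.2] at hz1
      rw [Prod.mk_sub_mk, sub_self, hz, he] at hz1
      have h3 : φ z.1 z.2.2 - z.2.1 - (φ z.1 z.2.2 - z.2.2) - 0 = -(z.2.1 - z.2.2) := by abel
      rw [h3, norm_neg, Prod.norm_mk, norm_zero, max_eq_right (norm_nonneg _)] at hz1
      have h4 : ‖z.2.1 - z.2.2‖ ≤ 0 := by linarith
      exact sub_eq_zero.1 (norm_le_zero_iff.1 h4)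
    · have hcx := hφ.continuousOn (0, x) ⟨h0, hx⟩
      have hcy := hφ.continuousOn (0, y) ⟨h0, hy⟩
      have h1 : ContinuousWithinAt (fun z : ℝ × (Euc n × Euc n) => φ z.1 z.2.1)
          (I ×ˢ (M ×ˢ M)) (0, (x, y)) :=
        hcx.comp (f := fun z : ℝ × (Euc n × Euc n) => (z.1, z.2.1)) (x := (0, (x, y)))
          (by fun_prop) fun z hz => ⟨hz.1, hz.2.1⟩
      have h2 : ContinuousWithinAt (fun z : ℝ × (Euc n × Euc n) => φ z.1 z.2.2)
          (I ×ˢ (M ×ˢ M)) (0, (x, y)) :=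
        hcy.comp (f := fun z : ℝ × (Euc n × Euc n) => (z.1, z.2.2)) (x := (0, (x, y)))
          (by fun_prop) fun z (hz : z ∈ I ×ˢ (M ×ˢ M)) => ⟨hz.1, hz.2.2⟩
      have h3 := (h1.prodMk h2).eventually
        (isOpen_ne_fun continuous_fst continuous_snd |>.mem_nhds
          (show (φ 0 x, φ 0 y) ∈ {p : Euc n × Euc n | p.1 ≠ p.2} by
            simpa [hid x hx, hid y hy] using hxy))
      rw [eventually_nhdsWithin_iff] at h3
      filter_upwards [h3, hIn] with z hz hzI hzM he
      exact absurd he (hz (show z ∈ I ×ˢ (M ×ˢ M) from ⟨hzI, hzM⟩))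
  filter_upwards [h] with t ht x hx y hy hxy
  exact ht (x, y) ⟨hx, hy⟩ ⟨hx, hy⟩ hxy

end Uniformity

section Leibniz

variable {I : Set ℝ} {h : ℝ × Euc n → ℝ}

/-- Derivatives within I × M need not be unique, but their value on (1,0) is, since I is open.
Evaluating a local continuous choice of derivative there gives continuity. -/
theorem hasDerivAt_and_continuousOn_deriv (hI : IsOpen I) (hh : ContDiffOn ℝ 1 h (I ×ˢ M)) :
    (∀ t ∈ I, ∀ x ∈ M, HasDerivAt (fun s => h (s, x)) (deriv (fun s => h (s, x)) t) t) ∧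
      ContinuousOn (fun q : ℝ × Euc n => deriv (fun s => h (s, q.2)) q.1) (I ×ˢ M) := by
  have key : ∀ q ∈ I ×ˢ M, ∀ h' : ℝ × Euc n →L[ℝ] ℝ, HasFDerivWithinAt h h' (I ×ˢ M) q →
      HasDerivAt (fun s => h (s, q.2)) (h' (1, 0)) q.1 := by
    intro q hq h' hd
    have h1 : HasDerivWithinAt (fun s : ℝ => (s, q.2)) ((1, 0) : ℝ × Euc n) I q.1 :=
      ((hasDerivAt_id q.1).prodMk (hasDerivAt_const q.1 q.2)).hasDerivWithinAt
    have h2 : MapsTo (fun s : ℝ => (s, q.2)) I (I ×ˢ M) := fun s hs => ⟨hs, hq.2⟩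
    exact (hd.comp_hasDerivWithinAt q.1 h1 h2).hasDerivAt (hI.mem_nhds hq.1)
  constructor
  · intro t ht x hx
    exact (key (t, x) ⟨ht, hx⟩ _ (hh.differentiableOn (by simp) (t, x)
      ⟨ht, hx⟩).hasFDerivWithinAt).differentiableAt.hasDerivAt
  · intro q hq
    have h1 : ContDiffWithinAt ℝ (0 + 1) h (I ×ˢ M) q := by simpa using hh q hq
    rw [contDiffWithinAt_succ_iff_hasFDerivWithinAt' (by simp), insert_eq_of_mem hq] at h1
    obtain ⟨u, hu, huS, -, h', hd, hc⟩ := h1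
    have h2 : ContinuousWithinAt (fun q => h' q (1, 0)) (I ×ˢ M) q :=
      hc.continuousWithinAt.clm_apply continuousWithinAt_const
    refine h2.congr_of_eventuallyEq ?_ (key q hq _ (hd q (mem_of_mem_nhdsWithin hq hu))).deriv
    filter_upwards [hu] with z hz using (key z (huS hz) _ (hd z hz)).deriv

/-- Differentiation under the integral sign. -/
theorem IsC2Submanifold.hasDerivAt_integral (hM : IsC2Submanifold k M) (hc : IsCompact M)
    {τ : ℝ} (hτ : 0 < τ) (hh : ContDiffOn ℝ 1 h (Ioo (-τ) τ ×ˢ M)) :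
    HasDerivAt (fun t => ∫ x in M, h (t, x) ∂μHE[k])
      (∫ x in M, deriv (fun s => h (s, x)) 0 ∂μHE[k]) 0 := by
  obtain ⟨hd, hdc⟩ := hasDerivAt_and_continuousOn_deriv isOpen_Ioo hh
  -- A compact subinterval supplies a uniform bound on the time derivative, the dominating constant.
  have hsub : Icc (-(τ / 2)) (τ / 2) ⊆ Ioo (-τ) τ := fun t ht =>
    ⟨by linarith [ht.1], by linarith [ht.2]⟩
  obtain ⟨C, hC⟩ := (isCompact_Icc.prod hc).exists_bound_of_continuousOn
    (hdc.mono (prod_mono hsub Subset.rfl))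
  have h0 : (0 : ℝ) ∈ Ioo (-τ) τ := ⟨by linarith, hτ⟩
  have hcont : ∀ t ∈ Ioo (-τ) τ, ContinuousOn (fun x => h (t, x)) M := fun t ht =>
    hh.continuousOn.comp (f := fun x => (t, x)) (by fun_prop) fun x hx => ⟨ht, hx⟩
  have hcont' : ContinuousOn (fun x => deriv (fun s => h (s, x)) 0) M :=
    hdc.comp (f := fun x => ((0 : ℝ), x)) (by fun_prop) fun x hx => ⟨h0, hx⟩
  have hms := hc.measurableSet
  have hae : ∀ {p : Euc n → Prop}, (∀ x ∈ M, p x) → ∀ᵐ x ∂(μHE[k].restrict M), p x := fun hp =>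
    (ae_restrict_iff' hms).2 (Eventually.of_forall hp)
  refine (hasDerivAt_integral_of_dominated_loc_of_deriv_le (μ := μHE[k].restrict M)
    (F := fun t x => h (t, x)) (F' := fun t x => deriv (fun s => h (s, x)) t)
    (s := Icc (-(τ / 2)) (τ / 2)) (bound := fun _ => C)
    (Icc_mem_nhds (by linarith) (by linarith)) ?_ (hM.integrableOn hc (hcont 0 h0))
    (hcont'.aestronglyMeasurable hms) ?_ ?_ ?_).2
  · filter_upwards [isOpen_Ioo.mem_nhds h0] with t ht
    exact (hcont t ht).aestronglyMeasurable hms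
  · exact hae fun x hx t ht => hC (t, x) ⟨ht, hx⟩
  · exact hM.integrableOn hc continuousOn_const
  · exact hae fun x hx t ht => hd t (hsub ht) x hx

end Leibniz

theorem jacobian_tangentProj_self (x : Euc n) :
    jacobian (tangentProj M x) (tangentProj M x) = 1 := by
  have h := tangentProj_mul_self (M := M) (x := x)
  rw [jacobian, show star (tangentProj M x) = tangentProj M x from star_starProjection _, h, h, h,
    add_sub_cancel]
  simp [ContinuousLinearMap.det]

/-- A compact minimal submanifold of the sphere is stationary for the weight `|x|⁻ᵏ`. -/
theorem IsC2Submanifold.isFStationary (hM : IsC2Submanifold k M) (hc : IsCompact M) {R : ℝ}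
    (hR : 0 < R) (hmin : IsMinimalInSphere R M) (U : Set (Euc n)) :
    IsFStationary (fun x => ‖x‖ ^ (-(k : ℤ))) k U M := by
  intro ε φ hφ
  have h0 : (0 : ℝ) ∈ Ioo (-ε) ε := ⟨by linarith [hφ.pos], hφ.pos⟩
  have hnorm : ∀ x ∈ M, ‖x‖ = R := fun x hx => mem_sphere_zero_iff_norm.1 (hmin.1 hx)
  have hne : ∀ x ∈ M, x ≠ 0 := fun x hx h => by
    have := hnorm x hx
    rw [h, norm_zero] at this
    exact hR.ne this
  set A : ℝ → Euc n → Euc n →L[ℝ] Euc n :=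
    fun t x => fderivWithin ℝ (φ t) M x ∘L tangentProj M x with hA
  have hAc := hM.contDiffOn_family_tangentialDeriv isOpen_Ioo hφ.contDiffOn
  have hPc : ContDiffOn ℝ 1 (fun q : ℝ × Euc n => tangentProj M q.2) (Ioo (-ε) ε ×ˢ M) :=
    hM.contDiffOn_tangentProj.comp contDiff_snd.contDiffOn fun q hq => hq.2
  have hA0 : ∀ x ∈ M, A 0 x = tangentProj M x := by
    intro x hx
    have : HasFDerivWithinAt (φ 0) (ContinuousLinearMap.id ℝ (Euc n)) M x :=
      (hasFDerivWithinAt_id x M).congr hφ.initial (hφ.initial x hx)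
    rw [hA]
    exact fderivWithin_comp_tangentProj this
  have hj0 : ∀ x ∈ M, jacobian (tangentProj M x) (A 0 x) = 1 := fun x hx => by
    rw [hA0 x hx, jacobian_tangentProj_self]
  have hφc := hφ.contDiffOn.continuousOn
  have ev1 : ∀ᶠ t in 𝓝 (0 : ℝ), ∀ x ∈ M, 0 < jacobian (tangentProj M x) (A t x) :=
    eventually_forall_pos (c := fun q => jacobian (tangentProj M q.2) (A q.1 q.2)) isOpen_Ioo h0 hc
      (continuousOn_jacobian_comp hPc.continuousOn hAc.continuousOn)
      fun x hx => by simp [hj0 x hx]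
  have ev2 : ∀ᶠ t in 𝓝 (0 : ℝ), ∀ x ∈ M, 0 < ‖φ t x‖ :=
    eventually_forall_pos (c := fun q => ‖φ q.1 q.2‖) isOpen_Ioo h0 hc hφc.norm
      fun x hx => by
        simp only [hφ.initial x hx]
        exact norm_pos_iff.2 (hne x hx)
  have ev3 := hM.eventually_injOn hc isOpen_Ioo h0 hφ.contDiffOn hφ.initial
  -- For |t| < τ the map φ_t is an injective immersion avoiding the origin, so the weighted area can
  -- be pulled back to M and differentiated under the integral.
  obtain ⟨τ, hτ, hball⟩ := Metric.eventually_nhds_iff_ball.1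
    (((ev1.and ev2).and ev3).and (isOpen_Ioo.eventually_mem h0))
  rw [Real.ball_eq_Ioo, zero_sub, zero_add] at hball
  set f : Euc n → ℝ := fun x => ‖x‖ ^ (-(k : ℤ)) with hf
  set h : ℝ × Euc n → ℝ := fun q => jacobian (tangentProj M q.2) (A q.1 q.2) * f (φ q.1 q.2) with hh
  have hsub : Ioo (-τ) τ ×ˢ M ⊆ Ioo (-ε) ε ×ˢ M := fun q hq => ⟨(hball q.1 hq.1).2, hq.2⟩
  have hhc : ContDiffOn ℝ 1 h (Ioo (-τ) τ ×ˢ M) := by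
    intro q hq
    refine ContDiffWithinAt.mul ?_ ?_
    · exact ((contDiffAt_jacobian ((hball q.1 hq.1).1.1.1 q.2 hq.2).ne').of_le
        le_top).comp_contDiffWithinAt q (f := fun q : ℝ × Euc n => (tangentProj M q.2, A q.1 q.2))
        (((hPc q (hsub hq)).mono hsub).prodMk ((hAc q (hsub hq)).mono hsub))
    · exact (contDiffAt_norm_zpow _ (norm_pos_iff.1 ((hball q.1 hq.1).1.1.2 q.2 hq.2))).comp_contDiffWithinAt
        q (f := fun q : ℝ × Euc n => φ q.1 q.2)
        (((hφ.contDiffOn q (hsub hq)).mono hsub).of_le (by norm_num))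
  have hE : (fun t : ℝ => weightedArea f k (φ t '' M)) =ᶠ[𝓝 0]
      fun t => ∫ x in M, h (t, x) ∂μHE[k] := by
    filter_upwards [isOpen_Ioo.mem_nhds (show (0 : ℝ) ∈ Ioo (-τ) τ from ⟨by linarith, hτ⟩)]
      with t ht
    obtain ⟨⟨⟨ht1, ht2⟩, ht3⟩, ht4⟩ := hball t ht
    have hφt : ContDiffOn ℝ 1 (φ t) M :=
      (hφ.contDiffOn.of_le (by norm_num)).comp (f := fun x => (t, x))
        (contDiff_const.prodMk contDiff_id).contDiffOn fun x hx => ⟨ht4, hx⟩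
    have him := hM.isImmersionOn hc hφt ht3 ht1
    refine him.setIntegral_image ?_
    rintro _ ⟨x, hx, rfl⟩
    exact (contDiffAt_norm_zpow _ (norm_pos_iff.1 (ht2 x hx))).continuousAt.continuousWithinAt
  set Y : Euc n → Euc n := fun x => deriv (fun s => φ s x) 0 with hY
  have hYc : ContDiffOn ℝ 1 Y M := hM.contDiffOn_family_velocity isOpen_Ioo hφ.contDiffOn h0
  -- The divergence comes from the Jacobian, the radial term from the weight |x|^{-k}; by minimality
  -- this combination integrates to zero.
  have hder : ∀ x ∈ M, deriv (fun s => h (s, x)) 0 =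
      R ^ (-(k : ℤ)) * (surfaceDiv M Y x - k / R ^ 2 * ⟪x, Y x⟫) := by
    intro x hx
    have d1 : HasDerivAt (fun s => jacobian (tangentProj M x) (A s x)) (surfaceDiv M Y x) 0 := by
      have h1 := hM.hasDerivAt_family_tangentialDeriv isOpen_Ioo hφ.contDiffOn h0 hx
      refine hasDerivAt_jacobian (tangentSpace M x) h1 ?_
      change A 0 x * tangentProj M x = tangentProj M x
      rw [hA0 x hx]
      exact tangentProj_mul_self
    obtain ⟨V, r, hxV, hr⟩ := hM.exists_retraction hx
    have d2 : HasDerivAt (fun s => φ s x) (Y x) 0 :=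
      (hr.hasDerivAt_family isOpen_Ioo hφ.contDiffOn h0 hxV hx).differentiableAt.hasDerivAt
    have d3 : HasDerivAt (fun s => f (φ s x)) _ 0 :=
      (hasFDerivAt_norm_zpow (-(k : ℤ)) (hne x hx)).comp_hasDerivAt_of_eq 0 d2
        (hφ.initial x hx).symm
    have d4 : HasDerivAt (fun s => h (s, x)) _ 0 := d1.mul d3
    rw [d4.deriv, hj0 x hx, hφ.initial x hx]
    simp only [hf, hnorm x hx]
    have e1 : R ^ (-(k : ℤ) - 2) = R ^ (-(k : ℤ)) / R ^ 2 := by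
      rw [zpow_sub₀ hR.ne']; rfl
    simp only [smul_apply, coe_innerSL_apply, smul_eq_mul, e1]
    push_cast
    ring
  refine HasDerivAt.congr_of_eventuallyEq ?_ hE
  have hres := hM.hasDerivAt_integral hc hτ hhc
  rw [setIntegral_congr_fun hc.measurableSet hder, integral_const_mul,
    hM.integral_surfaceDiv hc hR hmin hYc, mul_zero] at hres
  exact hres

end WeightedArea

/-! ### Stability inequalities and Simons' argument -/

namespace WeightedArea

open scoped Topology ENNReal
open Filter Asymptotics

variable {n k : ℕ} {M : Set (Euc n)} {R : ℝ} {X : Euc n → Euc n} {x : Euc n}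

theorem sum_inner_sq {E ι : Type*} [NormedAddCommGroup E] [InnerProductSpace ℝ E]
    [FiniteDimensional ℝ E] [Fintype ι] {T : Submodule ℝ E} (e : OrthonormalBasis ι ℝ T) (w : E) :
    ∑ j, ⟪(e j : E), w⟫ ^ 2 = ‖T.starProjection w‖ ^ 2 := by
  rw [Submodule.starProjection_apply, Submodule.norm_coe, ← e.sum_sq_norm_inner_right]
  refine Finset.sum_congr rfl fun j _ => ?_
  rw [Real.norm_eq_abs, sq_abs, Submodule.inner_orthogonalProjectionOnto_eq_of_mem_left]

/-- The projection onto the normal space of `M` in the sphere. -/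
def sphereNormalProj (M : Set (Euc n)) (x : Euc n) : Euc n →L[ℝ] Euc n :=
  (sphereNormalSpace M x).starProjection

theorem contDiffOn_sphereNormalProj (hM : IsC2Submanifold k M) (hR : 0 < R)
    (hS : M ⊆ Metric.sphere 0 R) : ContDiffOn ℝ 1 (sphereNormalProj M) M := by
  have h1 : ContDiffOn ℝ 1 (fun x : Euc n => ContinuousLinearMap.id ℝ (Euc n) - tangentProj M x -
      (R ^ 2)⁻¹ • (innerSL ℝ x).smulRight x) M := by
    refine (contDiffOn_const.sub hM.contDiffOn_tangentProj).sub (ContDiffOn.const_smul _ ?_)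
    exact ((innerSL ℝ : Euc n →L[ℝ] Euc n →L[ℝ] ℝ).contDiff.contDiffOn).smulRight contDiffOn_id
  refine h1.congr fun x hx => ?_
  ext1 v
  rw [sphereNormalProj, starProjection_sphereNormalSpace hR hS hx]
  rfl

theorem sphereNormalProj_apply_self (hR : 0 < R) (hS : M ⊆ Metric.sphere 0 R) (hx : x ∈ M) :
    sphereNormalProj M x x = 0 := by
  have hxx : ⟪x, x⟫ = R ^ 2 := by
    rw [real_inner_self_eq_norm_sq, mem_sphere_zero_iff_norm.1 (hS hx)]
  rw [sphereNormalProj, starProjection_sphereNormalSpace hR hS hx, tangentProj_apply_self hS hx,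
    hxx, smul_smul, inv_mul_cancel₀ (by positivity)]
  simp

theorem sphereNormalProj_of_mem_tangentSpace (hR : 0 < R) (hS : M ⊆ Metric.sphere 0 R)
    (hx : x ∈ M) {u : Euc n} (hu : u ∈ tangentSpace M x) : sphereNormalProj M x u = 0 := by
  rw [sphereNormalProj, starProjection_sphereNormalSpace hR hS hx, tangentProj_of_mem hu,
    inner_eq_zero_of_mem_tangentSpace hS hx hu]
  simp

/-- T_xM and the radial line span at most k + 1 ≤ n - 1 dimensions. -/
theorem one_le_finrank_sphereNormalSpace (hM : IsC2Submanifold k M) (hkn : k + 2 ≤ n)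
    (hx : x ∈ M) : 1 ≤ Module.finrank ℝ (sphereNormalSpace M x) := by
  rw [sphereNormalSpace, normalSpace, Submodule.inf_orthogonal]
  have h1 := Submodule.finrank_add_finrank_orthogonal
    (tangentSpace M x ⊔ Submodule.span ℝ {x})
  have h2 := Submodule.finrank_add_le_finrank_add_finrank (tangentSpace M x)
    (Submodule.span ℝ {x})
  have h3 : Module.finrank ℝ (Submodule.span ℝ {x}) ≤ 1 :=
    (finrank_span_le_card {x}).trans (by simp)
  rw [hM.finrank_tangentSpace hx] at h2
  rw [finrank_euclideanSpace_fin] at h1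
  omega

section SphericalField

theorem IsSphericalNormalField.tangentProj_eq_zero (hX : IsSphericalNormalField M X)
    (hx : x ∈ M) : tangentProj M x (X x) = 0 :=
  (mem_sphereNormalSpace_iff.1 (hX.normal x hx)).1

theorem IsSphericalNormalField.inner_eq_zero (hX : IsSphericalNormalField M X)
    (hx : x ∈ M) : ⟪x, X x⟫ = 0 :=
  (mem_sphereNormalSpace_iff.1 (hX.normal x hx)).2

theorem IsSphericalNormalField.hasFDerivWithinAt (hX : IsSphericalNormalField M X) (hx : x ∈ M) :
    HasFDerivWithinAt X (fderivWithin ℝ X M x) M x :=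
  (hX.contDiffOn.differentiableOn (by simp) x hx).hasFDerivWithinAt

/-- Differentiate ⟨y,X⟩ = 0 along u and use ⟨u,X⟩ = 0. -/
theorem IsSphericalNormalField.inner_tangentialDeriv (hX : IsSphericalNormalField M X)
    (hx : x ∈ M) {u : Euc n} (hu : u ∈ tangentSpace M x) :
    ⟪x, tangentialDeriv M X x u⟫ = 0 := by
  have h1 : HasFDerivWithinAt (fun y : Euc n => ⟪y, X y⟫) _ M x :=
    (hasFDerivWithinAt_id x M).inner ℝ (hX.hasFDerivWithinAt hx)
  have h2 : HasFDerivWithinAt (fun y : Euc n => ⟪y, X y⟫) (0 : Euc n →L[ℝ] ℝ) M x :=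
    (hasFDerivWithinAt_const (0 : ℝ) x M).congr (fun y hy => hX.inner_eq_zero hy)
      (hX.inner_eq_zero hx)
  have h3 := fderivWithin_of_mem_tangentSpace h1 hu
  rw [fderivWithin_of_mem_tangentSpace h2 hu] at h3
  simp only [zero_apply, ContinuousLinearMap.comp_apply, ContinuousLinearMap.prod_apply,
    ContinuousLinearMap.id_apply, fderivInnerCLM_apply, id] at h3
  have h4 : ⟪u, X x⟫ = 0 := by
    have := (hX.normal x hx).1
    exact (Submodule.mem_orthogonal _ _).1 this u hu
  rw [h4, add_zero] at h3
  exact h3.symm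

theorem IsSphericalNormalField.starProjection_normalSpace (hX : IsSphericalNormalField M X)
    (hR : 0 < R) (hS : M ⊆ Metric.sphere 0 R) (hx : x ∈ M) {u : Euc n}
    (hu : u ∈ tangentSpace M x) :
    (normalSpace M x).starProjection (tangentialDeriv M X x u) =
      (sphereNormalSpace M x).starProjection (tangentialDeriv M X x u) := by
  rw [WeightedArea.starProjection_normalSpace, starProjection_sphereNormalSpace hR hS hx,
    hX.inner_tangentialDeriv hx hu]
  simp

theorem IsSphericalNormalField.inner_secondFundamentalForm (hX : IsSphericalNormalField M X)
    (hx : x ∈ M) (u v : Euc n) :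
    ⟪secondFundamentalForm M x u v, X x⟫ = ⟪sphereSecondFundamentalForm M x u v, X x⟫ := by
  rw [secondFundamentalForm, sphereSecondFundamentalForm,
    Submodule.inner_starProjection_left_eq_right, Submodule.inner_starProjection_left_eq_right,
    Submodule.starProjection_eq_self_iff.2 (hX.normal x hx),
    Submodule.starProjection_eq_self_iff.2 (hX.normal x hx).1]

/-- Weingarten's relation, from differentiating PX = 0. It expresses the curvature term through
first derivatives of X, whose continuity is known. -/
theorem IsSphericalNormalField.inner_sphereSecondFundamentalForm
    (hX : IsSphericalNormalField M X) (hM : IsC2Submanifold k M)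
    (hx : x ∈ M) {u : Euc n} (hu : u ∈ tangentSpace M x) (v : Euc n) :
    ⟪sphereSecondFundamentalForm M x u v, X x⟫ =
      -⟪v, tangentProj M x (tangentialDeriv M X x u)⟫ := by
  rw [sphereSecondFundamentalForm, Submodule.inner_starProjection_left_eq_right,
    Submodule.starProjection_eq_self_iff.2 (hX.normal x hx),
    hM.tangentialDeriv_tangentExtension hx hu, hM.inner_projDeriv hx hu,
    hM.projDeriv_normal hx (hX.hasFDerivWithinAt hx)
      (fun y hy => hX.tangentProj_eq_zero hy) hu, inner_neg_right]
  rfl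

theorem IsSphericalNormalField.inner_meanCurvature (hX : IsSphericalNormalField M X)
    (hmin : IsMinimalInSphere R M) (hx : x ∈ M) : ⟪meanCurvature M x, X x⟫ = 0 := by
  rw [meanCurvature, sum_inner]
  simp only [hX.inner_secondFundamentalForm hx]
  rw [← sum_inner, hmin.2 x hx, inner_zero_left]

/-- The square `∑ ⟪B(eᵢ,eⱼ),X⟫²` of the component of the second fundamental form along `X`. -/
def shapeNormSq (M : Set (Euc n)) (X : Euc n → Euc n) (p : Euc n) : ℝ :=
  ∑ i, ∑ j,
    ⟪sphereSecondFundamentalForm M p (tangentFrame M p i) (tangentFrame M p j), X p⟫ ^ 2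

/-- The square `|∇^⊥ X|²` of the normal derivative. -/
def normalDerivNormSq (M : Set (Euc n)) (X : Euc n → Euc n) (p : Euc n) : ℝ :=
  ∑ i, ‖(sphereNormalSpace M p).starProjection (tangentialDeriv M X p (tangentFrame M p i))‖ ^ 2

/-- The double sum is the squared Hilbert-Schmidt norm of P∘DX∘P, hence continuous although the
frame may not be. -/
theorem IsSphericalNormalField.continuousOn_shapeNormSq (hX : IsSphericalNormalField M X)
    (hM : IsC2Submanifold k M) : ContinuousOn (shapeNormSq M X) M := by
  have h1 : ContinuousOn (fun x => hsNormSq (tangentProj M x *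
      (fderivWithin ℝ X M x ∘L tangentProj M x))) M :=
    continuous_hsNormSq.comp_continuousOn
      (hM.contDiffOn_tangentProj.continuousOn.mul (hM.continuousOn_tangentialDeriv hX.contDiffOn))
  refine h1.congr fun x hx => ?_
  have h2 : tangentProj M x * (fderivWithin ℝ X M x ∘L tangentProj M x) =
    (tangentProj M x * fderivWithin ℝ X M x) * (tangentSpace M x).starProjection := rfl
  simp only [h2, hsNormSq_mul_starProjection _ _ (tangentFrame M x)]
  refine Finset.sum_congr rfl fun i _ => ?_
  simp only [hX.inner_sphereSecondFundamentalForm hM hx (tangentFrame M x i).2, neg_sq]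
  rw [sum_inner_sq]
  congr 2
  exact tangentProj_of_mem (tangentProj_mem _)

theorem IsSphericalNormalField.continuousOn_normalDerivNormSq (hX : IsSphericalNormalField M X)
    (hM : IsC2Submanifold k M) (hR : 0 < R) (hS : M ⊆ Metric.sphere 0 R) :
    ContinuousOn (normalDerivNormSq M X) M := by
  have h1 : ContinuousOn (fun x => hsNormSq (sphereNormalProj M x *
      (fderivWithin ℝ X M x ∘L tangentProj M x))) M :=
    continuous_hsNormSq.comp_continuousOn
      ((contDiffOn_sphereNormalProj hM hR hS).continuousOn.mul
        (hM.continuousOn_tangentialDeriv hX.contDiffOn))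
  refine h1.congr fun x hx => ?_
  have h2 : sphereNormalProj M x * (fderivWithin ℝ X M x ∘L tangentProj M x) =
    (sphereNormalProj M x * fderivWithin ℝ X M x) * (tangentSpace M x).starProjection := rfl
  simp only [h2, hsNormSq_mul_starProjection _ _ (tangentFrame M x)]
  rfl

theorem IsSphericalNormalField.continuousOn_norm_sq (hX : IsSphericalNormalField M X) :
    ContinuousOn (fun x => ‖X x‖ ^ 2) M :=
  hX.contDiffOn.continuousOn.norm.pow 2

/-- For fields tangent to the sphere, `f`-stability is stability for the area in the sphere. -/
theorem IsSphericalNormalField.fStabilityInequality_iff (hX : IsSphericalNormalField M X)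
    (hM : IsC2Submanifold k M) (hc : IsCompact M) (hR : 0 < R) (hmin : IsMinimalInSphere R M) :
    FStabilityInequality (fun x => ‖x‖ ^ (-(k : ℤ))) k M X ↔
      SphereAreaStabilityInequality k R M X := by
  have hS := hmin.1
  have i1 := hM.integrableOn hc (hX.continuousOn_shapeNormSq hM)
  have i2 := hM.integrableOn hc (hX.continuousOn_normalDerivNormSq hM hR hS)
  have i3 := hM.integrableOn hc hX.continuousOn_norm_sq
  have hnorm : ∀ x ∈ M, ‖x‖ = R := fun x hx => mem_sphere_zero_iff_norm.1 (hS hx)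
  have e1 : R ^ (-(k : ℤ) - 2) = R ^ (-(k : ℤ)) / R ^ 2 := by
    rw [zpow_sub₀ hR.ne']; rfl
  have hl : ∀ p ∈ M, ‖p‖ ^ (-(k : ℤ)) * ((∑ i, ∑ j,
        ⟪secondFundamentalForm M p (tangentFrame M p i) (tangentFrame M p j), X p⟫ ^ 2)
      + ⟪meanCurvature M p, X p⟫ ^ 2) = R ^ (-(k : ℤ)) * shapeNormSq M X p := by
    intro p hp
    rw [hnorm p hp, hX.inner_meanCurvature hmin hp]
    simp [shapeNormSq, hX.inner_secondFundamentalForm hp]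
  -- The Hessian term is negative; moved to the other side, it is the term (k/R²)|X|² of the
  -- inequality in the sphere.
  have hr : ∀ p ∈ M, ‖p‖ ^ (-(k : ℤ)) * (∑ i, ‖(normalSpace M p).starProjection
        (tangentialDeriv M X p (tangentFrame M p i))‖ ^ 2)
      + fderiv ℝ (fderiv ℝ fun x : Euc n => ‖x‖ ^ (-(k : ℤ))) p (X p) (X p) =
      R ^ (-(k : ℤ)) * (normalDerivNormSq M X p - k / R ^ 2 * ‖X p‖ ^ 2) := by
    intro p hp
    have hp0 : p ≠ 0 := norm_pos_iff.1 (by rw [hnorm p hp]; exact hR)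
    rw [hessian_norm_zpow _ hp0 (hX.inner_eq_zero hp), hnorm p hp, e1, normalDerivNormSq]
    simp only [hX.starProjection_normalSpace hR hS hp (tangentFrame M p _).2]
    push_cast
    ring
  unfold FStabilityInequality SphereAreaStabilityInequality
  rw [setIntegral_congr_fun hc.measurableSet hl, setIntegral_congr_fun hc.measurableSet hr,
    integral_const_mul, integral_const_mul, mul_le_mul_iff_right₀ (zpow_pos hR _)]
  change _ ↔ ∫ p in M, (shapeNormSq M X p + k / R ^ 2 * ‖X p‖ ^ 2) ∂μHE[k] ≤
    ∫ p in M, normalDerivNormSq M X p ∂μHE[k]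
  rw [integral_sub i2 (i3.const_mul _), integral_add i1 (i3.const_mul _), le_sub_iff_add_le]

end SphericalField

section ConstantField

variable (hM : IsC2Submanifold k M) (hR : 0 < R) (hS : M ⊆ Metric.sphere 0 R)
include hM hR hS

/-- The normal components of constant fields. -/
theorem isSphericalNormalField_sphereNormalProj (b : Euc n) :
    IsSphericalNormalField M fun x => sphereNormalProj M x b where
  contDiffOn := (contDiffOn_sphereNormalProj hM hR hS).clm_apply contDiffOn_const
  normal _ _ := Submodule.starProjection_apply_mem _ _

/-- Write N for the projection and Nb = b - Pb - R⁻²⟨x,b⟩x. The derivative of the last term is a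
combination of x and u, both killed by N. -/
theorem sphereNormalProj_tangentialDeriv (hx : x ∈ M) {u : Euc n} (hu : u ∈ tangentSpace M x)
    (b : Euc n) :
    sphereNormalProj M x (tangentialDeriv M (fun x => sphereNormalProj M x b) x u) =
      -(sphereNormalProj M x * projDeriv M x u) b := by
  have h1 : HasFDerivWithinAt
      (fun y : Euc n => b - tangentProj M y b - (R ^ 2)⁻¹ • ⟪y, b⟫ • y) _ M x :=
    ((hasFDerivWithinAt_const b x M).sub ((hM.hasFDerivWithinAt_tangentProj hx).clm_apply
      (hasFDerivWithinAt_const b x M))).sub ((((hasFDerivWithinAt_id x M).inner ℝ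
        (hasFDerivWithinAt_const b x M)).smul (hasFDerivWithinAt_id x M)).const_smul (R ^ 2)⁻¹)
  have h2 := h1.congr (fun y hy => starProjection_sphereNormalSpace hR hS hy b)
    (starProjection_sphereNormalSpace hR hS hx b)
  have h3 : tangentialDeriv M (fun x => sphereNormalProj M x b) x u = _ :=
    fderivWithin_of_mem_tangentSpace h2 hu
  rw [h3]
  simp [projDeriv, sphereNormalProj_apply_self hR hS hx,
    sphereNormalProj_of_mem_tangentSpace hR hS hx hu]

/-- Insert DP = P·DP + DP·P and NP = 0. Consequently the normal derivative of Nb in the direction u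
is -B^S(u, b^⊤). -/
theorem sphereNormalProj_mul_projDeriv (hx : x ∈ M) {u : Euc n} (hu : u ∈ tangentSpace M x) :
    sphereNormalProj M x * projDeriv M x u =
      sphereNormalProj M x * projDeriv M x u * (tangentSpace M x).starProjection := by
  have h0 : sphereNormalProj M x * tangentProj M x = 0 := by
    ext1 v
    exact sphereNormalProj_of_mem_tangentSpace hR hS hx (tangentProj_mem v)
  conv_lhs => rw [hM.projDeriv_eq hx hu, mul_add, ← mul_assoc, h0, zero_mul, zero_add]
  rfl

/-- Both sides are |B^S|²: for each e_i the Hilbert-Schmidt norm of N·DP(e_i) is computed once in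
the basis b and once in the tangent frame. -/
theorem sum_normalDerivNormSq {ι : Type*} [Fintype ι] (b : OrthonormalBasis ι ℝ (Euc n))
    (hx : x ∈ M) :
    ∑ a, normalDerivNormSq M (fun x => sphereNormalProj M x (b a)) x =
      ∑ a, shapeNormSq M (fun x => sphereNormalProj M x (b a)) x := by
  have hT := fun i => (tangentFrame M x i).2
  have h1 : ∀ i j : Fin (Module.finrank ℝ (tangentSpace M x)),
      ∑ a, ⟪sphereSecondFundamentalForm M x (tangentFrame M x i) (tangentFrame M x j),
        sphereNormalProj M x (b a)⟫ ^ 2 =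
      ‖(sphereNormalProj M x * projDeriv M x (tangentFrame M x i)) (tangentFrame M x j)‖ ^ 2 := by
    intro i j
    rw [← b.sum_sq_norm_inner_left]
    refine Finset.sum_congr rfl fun a _ => ?_
    rw [sphereSecondFundamentalForm, hM.tangentialDeriv_tangentExtension hx (hT i),
      Real.norm_eq_abs, sq_abs, sphereNormalProj, ← Submodule.inner_starProjection_left_eq_right,
      Submodule.starProjection_eq_self_iff.2 (Submodule.starProjection_apply_mem _ _)]
    rfl
  simp only [normalDerivNormSq, shapeNormSq]
  rw [Finset.sum_comm, Finset.sum_comm (s := Finset.univ (α := ι))]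
  refine Finset.sum_congr rfl fun i _ => ?_
  rw [Finset.sum_comm]
  simp only [h1]
  rw [← hsNormSq_mul_starProjection, ← sphereNormalProj_mul_projDeriv hM hR hS hx (hT i),
    hsNormSq_eq_sum _ b]
  refine Finset.sum_congr rfl fun a _ => ?_
  rw [← norm_neg ((sphereNormalProj M x * _) (b a)),
    ← sphereNormalProj_tangentialDeriv hM hR hS hx (hT i)]
  rfl

/-- The sum is the squared Hilbert-Schmidt norm of an orthogonal projection, that is, its rank. -/
theorem one_le_sum_norm_sphereNormalProj {ι : Type*} [Fintype ι] (hkn : k + 2 ≤ n)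
    (b : OrthonormalBasis ι ℝ (Euc n)) (hx : x ∈ M) :
    1 ≤ ∑ a, ‖sphereNormalProj M x (b a)‖ ^ 2 := by
  have h1 := hsNormSq_mul_starProjection (sphereNormalSpace M x) (1 : Euc n →L[ℝ] Euc n)
    (stdOrthonormalBasis ℝ _)
  rw [one_mul, hsNormSq_eq_sum _ b] at h1
  change 1 ≤ ∑ a, ‖(sphereNormalSpace M x).starProjection (b a)‖ ^ 2
  rw [h1]
  simp only [one_apply_eq_self, Submodule.norm_coe, OrthonormalBasis.norm_eq_one]
  simpa using one_le_finrank_sphereNormalSpace hM hkn hx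

/-- Compact minimal submanifolds of the sphere of codimension at least one are unstable. -/
theorem exists_not_sphereAreaStabilityInequality (hc : IsCompact M) (hne : M.Nonempty)
    (hk : 1 ≤ k) (hkn : k + 2 ≤ n) :
    ∃ X, IsSphericalNormalField M X ∧ ¬ SphereAreaStabilityInequality k R M X := by
  by_contra! hcon
  let b := stdOrthonormalBasis ℝ (Euc n)
  have hX := fun a => isSphericalNormalField_sphereNormalProj hM hR hS (b a)
  set Y : Fin (Module.finrank ℝ (Euc n)) → Euc n → Euc n :=
    fun a x => sphereNormalProj M x (b a) with hY
  have i1 := fun a => hM.integrableOn hc ((hX a).continuousOn_shapeNormSq hM)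
  have i2 := fun a => hM.integrableOn hc ((hX a).continuousOn_normalDerivNormSq hM hR hS)
  have i3 := fun a => hM.integrableOn hc (hX a).continuousOn_norm_sq
  have h1 : ∀ a, ∫ p in M, shapeNormSq M (Y a) p ∂μHE[k] +
      k / R ^ 2 * ∫ p in M, ‖Y a p‖ ^ 2 ∂μHE[k] ≤
      ∫ p in M, normalDerivNormSq M (Y a) p ∂μHE[k] := by
    intro a
    rw [← integral_const_mul, ← integral_add (i1 a) ((i3 a).const_mul _)]
    exact hcon _ (hX a)
  -- After summation the curvature and derivative integrals cancel, leaving (k/R²)∫∑|Y_a|² ≤ 0.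
  have h2 := Finset.sum_le_sum fun a (_ : a ∈ Finset.univ) => h1 a
  rw [Finset.sum_add_distrib, ← Finset.mul_sum, ← integral_finsetSum _ fun a _ => i1 a,
    ← integral_finsetSum _ fun a _ => i2 a, ← integral_finsetSum _ fun a _ => i3 a,
    setIntegral_congr_fun hc.measurableSet fun x hx => sum_normalDerivNormSq hM hR hS b hx,
    add_le_iff_nonpos_right] at h2
  have hμ := hM.measure_lt_top hc
  have h3 : μHE[k].real M ≤ ∫ p in M, ∑ a, ‖Y a p‖ ^ 2 ∂μHE[k] := by
    have h4 : ∫ _ in M, (1 : ℝ) ∂μHE[k] = μHE[k].real M := by simp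
    rw [← h4]
    refine setIntegral_mono_on (integrableOn_const hμ.ne) (integrable_finsetSum _ fun a _ => i3 a)
      hc.measurableSet fun x hx => ?_
    exact one_le_sum_norm_sphereNormalProj hM hR hS hkn b hx
  have h5 : 0 < μHE[k].real M := ENNReal.toReal_pos (hM.measure_pos hne).ne' hμ.ne
  have h6 : (0 : ℝ) < k / R ^ 2 := by positivity
  have h7 := mul_pos h6 (h5.trans_le h3)
  linarith

end ConstantField

end WeightedArea

end

/-! ### The theorem -/

theorem theorem1p5 (n k : ℕ) (hk : 1 ≤ k) (hkn : k + 2 ≤ n) (R : ℝ) (hR : 0 < R)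
    (M : Set (WeightedArea.Euc n)) (hM : WeightedArea.IsC2Submanifold k M)
    (hne : M.Nonempty) (hcpt : IsCompact M) (hmin : WeightedArea.IsMinimalInSphere R M)
    (U : Set (WeightedArea.Euc n)) (hU : IsOpen U) (hMU : M ⊆ U) :
    WeightedArea.IsFUnstable (fun x => ‖x‖ ^ (-(k : ℤ))) k U M ∧
    (∀ X : WeightedArea.Euc n → WeightedArea.Euc n, WeightedArea.IsSphericalNormalField M X →
      (WeightedArea.FStabilityInequality (fun x => ‖x‖ ^ (-(k : ℤ))) k M X ↔
        WeightedArea.SphereAreaStabilityInequality k R M X)) ∧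
    (∃ X : WeightedArea.Euc n → WeightedArea.Euc n, WeightedArea.IsSphericalNormalField M X ∧
      ¬ WeightedArea.SphereAreaStabilityInequality k R M X) := by
  obtain ⟨X, hX, hXn⟩ :=
    WeightedArea.exists_not_sphereAreaStabilityInequality hM hR hmin.1 hcpt hne hk hkn
  refine ⟨⟨hM.isFStationary hcpt hR hmin U, fun hst => hXn ?_⟩,
    fun Y hY => hY.fStabilityInequality_iff hM hcpt hR hmin, X, hX, hXn⟩
  -- Since M is compact and contained in U, it serves itself as the compact support of X.
  refine (hX.fStabilityInequality_iff hM hcpt hR hmin).1 (hst.2 X ⟨hX.contDiffOn,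
    fun p hp => (hX.normal p hp).1, M, hcpt, hMU, fun p hp => absurd hp.1 hp.2⟩)
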